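/- Let $M^n$, $n\ge 3$, be a closed (compact, boundaryless) smooth manifold, $g$ a smooth Riemannian metric on $M$ with constant scalar curvature $R_g$ and volume $1$, and $f$ a non-constant smooth function on $M$ such that $(M^n,g,f)$ is a CPE metric, that is, $$\nabla^2_g f-(\Delta_g f)\,g-f\,\mathrm{Ric}_g=\mathring{\mathrm{Ric}}_g,\qquad \mathring{\mathrm{Ric}}_g=\mathrm{Ric}_g-\frac{R_g}{n}g .$$ Let $\sigma_2(g)$ be the second elementary symmetric function of the eigenvalues, with respect to $g$, of the tensor $A_g=\mathrm{Ric}_g-\frac{R_g}{2(n-1)}g$. Let $\Lambda_g(h)=\frac{d}{dt}\big|_{t=0}\sigma_2(g+th)$, for smooth symmetric $2$-tensor fields $h$, be the linearization of the $\sigma_2$-curvature at $g$, and let $\Lambda_g^*$ be its formal $L^2$-adjoint, so that $\Lambda_g^*(f)$ is the smooth symmetric $2$-tensor field $S$ with $$\int_M\langle S,h\rangle_g\,dv_g=\int_M f\,\Lambda_g(h)\,dv_g\quad\text{for all smooth symmetric } 2\text{-tensor fields } h .$$ Then $(M,g)$ is Einstein (that is, $\mathrm{Ric}_g=c\,g$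 for a constant $c$) if and only if $f\in\ker\Lambda_g^*$; equivalently, if and only if $(M^n,g,f)$ is a $\sigma_2$-singular space, i.e. $f$ is a nontrivial element of $\ker\Lambda_g^*$. -/

import Mathlib

open scoped Manifold ContDiff Bundle

noncomputable section

namespace CPESigma2

/-! ### Tensor calculus in a coordinate domain

`G` is the coordinate matrix of a metric as a function on (an open part of) `ℝⁿ`. -/

/-- The partial derivative `∂ᵢ u` at `y`. -/
def partialDeriv {n : ℕ} (i : Fin n) (u : EuclideanSpace ℝ (Fin n) → ℝ)
    (y : EuclideanSpace ℝ (Fin n)) : ℝ :=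
  fderiv ℝ u y (EuclideanSpace.single i 1)

/-- The Christoffel symbol
`Γᵏᵢⱼ = ½ ∑ₗ Gᵏˡ (∂ᵢ Gⱼₗ + ∂ⱼ Gᵢₗ - ∂ₗ Gᵢⱼ)` of the Levi-Civita connection. -/
def christoffel {n : ℕ} (G : EuclideanSpace ℝ (Fin n) → Matrix (Fin n) (Fin n) ℝ)
    (k i j : Fin n) (y : EuclideanSpace ℝ (Fin n)) : ℝ :=
  (1 / 2) * ∑ l, (G y)⁻¹ k l *
    (partialDeriv i (fun z => G z j l) y + partialDeriv j (fun z => G z i l) y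
      - partialDeriv l (fun z => G z i j) y)

/-- The coordinate matrix of the Ricci tensor,
`Rᵢⱼ = ∂ₖ Γᵏᵢⱼ - ∂ᵢ Γᵏₖⱼ + Γᵏₖₗ Γˡᵢⱼ - Γᵏᵢₗ Γˡₖⱼ` (summed over repeated indices). -/
def ricciCoord {n : ℕ} (G : EuclideanSpace ℝ (Fin n) → Matrix (Fin n) (Fin n) ℝ)
    (y : EuclideanSpace ℝ (Fin n)) : Matrix (Fin n) (Fin n) ℝ :=
  Matrix.of fun i j =>
    ∑ k, (partialDeriv k (christoffel G k i j) y - partialDeriv i (christoffel G k k j) y)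
    + ∑ k, ∑ l, (christoffel G k k l y * christoffel G l i j y
        - christoffel G k i l y * christoffel G l k j y)

/-- The metric trace `Gⁱʲ Aᵢⱼ` of a symmetric covariant 2-tensor is `tr (G⁻¹ A)`;
the scalar curvature is the metric trace of the Ricci tensor. -/
def scalarCoord {n : ℕ} (G : EuclideanSpace ℝ (Fin n) → Matrix (Fin n) (Fin n) ℝ)
    (y : EuclideanSpace ℝ (Fin n)) : ℝ :=
  Matrix.trace ((G y)⁻¹ * ricciCoord G y)

/-- The coordinate matrix of the tensor `A = Ric - R / (2 (n - 1)) g`. -/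
def schoutenCoord {n : ℕ} (G : EuclideanSpace ℝ (Fin n) → Matrix (Fin n) (Fin n) ℝ)
    (y : EuclideanSpace ℝ (Fin n)) : Matrix (Fin n) (Fin n) ℝ :=
  ricciCoord G y - (scalarCoord G y / (2 * ((n : ℝ) - 1))) • G y

/-- The second elementary symmetric function of the eigenvalues (with multiplicity) of
`A = Ric - R / (2 (n - 1)) g` with respect to `g`, that is, of the endomorphism `G⁻¹ A`. -/
def sigmaTwoCoord {n : ℕ} (G : EuclideanSpace ℝ (Fin n) → Matrix (Fin n) (Fin n) ℝ)
    (y : EuclideanSpace ℝ (Fin n)) : ℝ :=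
  ((G y)⁻¹ * schoutenCoord G y).charpoly.roots.esymm 2

/-- The coordinate matrix `∂ᵢ ∂ⱼ u - Γᵏᵢⱼ ∂ₖ u` of the Hessian of `u`. -/
def hessianCoord {n : ℕ} (G : EuclideanSpace ℝ (Fin n) → Matrix (Fin n) (Fin n) ℝ)
    (u : EuclideanSpace ℝ (Fin n) → ℝ) (y : EuclideanSpace ℝ (Fin n)) :
    Matrix (Fin n) (Fin n) ℝ :=
  Matrix.of fun i j =>
    partialDeriv i (partialDeriv j u) y - ∑ k, christoffel G k i j y * partialDeriv k u y

/-! ### Tensors and curvature on a manifold -/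

/-- Fields of bilinear forms on the tangent spaces of an `n`-manifold `M`. -/
abbrev TwoTensorField (n : ℕ) (M : Type*) [TopologicalSpace M]
    [ChartedSpace (EuclideanSpace ℝ (Fin n)) M] :=
  ∀ x : M, TangentSpace (𝓡 n) x →L[ℝ] TangentSpace (𝓡 n) x →L[ℝ] ℝ

/-- Smooth Riemannian metrics on `M`. -/
abbrev Metric (n : ℕ) (M : Type*) [TopologicalSpace M]
    [ChartedSpace (EuclideanSpace ℝ (Fin n)) M] [IsManifold (𝓡 n) ∞ M] :=
  Bundle.ContMDiffRiemannianMetric (𝓡 n) ∞ (EuclideanSpace ℝ (Fin n))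
    (fun x : M => TangentSpace (𝓡 n) x)

section

variable {n : ℕ} {M : Type*} [TopologicalSpace M] [ChartedSpace (EuclideanSpace ℝ (Fin n)) M]

/-- `h` is a smooth symmetric covariant 2-tensor field, i.e. an element of `S₂(M)`. -/
def IsSmoothSymmetric [IsManifold (𝓡 n) ∞ M] (h : TwoTensorField n M) : Prop :=
  (∀ (x : M) (v w : TangentSpace (𝓡 n) x), h x v w = h x w v) ∧
  ContMDiff (𝓡 n)
    ((𝓡 n).prod 𝓘(ℝ, EuclideanSpace ℝ (Fin n) →L[ℝ] EuclideanSpace ℝ (Fin n) →L[ℝ] ℝ)) ∞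
    (fun x : M => Bundle.TotalSpace.mk'
      (EuclideanSpace ℝ (Fin n) →L[ℝ] EuclideanSpace ℝ (Fin n) →L[ℝ] ℝ)
      (E := fun x : M => TangentSpace (𝓡 n) x →L[ℝ] TangentSpace (𝓡 n) x →L[ℝ] ℝ) x (h x))

/-- The coordinate matrix `h(∂ᵢ, ∂ⱼ)` in the preferred chart at `x₀`, at the point with
coordinates `y`. -/
def coordMatrix (h : TwoTensorField n M) (x₀ : M) (y : EuclideanSpace ℝ (Fin n)) :
    Matrix (Fin n) (Fin n) ℝ :=
  Matrix.of fun i j =>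
    h ((extChartAt (𝓡 n) x₀).symm y)
      (mfderiv 𝓘(ℝ, EuclideanSpace ℝ (Fin n)) (𝓡 n) (extChartAt (𝓡 n) x₀).symm y
        (EuclideanSpace.single i 1))
      (mfderiv 𝓘(ℝ, EuclideanSpace ℝ (Fin n)) (𝓡 n) (extChartAt (𝓡 n) x₀).symm y
        (EuclideanSpace.single j 1))

/-- The components of a tangent vector at `x` in the preferred chart at `x`. -/
def tangentCoord (x : M) (v : TangentSpace (𝓡 n) x) : EuclideanSpace ℝ (Fin n) :=
  mfderiv (𝓡 n) 𝓘(ℝ, EuclideanSpace ℝ (Fin n)) (extChartAt (𝓡 n) x) x v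

/-- The bilinear form on `TₓM` whose matrix in the preferred chart at `x` is `A`. -/
def formOfCoord (x : M) (A : Matrix (Fin n) (Fin n) ℝ) (v w : TangentSpace (𝓡 n) x) : ℝ :=
  ∑ i, ∑ j, A i j * tangentCoord x v i * tangentCoord x w j

/-- The Ricci tensor. -/
def ricci (g : TwoTensorField n M) (x : M) (v w : TangentSpace (𝓡 n) x) : ℝ :=
  formOfCoord x (ricciCoord (coordMatrix g x) (extChartAt (𝓡 n) x x)) v w

/-- The scalar curvature. -/
def scalarCurvature (g : TwoTensorField n M) (x : M) : ℝ :=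
  scalarCoord (coordMatrix g x) (extChartAt (𝓡 n) x x)

/-- The trace-free Ricci tensor `Ric - (R / n) g`. -/
def traceFreeRicci (g : TwoTensorField n M) (x : M) (v w : TangentSpace (𝓡 n) x) : ℝ :=
  ricci g x v w - scalarCurvature g x / n * g x v w

/-- The `σ₂`-curvature. -/
def sigmaTwo (g : TwoTensorField n M) (x : M) : ℝ :=
  sigmaTwoCoord (coordMatrix g x) (extChartAt (𝓡 n) x x)

/-- The Hessian `∇²f`. -/
def hessian (g : TwoTensorField n M) (f : M → ℝ) (x : M) (v w : TangentSpace (𝓡 n) x) : ℝ :=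
  formOfCoord x (hessianCoord (coordMatrix g x) (f ∘ (extChartAt (𝓡 n) x).symm)
    (extChartAt (𝓡 n) x x)) v w

/-- The Laplacian `Δf = tr ∇²f`. -/
def laplacian (g : TwoTensorField n M) (f : M → ℝ) (x : M) : ℝ :=
  Matrix.trace ((coordMatrix g x (extChartAt (𝓡 n) x x))⁻¹ *
    hessianCoord (coordMatrix g x) (f ∘ (extChartAt (𝓡 n) x).symm) (extChartAt (𝓡 n) x x))

/-- The inner product `⟨S, h⟩ = gⁱᵏ gʲˡ Sᵢⱼ hₖₗ` of symmetric 2-tensors at `x`. -/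
def tensorInner (g S h : TwoTensorField n M) (x : M) : ℝ :=
  Matrix.trace ((coordMatrix g x (extChartAt (𝓡 n) x x))⁻¹ *
    coordMatrix S x (extChartAt (𝓡 n) x x) *
    (coordMatrix g x (extChartAt (𝓡 n) x x))⁻¹ *
    coordMatrix h x (extChartAt (𝓡 n) x x))

/-- The measure `√(det G) dy` of the preferred chart at `x₀`, carried over to `M`
(it vanishes outside the domain of the chart). -/
def chartVolume [MeasurableSpace M] (g : TwoTensorField n M) (x₀ : M) :
    MeasureTheory.Measure M :=
  MeasureTheory.Measure.map (extChartAt (𝓡 n) x₀).symm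
    ((MeasureTheory.volume.restrict (extChartAt (𝓡 n) x₀).target).withDensity
      fun y => ENNReal.ofReal (Real.sqrt (coordMatrix g x₀ y).det))

/-- The Riemannian volume measure `dv_g`. The chart measures agree on the overlaps of the charts,
so that their supremum is the Borel measure which equals `√(det G) dy` in every chart. -/
def volumeMeasure [MeasurableSpace M] (g : TwoTensorField n M) : MeasureTheory.Measure M :=
  ⨆ x₀ : M, chartVolume g x₀

/-- The linearization `Λ_g(h) = d/dt|₀ σ₂(g + t h)` of the `σ₂`-curvature at `g`. -/
def linearizedSigmaTwo (g h : TwoTensorField n M) (x : M) : ℝ :=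
  deriv (fun t : ℝ => sigmaTwo (g + t • h) x) 0

variable [IsManifold (𝓡 n) ∞ M] [MeasurableSpace M]

/-- `S = Λ_g^*(f)`, where `Λ_g^*` is the formal `L²`-adjoint of `Λ_g`: for every smooth symmetric
2-tensor field `h`, `∫ ⟨S, h⟩ dv_g = ∫ f Λ_g(h) dv_g`. -/
def IsAdjointValue (g : Metric n M) (f : M → ℝ) (S : TwoTensorField n M) : Prop :=
  IsSmoothSymmetric S ∧ ∀ h : TwoTensorField n M, IsSmoothSymmetric h →
    ∫ x, tensorInner g.inner S h x ∂(volumeMeasure g.inner) =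
      ∫ x, f x * linearizedSigmaTwo g.inner h x ∂(volumeMeasure g.inner)

/-- `f ∈ ker Λ_g^*`: `f` is smooth and `Λ_g^*(f) = 0`. -/
def MemKerAdjoint (g : Metric n M) (f : M → ℝ) : Prop :=
  ContMDiff (𝓡 n) 𝓘(ℝ, ℝ) ∞ f ∧ IsAdjointValue g f 0

/-- `(M, g, f)` is a `σ₂`-singular space: `f` is a nontrivial element of `ker Λ_g^*`. (Completeness
of `M` is not repeated here, the manifolds considered below are compact.) -/
def IsSigmaTwoSingular (g : Metric n M) (f : M → ℝ) : Prop :=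
  MemKerAdjoint g f ∧ f ≠ 0

/-- `(M, g, f)` is a CPE metric (on a compact `M` without boundary): the scalar curvature is
constant, the volume is `1`, and `f` is a smooth solution of
`∇²f - (Δf) g - f Ric = Ric - (R / n) g`. -/
structure IsCPE (g : Metric n M) (f : M → ℝ) : Prop where
  scalar_const : ∃ c : ℝ, ∀ x : M, scalarCurvature g.inner x = c
  volume_eq_one : volumeMeasure g.inner Set.univ = 1
  smooth : ContMDiff (𝓡 n) 𝓘(ℝ, ℝ) ∞ f
  equation : ∀ (x : M) (v w : TangentSpace (𝓡 n) x),
    hessian g.inner f x v w - laplacian g.inner f x * g.inner x v w - f x * ricci g.inner x v w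
      = traceFreeRicci g.inner x v w

end

/-- `(M, g)` is Einstein: `Ric = c g` for some constant `c`. -/
def IsEinstein {n : ℕ} {M : Type*} [TopologicalSpace M]
    [ChartedSpace (EuclideanSpace ℝ (Fin n)) M] [IsManifold (𝓡 n) ∞ M] (g : Metric n M) : Prop :=
  ∃ c : ℝ, ∀ (x : M) (v w : TangentSpace (𝓡 n) x),
    ricci g.inner x v w = c * g.inner x v w

end CPESigma2

end

/-!
In dimension `n`, `σ₂ = n / (8 (n - 1)) R² - |Ric|² / 2` (`sigmaTwoCoord_eq`), so everything can be
phrased in terms of `R` and `|Ric|²`. Write `Ric°` for the trace-free Ricci tensor and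
`DR*(u) = ∇²u - (Δu) g - u Ric` for the formal adjoint of the linearized scalar curvature `DR`; the
CPE equation says `DR*(f) = Ric°`.

*Einstein implies kernel* (`IsCPE.memKerAdjoint_of_isEinstein`). Where `Ric = c g`, the
linearization of `|Ric|²` is `2 c` times that of `R`, whatever the variation of the Ricci tensor is,
so `Λ_g` is a constant multiple of `DR`. Hence `∫ f Λ_g(h)` is that multiple of
`∫ ⟨DR*(f), h⟩ = ∫ ⟨Ric°, h⟩ = 0`.

*Kernel implies Einstein* (`IsCPE.isEinstein_of_memKerAdjoint`). Since `σ₂(c g) = c⁻² σ₂(g)`,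
testing `Λ_g^*(f) = 0` against `h = g` gives `∫ f σ₂ = 0`. The trace of the CPE equation
expresses `Δf` as a multiple of `R f`, so `∫ Δf = 0` gives `R ∫ f = 0`; with `∫ f σ₂ = 0` this becomes
`∫ f |Ric°|² = 0`. As `R` is constant, the contracted Bianchi identity makes `⟨Ric, ∇²f⟩` the
divergence of `Ric(∇f)`, and contracting the CPE equation with `Ric` turns `∫ ⟨Ric, ∇²f⟩ = 0` into
`∫ (1 + f) |Ric°|² = 0`. Therefore `∫ |Ric°|² = 0` and `Ric° = 0`.

The local identities are statements about a commutative ring with commuting derivations and matrices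
over it (`IsLeviCivita`): the contracted Bianchi identity (`IsLeviCivita.contracted_bianchi`), the
Palatini formula for the variation of the Ricci tensor
(`IsLeviCivita.density_mul_trace_variation_ric`, `IsLeviCivita.density_mul_variation_scalar`) and
the transformation laws under changes of coordinates (`IsCoordChange.ricci`,
`IsCoordChange.hessian`). They are applied in the ring `SmoothGerm p` of germs of smooth functions,
where all differentiability side conditions disappear; for a variation `G + t H` of the metric the
germs are taken at a point of `ℝ × ℝⁿ`, and `∂ₜ` is one more derivation.

The three integrals that have to vanish, of `Δu`, of `⟨Ric, ∇²u⟩` and of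
`u DR(h) - ⟨DR*(u), h⟩`, come from operators in `u` that are additive and whose product with the
volume density is, in every chart, a sum of partial derivatives of functions supported where `u` is
(`HasDivergenceForm`). A partition of unity reduces the integral of such an operator to functions
`u` supported in one chart (`HasDivergenceForm.integral_eq_zero`); there the volume measure is the
measure with density `√(det G)` (`volumeMeasure_restrict_source`), and the integral of a partial
derivative of a compactly supported function is zero.
-/

open scoped Manifold ContDiff Bundle

noncomputable section

namespace CPESigma2

section Algebra

open Matrix

variable {n : ℕ} {A B : Type*} [CommRing A] [CommRing B]

/-! ### Levi-Civita connections over a ring with commuting derivations -/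

lemma matrix_map_derivation_mul (d : Derivation ℤ A A) (M N : Matrix (Fin n) (Fin n) A) :
    (M * N).map d = M.map d * N + M * N.map d := by
  ext i j
  simp only [Matrix.map_apply, Matrix.mul_apply, Matrix.add_apply, map_sum, Derivation.leibniz,
    smul_eq_mul, Finset.sum_add_distrib]
  rw [add_comm]
  congr 1
  exact Finset.sum_congr rfl fun k _ => mul_comm _ _

lemma matrix_map_derivation_add (d : Derivation ℤ A A) (M N : Matrix (Fin n) (Fin n) A) :
    (M + N).map d = M.map d + N.map d := by
  ext i j; simp

lemma matrix_map_derivation_sub (d : Derivation ℤ A A) (M N : Matrix (Fin n) (Fin n) A) :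
    (M - N).map d = M.map d - N.map d := by
  ext i j; simp

lemma matrix_map_derivation_one (d : Derivation ℤ A A) :
    (1 : Matrix (Fin n) (Fin n) A).map d = 0 := by
  ext i j
  by_cases h : i = j <;> simp [h]

/-- A family `Γ i` of matrices, with `(Γ i) k j = Γᵏᵢⱼ`, is the Levi-Civita connection of the
symmetric matrix `G` with inverse `P` when it is torsion-free and `∂ᵢ G = (Γ i)ᵀ G + G (Γ i)`. -/
structure IsLeviCivita (d : Fin n → Derivation ℤ A A) (G P : Matrix (Fin n) (Fin n) A)
    (Γ : Fin n → Matrix (Fin n) (Fin n) A) : Prop where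
  symm : Gᵀ = G
  inv_mul : P * G = 1
  torsion : ∀ i j k, Γ i k j = Γ j k i
  compat : ∀ i, G.map (d i) = (Γ i)ᵀ * G + G * Γ i

/-- The curvature matrices `∂ᵢ Γⱼ - ∂ⱼ Γᵢ + [Γᵢ, Γⱼ]`. -/
def curv (d : Fin n → Derivation ℤ A A) (Γ : Fin n → Matrix (Fin n) (Fin n) A) (i j : Fin n) :
    Matrix (Fin n) (Fin n) A :=
  (Γ j).map (d i) - (Γ i).map (d j) + Γ i * Γ j - Γ j * Γ i

/-- The Ricci contraction of the curvature matrices. -/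
def ric (d : Fin n → Derivation ℤ A A) (Γ : Fin n → Matrix (Fin n) (Fin n) A) :
    Matrix (Fin n) (Fin n) A :=
  Matrix.of fun i j => ∑ k, curv d Γ k i k j

/-- The Hessian `∂ᵢ ∂ⱼ u - Γᵏᵢⱼ ∂ₖ u`. -/
def hess (d : Fin n → Derivation ℤ A A) (Γ : Fin n → Matrix (Fin n) (Fin n) A) (u : A) :
    Matrix (Fin n) (Fin n) A :=
  Matrix.of fun i j => d i (d j u) - ∑ k, Γ i k j * d k u

namespace IsLeviCivita

variable {d : Fin n → Derivation ℤ A A} {G P : Matrix (Fin n) (Fin n) A}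
  {Γ Γ' : Fin n → Matrix (Fin n) (Fin n) A}

lemma mul_inv (h : IsLeviCivita d G P Γ) : G * P = 1 := mul_eq_one_comm.mp h.inv_mul

lemma inv_symm (h : IsLeviCivita d G P Γ) : Pᵀ = P := by
  have h1 : Pᵀ * G = 1 := by
    have := congrArg Matrix.transpose h.mul_inv
    rwa [Matrix.transpose_mul, h.symm, Matrix.transpose_one] at this
  calc Pᵀ = Pᵀ * (G * P) := by rw [h.mul_inv, mul_one]
    _ = P := by rw [← mul_assoc, h1, one_mul]

/-- The Levi-Civita connection is unique. -/
lemma unique (h2 : ∀ a : A, 2 * a = 0 → a = 0) (h : IsLeviCivita d G P Γ)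
    (h' : IsLeviCivita d G P Γ') : Γ = Γ' := by
  set L : Fin n → Matrix (Fin n) (Fin n) A := fun i => G * (Γ i - Γ' i) with hL
  have hanti : ∀ i k j, L i k j = - L i j k := by
    intro i k j
    have h1 : (L i)ᵀ + L i = 0 := by
      have h3 : (Γ i)ᵀ * G + G * Γ i = (Γ' i)ᵀ * G + G * Γ' i := by rw [← h.compat, ← h'.compat]
      have h4 : (L i)ᵀ + L i
          = ((Γ i)ᵀ * G + G * Γ i) - ((Γ' i)ᵀ * G + G * Γ' i) := by
        simp only [hL, Matrix.transpose_mul, Matrix.transpose_sub, h.symm]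
        noncomm_ring
      rw [h4, h3, sub_self]
    have := congrFun (congrFun h1 j) k
    simp only [Matrix.add_apply, Matrix.transpose_apply, Matrix.zero_apply] at this
    exact eq_neg_of_add_eq_zero_left this
  have hsym : ∀ i k j, L i k j = L j k i := by
    intro i k j
    simp only [hL, Matrix.mul_apply, Matrix.sub_apply]
    exact Finset.sum_congr rfl fun l _ => by rw [h.torsion i j l, h'.torsion i j l]
  have hzero : ∀ i, L i = 0 := by
    intro i
    ext k j
    apply h2
    have h1 : L i k j = - L i k j := by
      calc L i k j = L j k i := hsym _ _ _
        _ = - L j i k := hanti _ _ _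
        _ = - L k i j := by rw [hsym]
        _ = L k j i := by rw [hanti k i j, neg_neg]
        _ = L i j k := hsym _ _ _
        _ = - L i k j := hanti _ _ _
    rw [two_mul]
    exact add_eq_zero_iff_eq_neg.mpr h1
  funext i
  have h3 : P * (G * (Γ i - Γ' i)) = 0 := by
    have := hzero i
    simp only [hL] at this
    rw [this, mul_zero]
  rw [← mul_assoc, h.inv_mul, one_mul] at h3
  exact sub_eq_zero.mp h3

/-- Metric compatibility for the inverse metric. -/
lemma map_inv (h : IsLeviCivita d G P Γ) (i : Fin n) :
    P.map (d i) = -(Γ i * P) - P * (Γ i)ᵀ := by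
  have h1 : P.map (d i) * G + P * G.map (d i) = 0 := by
    rw [← matrix_map_derivation_mul, h.inv_mul, matrix_map_derivation_one]
  have h2 : P.map (d i) = -(P * G.map (d i) * P) := by
    have h3 : (P.map (d i) * G + P * G.map (d i)) * P = 0 := by rw [h1, zero_mul]
    rw [add_mul, mul_assoc (P.map (d i)), h.mul_inv, mul_one] at h3
    exact eq_neg_of_add_eq_zero_left h3
  rw [h2, h.compat]
  calc -(P * ((Γ i)ᵀ * G + G * Γ i) * P)
      = -(P * (Γ i)ᵀ * (G * P)) - (P * G) * (Γ i * P) := by noncomm_ring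
    _ = _ := by rw [h.inv_mul, h.mul_inv]; noncomm_ring

end IsLeviCivita

/-! ### Change of coordinates -/

/-- A change of coordinates with Jacobian matrix `J`, whose inverse is `K`: `σ` pulls functions
back, and the derivations `d`, `e` along the coordinates are related by the chain rule. -/
structure IsCoordChange (d : Fin n → Derivation ℤ A A) (e : Fin n → Derivation ℤ B B)
    (σ : B →+* A) (J K : Matrix (Fin n) (Fin n) A) : Prop where
  inv_mul : K * J = 1
  chain : ∀ i b, d i (σ b) = ∑ a, J a i * σ (e a b)
  closed : ∀ i j a, d i (J a j) = d j (J a i)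

namespace IsCoordChange

variable {d : Fin n → Derivation ℤ A A} {e : Fin n → Derivation ℤ B B}
  {σ : B →+* A} {J K : Matrix (Fin n) (Fin n) A}
  {G P : Matrix (Fin n) (Fin n) B} {G' P' : Matrix (Fin n) (Fin n) A}
  {Γ : Fin n → Matrix (Fin n) (Fin n) B} {Γ' : Fin n → Matrix (Fin n) (Fin n) A}

lemma mul_inv (hc : IsCoordChange d e σ J K) : J * K = 1 := mul_eq_one_comm.mp hc.inv_mul

lemma map_map (hc : IsCoordChange d e σ J K) (M : Matrix (Fin n) (Fin n) B) (i : Fin n) :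
    (M.map σ).map (d i) = ∑ a, J a i • (M.map (e a)).map σ := by
  ext k j
  simp [Matrix.sum_apply, hc.chain]

/-- The pullback `∑ₐ Jᵃᵢ Γₐ` of the connection matrices. -/
def pullConn (σ : B →+* A) (J : Matrix (Fin n) (Fin n) A) (Γ : Fin n → Matrix (Fin n) (Fin n) B)
    (i : Fin n) : Matrix (Fin n) (Fin n) A :=
  ∑ a, J a i • (Γ a).map σ

lemma map_metric (hc : IsCoordChange d e σ J K) (h : IsLeviCivita e G P Γ) (i : Fin n) :
    (G.map σ).map (d i)
      = (pullConn σ J Γ i)ᵀ * G.map σ + G.map σ * pullConn σ J Γ i := by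
  rw [hc.map_map]
  have h1 : ∀ a, (G.map (e a)).map σ = ((Γ a).map σ)ᵀ * G.map σ + G.map σ * (Γ a).map σ := by
    intro a
    rw [h.compat, Matrix.map_add _ (map_add σ), Matrix.map_mul, Matrix.map_mul,
      Matrix.transpose_map]
  simp only [h1, pullConn, Matrix.transpose_sum, Matrix.transpose_smul, Matrix.sum_mul,
    Matrix.mul_sum, Matrix.smul_mul, Matrix.mul_smul, ← Finset.sum_add_distrib, smul_add]

/-- The transformation law of the connection matrices: the transformed connection is again
torsion-free and metric, so uniqueness applies. -/
lemma connection (h2 : ∀ a : A, 2 * a = 0 → a = 0) (hc : IsCoordChange d e σ J K)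
    (h : IsLeviCivita e G P Γ) (h' : IsLeviCivita d G' P' Γ') (hG : G' = Jᵀ * G.map σ * J)
    (i : Fin n) : J * Γ' i = pullConn σ J Γ i * J + J.map (d i) := by
  have key : IsLeviCivita d G' P' fun i => K * (pullConn σ J Γ i * J + J.map (d i)) := by
    refine ⟨h'.symm, h'.inv_mul, ?_, ?_⟩
    · intro i j k
      have h1 : ∀ a, (pullConn σ J Γ i * J + J.map (d i)) a j
          = (pullConn σ J Γ j * J + J.map (d j)) a i := by
        intro a
        simp only [Matrix.add_apply, Matrix.mul_apply, pullConn, Matrix.sum_apply,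
          Matrix.smul_apply, Matrix.map_apply, smul_eq_mul, hc.closed i j a, Finset.sum_mul]
        congr 1
        rw [Finset.sum_comm]
        refine Finset.sum_congr rfl fun b _ => Finset.sum_congr rfl fun c _ => ?_
        rw [h.torsion]; ring
      change (K * (pullConn σ J Γ i * J + J.map (d i))) k j
        = (K * (pullConn σ J Γ j * J + J.map (d j))) k i
      rw [Matrix.mul_apply, Matrix.mul_apply]
      exact Finset.sum_congr rfl fun a _ => by rw [h1]
    · intro i
      have hJK : Jᵀ * Kᵀ = 1 := by rw [← Matrix.transpose_mul, hc.inv_mul, Matrix.transpose_one]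
      have hT : (J.map (d i))ᵀ = Jᵀ.map (d i) := rfl
      have e1 : (K * (pullConn σ J Γ i * J + J.map (d i)))ᵀ * G'
          = (Jᵀ * (pullConn σ J Γ i)ᵀ + Jᵀ.map (d i)) * G.map σ * J := by
        rw [Matrix.transpose_mul, hG, Matrix.transpose_add, Matrix.transpose_mul, hT]
        calc (Jᵀ * (pullConn σ J Γ i)ᵀ + Jᵀ.map (d i)) * Kᵀ * (Jᵀ * G.map σ * J)
            = (Jᵀ * (pullConn σ J Γ i)ᵀ + Jᵀ.map (d i)) * (Kᵀ * Jᵀ) * (G.map σ * J) := by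
              noncomm_ring
          _ = _ := by rw [mul_eq_one_comm.mp hJK]; noncomm_ring
      have e2 : G' * (K * (pullConn σ J Γ i * J + J.map (d i)))
          = Jᵀ * G.map σ * (pullConn σ J Γ i * J + J.map (d i)) := by
        rw [hG, mul_assoc (Jᵀ * G.map σ), ← mul_assoc J, hc.mul_inv, one_mul]
      rw [e1, e2, hG, matrix_map_derivation_mul, matrix_map_derivation_mul, hc.map_metric h]
      noncomm_ring
  have := congrFun (h'.unique h2 key) i
  rw [this, ← mul_assoc, hc.mul_inv, one_mul]

/-- The transformation law of the curvature matrices. -/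
lemma curvature (h2 : ∀ a : A, 2 * a = 0 → a = 0) (hc : IsCoordChange d e σ J K)
    (hcomm : ∀ i j a, d i (d j a) = d j (d i a))
    (h : IsLeviCivita e G P Γ) (h' : IsLeviCivita d G' P' Γ') (hG : G' = Jᵀ * G.map σ * J)
    (i j : Fin n) :
    J * curv d Γ' i j = (∑ a, ∑ b, (J a i * J b j) • (curv e Γ a b).map σ) * J := by
  have hcon := hc.connection h2 h h' hG
  -- the curvature of the pulled back connection matrices
  have hpull : ∑ a, ∑ b, (J a i * J b j) • (curv e Γ a b).map σ
      = (pullConn σ J Γ j).map (d i) - (pullConn σ J Γ i).map (d j)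
        + pullConn σ J Γ i * pullConn σ J Γ j - pullConn σ J Γ j * pullConn σ J Γ i := by
    have e1 : ∀ i j, (pullConn σ J Γ j).map (d i) = ∑ a, d i (J a j) • (Γ a).map σ
        + ∑ a, ∑ b, (J a i * J b j) • ((Γ b).map (e a)).map σ := by
      intro i j
      ext k l
      simp only [pullConn, Matrix.map_apply, Matrix.sum_apply, Matrix.smul_apply, smul_eq_mul,
        map_sum, Derivation.leibniz, Matrix.add_apply, Finset.sum_add_distrib, hc.chain,
        Finset.mul_sum]
      rw [add_comm]
      congr 1
      · exact Finset.sum_congr rfl fun _ _ => mul_comm _ _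
      · rw [Finset.sum_comm]
        exact Finset.sum_congr rfl fun _ _ => Finset.sum_congr rfl fun _ _ => by ring
    have e2 : ∀ i j, pullConn σ J Γ i * pullConn σ J Γ j
        = ∑ a, ∑ b, (J a i * J b j) • (Γ a * Γ b).map σ := by
      intro i j
      simp only [pullConn, Matrix.sum_mul, Matrix.mul_sum, Matrix.smul_mul, Matrix.mul_smul,
        Finset.smul_sum, smul_smul, Matrix.map_mul]
      rw [Finset.sum_comm]
      exact Finset.sum_congr rfl fun _ _ => Finset.sum_congr rfl fun _ _ => by rw [mul_comm (J _ j)]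
    have e3 : ∀ X : Fin n → Fin n → Matrix (Fin n) (Fin n) A,
        ∑ a, ∑ b, (J a j * J b i) • X a b = ∑ a, ∑ b, (J a i * J b j) • X b a := by
      intro X
      rw [Finset.sum_comm]
      exact Finset.sum_congr rfl fun _ _ => Finset.sum_congr rfl fun _ _ => by rw [mul_comm]
    have e4 : ∀ a b, (curv e Γ a b).map σ = ((Γ b).map (e a)).map σ - ((Γ a).map (e b)).map σ
        + (Γ a * Γ b).map σ - (Γ b * Γ a).map σ := by
      intro a b
      ext k l
      simp only [curv, Matrix.map_apply, Matrix.sub_apply, Matrix.add_apply, map_sub, map_add]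
    have e5 : ∑ a, d i (J a j) • (Γ a).map σ = ∑ a, d j (J a i) • (Γ a).map σ :=
      Finset.sum_congr rfl fun a _ => by rw [hc.closed]
    rw [e1 i j, e1 j i, e2 i j, e2 j i, e3, e3, e5]
    simp only [e4, smul_sub, smul_add, Finset.sum_add_distrib, Finset.sum_sub_distrib]
    abel
  have hd : ∀ i j, J * (Γ' j).map (d i) = (pullConn σ J Γ j).map (d i) * J
      + pullConn σ J Γ j * J.map (d i) + (J.map (d j)).map (d i) - J.map (d i) * Γ' j := by
    intro i j
    have := congrArg (fun M => M.map (d i)) (hcon j)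
    simp only [matrix_map_derivation_mul, matrix_map_derivation_add] at this
    rw [← this]; abel
  have hJJ : (J.map (d j)).map (d i) = (J.map (d i)).map (d j) := by
    ext k l; simp [hcomm i j]
  rw [hpull]
  have e1 : J * (Γ' i * Γ' j) = pullConn σ J Γ i * (pullConn σ J Γ j * J + J.map (d j))
      + J.map (d i) * Γ' j := by
    rw [← mul_assoc, hcon i, add_mul, mul_assoc, hcon j]
  have e2 : J * (Γ' j * Γ' i) = pullConn σ J Γ j * (pullConn σ J Γ i * J + J.map (d i))
      + J.map (d j) * Γ' i := by
    rw [← mul_assoc, hcon j, add_mul, mul_assoc, hcon i]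
  rw [curv, mul_sub, mul_add, mul_sub, hd i j, hd j i, hJJ, e1, e2]
  noncomm_ring

/-- The Ricci matrix transforms as a covariant 2-tensor. -/
theorem ricci (h2 : ∀ a : A, 2 * a = 0 → a = 0) (hc : IsCoordChange d e σ J K)
    (hcomm : ∀ i j a, d i (d j a) = d j (d i a))
    (h : IsLeviCivita e G P Γ) (h' : IsLeviCivita d G' P' Γ') (hG : G' = Jᵀ * G.map σ * J) :
    ric d Γ' = Jᵀ * (ric e Γ).map σ * J := by
  have hcur : ∀ i j, curv d Γ' i j
      = ∑ a, ∑ b, (J a i * J b j) • (K * (curv e Γ a b).map σ * J) := by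
    intro i j
    calc curv d Γ' i j = K * (J * curv d Γ' i j) := by rw [← mul_assoc, hc.inv_mul, one_mul]
      _ = _ := by
        rw [hc.curvature h2 hcomm h h' hG]
        simp only [Matrix.sum_mul, Matrix.mul_sum, Matrix.smul_mul, Matrix.mul_smul, mul_assoc]
  ext i j
  have hJK : ∀ a c, ∑ k, J a k * K k c = if a = c then 1 else 0 := by
    intro a c
    rw [← Matrix.mul_apply, hc.mul_inv, Matrix.one_apply]
  have hterm : ∀ a b, ∑ k, J a k * J b i * (K * (curv e Γ a b).map σ * J) k j
      = J b i * ((curv e Γ a b).map σ * J) a j := by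
    intro a b
    calc ∑ k, J a k * J b i * (K * (curv e Γ a b).map σ * J) k j
        = J b i * (J * (K * ((curv e Γ a b).map σ * J))) a j := by
          rw [Matrix.mul_apply, Finset.mul_sum]
          exact Finset.sum_congr rfl fun k _ => by rw [mul_assoc K]; ring
      _ = _ := by rw [← mul_assoc J, hc.mul_inv, one_mul]
  calc ric d Γ' i j = ∑ k, ∑ a, ∑ b, J a k * J b i * (K * (curv e Γ a b).map σ * J) k j := by
        simp only [ric, Matrix.of_apply, hcur, Matrix.sum_apply, Matrix.smul_apply, smul_eq_mul]
    _ = ∑ a, ∑ b, J b i * ((curv e Γ a b).map σ * J) a j := by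
        rw [Finset.sum_comm]
        refine Finset.sum_congr rfl fun a _ => ?_
        rw [Finset.sum_comm]
        exact Finset.sum_congr rfl fun b _ => hterm a b
    _ = _ := by
        rw [Finset.sum_comm]
        rw [Matrix.mul_assoc, Matrix.mul_apply]
        simp only [Matrix.transpose_apply]
        refine Finset.sum_congr rfl fun b _ => ?_
        rw [← Finset.mul_sum]
        congr 1
        simp only [Matrix.mul_apply, Matrix.map_apply, ric, Matrix.of_apply, map_sum,
          Finset.sum_mul]
        rw [Finset.sum_comm]

/-- The Hessian transforms as a covariant 2-tensor. -/
theorem hessian (h2 : ∀ a : A, 2 * a = 0 → a = 0) (hc : IsCoordChange d e σ J K)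
    (h : IsLeviCivita e G P Γ) (h' : IsLeviCivita d G' P' Γ') (hG : G' = Jᵀ * G.map σ * J)
    (u : B) : hess d Γ' (σ u) = Jᵀ * (hess e Γ u).map σ * J := by
  have hcon := hc.connection h2 h h' hG
  ext i j
  have h1 : ∑ k, Γ' i k j * d k (σ u)
      = ∑ a, (pullConn σ J Γ i * J + J.map (d i)) a j * σ (e a u) := by
    rw [← hcon i]
    simp only [hc.chain, Matrix.mul_apply, Finset.mul_sum, Finset.sum_mul]
    rw [Finset.sum_comm]
    exact Finset.sum_congr rfl fun _ _ => Finset.sum_congr rfl fun _ _ => by ring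
  have h3 : d i (d j (σ u)) = ∑ a, d i (J a j) * σ (e a u)
      + ∑ a, ∑ b, J b j * (J a i * σ (e a (e b u))) := by
    simp only [hc.chain j, map_sum, Derivation.leibniz, smul_eq_mul, hc.chain i,
      Finset.sum_add_distrib, Finset.mul_sum]
    rw [add_comm, Finset.sum_comm]
    congr 1
    exact Finset.sum_congr rfl fun _ _ => by ring
  have h4 : (Jᵀ * (hess e Γ u).map σ * J) i j
      = ∑ a, ∑ b, J b j * (J a i * (σ (e a (e b u)) - ∑ c, σ (Γ a c b) * σ (e c u))) := by
    simp only [Matrix.mul_apply, Matrix.transpose_apply, Matrix.map_apply, hess, Matrix.of_apply,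
      map_sub, map_sum, map_mul, Finset.sum_mul]
    rw [Finset.sum_comm]
    exact Finset.sum_congr rfl fun _ _ => Finset.sum_congr rfl fun _ _ => by ring
  have h5 : ∑ a, (pullConn σ J Γ i * J) a j * σ (e a u)
      = ∑ a, ∑ b, J b j * (J a i * ∑ c, σ (Γ a c b) * σ (e c u)) := by
    simp only [pullConn, Matrix.mul_apply, Matrix.sum_apply, Matrix.smul_apply, Matrix.map_apply,
      smul_eq_mul, Finset.sum_mul, Finset.mul_sum]
    rw [Finset.sum_comm]
    conv_lhs => enter [2, x]; rw [Finset.sum_comm]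
    rw [Finset.sum_comm]
    refine Finset.sum_congr rfl fun _ _ => Finset.sum_congr rfl fun _ _ =>
      Finset.sum_congr rfl fun _ _ => by ring
  rw [h4]
  simp only [hess, Matrix.of_apply]
  rw [h1, h3]
  simp only [Matrix.add_apply, Matrix.map_apply, add_mul, Finset.sum_add_distrib, h5, mul_sub,
    Finset.sum_sub_distrib]
  ring

end IsCoordChange

end Algebra

section Algebra

open Matrix

variable {n : ℕ} {A : Type*} [CommRing A]

/-! ### The contracted Bianchi identity -/

lemma matrix_map_derivation_neg (d : Derivation ℤ A A) (M : Matrix (Fin n) (Fin n) A) :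
    (-M).map d = -M.map d := by
  ext i j; simp

lemma matrix_map_derivation_comm {d e : Derivation ℤ A A} (h : ∀ a, d (e a) = e (d a))
    (M : Matrix (Fin n) (Fin n) A) : (M.map e).map d = (M.map d).map e := by
  ext i j; simp [h]

lemma sum_rotate (f : Fin n → Fin n → Fin n → A) :
    ∑ k, ∑ i, ∑ m, f k i m = ∑ m, ∑ k, ∑ i, f k i m := by
  conv_lhs => enter [2, k]; rw [Finset.sum_comm]
  rw [Finset.sum_comm]

lemma sum_skew_mul_symm_eq_zero (h2 : ∀ a : A, 2 * a = 0 → a = 0) {q s : Fin n → Fin n → A}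
    (hq : ∀ a b, q a b = -q b a) (hs : ∀ a b, s a b = s b a) :
    ∑ a, ∑ b, q a b * s a b = 0 := by
  apply h2
  have : ∑ a, ∑ b, q a b * s a b = -∑ a, ∑ b, q a b * s a b := by
    conv_lhs => rw [Finset.sum_comm]
    simp only [← Finset.sum_neg_distrib]
    exact Finset.sum_congr rfl fun a _ => Finset.sum_congr rfl fun b _ => by
      rw [hq b a, hs b a, neg_mul]
  rw [two_mul]
  exact add_eq_zero_iff_eq_neg.mpr this

namespace IsLeviCivita

variable {d : Fin n → Derivation ℤ A A} {G P : Matrix (Fin n) (Fin n) A}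
  {Γ : Fin n → Matrix (Fin n) (Fin n) A}

/-- The curvature with both endomorphism indices raised is skew. -/
lemma curv_mul_inv_skew (h : IsLeviCivita d G P Γ) (hcomm : ∀ i j a, d i (d j a) = d j (d i a))
    (i j : Fin n) : (curv d Γ i j * P)ᵀ = -(curv d Γ i j * P) := by
  have h1 := matrix_map_derivation_comm (hcomm i j) P
  rw [h.map_inv j, h.map_inv i] at h1
  have hm : ∀ k l, (-(Γ l * P) - P * (Γ l)ᵀ).map (d k)
      = -((Γ l).map (d k) * P) - Γ l * P.map (d k) - P.map (d k) * (Γ l)ᵀ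
        - P * ((Γ l).map (d k))ᵀ := by
    intro k l
    rw [matrix_map_derivation_sub, matrix_map_derivation_neg, matrix_map_derivation_mul,
      matrix_map_derivation_mul, Matrix.transpose_map]
    noncomm_ring
  rw [hm, hm, h.map_inv j, h.map_inv i] at h1
  rw [Matrix.transpose_mul, h.inv_symm, eq_neg_iff_add_eq_zero]
  simp only [curv, Matrix.transpose_add, Matrix.transpose_sub, Matrix.transpose_mul]
  have h2 := sub_eq_zero.mpr h1.symm
  rw [← h2]
  noncomm_ring

/-- The second Bianchi identity. -/
lemma bianchi (hcomm : ∀ i j a, d i (d j a) = d j (d i a)) (i j k : Fin n) :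
    ((curv d Γ i j).map (d k) + Γ k * curv d Γ i j - curv d Γ i j * Γ k)
    + ((curv d Γ j k).map (d i) + Γ i * curv d Γ j k - curv d Γ j k * Γ i)
    + ((curv d Γ k i).map (d j) + Γ j * curv d Γ k i - curv d Γ k i * Γ j) = 0 := by
  simp only [curv, matrix_map_derivation_sub, matrix_map_derivation_add,
    matrix_map_derivation_mul]
  rw [matrix_map_derivation_comm (hcomm k i), matrix_map_derivation_comm (hcomm i j),
    matrix_map_derivation_comm (hcomm j k)]
  noncomm_ring

/-- The mixed Ricci tensor `Sᵏⱼ = Pᵏˡ Ricⱼₗ`, as a contraction of the curvature. -/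
lemma mixedRicci_eq (h : IsLeviCivita d G P Γ) (hcomm : ∀ i j a, d i (d j a) = d j (d i a))
    (k j : Fin n) : (P * (ric d Γ)ᵀ) k j = -∑ i, (curv d Γ i j * P) k i := by
  have hskew : ∀ i, (curv d Γ i j * P) k i = -(curv d Γ i j * P) i k := fun i => by
    have := congrFun (congrFun (h.curv_mul_inv_skew hcomm i j) i) k
    simpa using this
  simp only [hskew, Finset.sum_neg_distrib, neg_neg]
  simp only [Matrix.mul_apply, Matrix.transpose_apply, ric, Matrix.of_apply, Finset.mul_sum]
  rw [Finset.sum_comm]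
  refine Finset.sum_congr rfl fun i _ => Finset.sum_congr rfl fun l _ => ?_
  have hP : P k l = P l k := congrFun (congrFun h.inv_symm l) k
  rw [hP, mul_comm]

lemma trace_eq_sum_torsion (h : IsLeviCivita d G P Γ) (j : Fin n) :
    (Γ j).trace = ∑ k, Γ k k j :=
  Finset.sum_congr rfl fun k _ => h.torsion j k k

/-- The contracted second Bianchi identity `∂ⱼ R = 2 ∇ₖ Sᵏⱼ`. -/
theorem contracted_bianchi (h2 : ∀ a : A, 2 * a = 0 → a = 0) (h : IsLeviCivita d G P Γ)
    (hcomm : ∀ i j a, d i (d j a) = d j (d i a)) (j : Fin n) :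
    d j (trace (P * ric d Γ)) = 2 * (∑ k, d k ((P * (ric d Γ)ᵀ) k j)
      + ∑ m, (Γ m).trace * (P * (ric d Γ)ᵀ) m j
      - ∑ k, ∑ m, Γ k m j * (P * (ric d Γ)ᵀ) k m) := by
  set Q : Fin n → Fin n → Matrix (Fin n) (Fin n) A := fun i j => curv d Γ i j * P with hQ
  set T : Fin n → Fin n → A := fun k j => ∑ i, Q i j k i with hT
  have hS : ∀ k j, (P * (ric d Γ)ᵀ) k j = - T k j := fun k j => h.mixedRicci_eq hcomm k j
  have hQs : ∀ i j k l, Q i j k l = - Q i j l k := fun i j k l => by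
    have := congrFun (congrFun (h.curv_mul_inv_skew hcomm i j) l) k
    simpa using this
  have hQi : ∀ i j k l, Q i j k l = - Q j i k l := fun i j k l => by
    have : curv d Γ i j = - curv d Γ j i := by simp only [curv]; abel
    simp only [hQ, this, neg_mul, Matrix.neg_apply]
  -- the Bianchi identity in terms of the skew matrices `Q`
  have hB : ∀ k i, ((Q i j).map (d k) + Γ k * Q i j + Q i j * (Γ k)ᵀ)
      + ((Q j k).map (d i) + Γ i * Q j k + Q j k * (Γ i)ᵀ)
      + ((Q k i).map (d j) + Γ j * Q k i + Q k i * (Γ j)ᵀ) = 0 := by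
    intro k i
    have e1 : ∀ a b c, (Q a b).map (d c) + Γ c * Q a b + Q a b * (Γ c)ᵀ
        = ((curv d Γ a b).map (d c) + Γ c * curv d Γ a b - curv d Γ a b * Γ c) * P := by
      intro a b c
      simp only [hQ, matrix_map_derivation_mul, h.map_inv]
      noncomm_ring
    rw [e1, e1, e1, ← add_mul, ← add_mul, bianchi hcomm, zero_mul]
  have hE : ∀ k i a b c, ((Q a b).map (d c) + Γ c * Q a b + Q a b * (Γ c)ᵀ) k i
      = d c (Q a b k i) + ∑ m, Γ c k m * Q a b m i + ∑ m, Q a b k m * Γ c i m := by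
    intro k i a b c
    simp [Matrix.mul_apply]
  have hsum : ∑ k, ∑ i, ((d k (Q i j k i) + ∑ m, Γ k k m * Q i j m i + ∑ m, Q i j k m * Γ k i m)
      + (d i (Q j k k i) + ∑ m, Γ i k m * Q j k m i + ∑ m, Q j k k m * Γ i i m)
      + (d j (Q k i k i) + ∑ m, Γ j k m * Q k i m i + ∑ m, Q k i k m * Γ j i m)) = 0 := by
    refine Finset.sum_eq_zero fun k _ => Finset.sum_eq_zero fun i _ => ?_
    have := congrFun (congrFun (hB k i) k) i
    rw [Matrix.add_apply, Matrix.add_apply, hE, hE, hE] at this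
    simpa using this
  simp only [Finset.sum_add_distrib] at hsum
  -- the individual contractions
  have t1 : ∑ k, ∑ i, d k (Q i j k i) = ∑ k, d k (T k j) := by
    simp only [hT, map_sum]
  have t2 : ∑ k, ∑ i, ∑ m, Γ k k m * Q i j m i = ∑ m, (Γ m).trace * T m j := by
    rw [sum_rotate]
    simp only [h.trace_eq_sum_torsion, hT, Finset.sum_mul_sum]
  have t3 : ∑ k, ∑ i, ∑ m, Q i j k m * Γ k i m = 0 := by
    rw [Finset.sum_comm]
    exact Finset.sum_eq_zero fun i _ => sum_skew_mul_symm_eq_zero h2 (fun a b => hQs i j a b)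
      (fun a b => h.torsion a b i)
  have t4 : ∑ k, ∑ i, d i (Q j k k i) = ∑ k, d k (T k j) := by
    rw [Finset.sum_comm]
    simp only [hT, map_sum]
    exact Finset.sum_congr rfl fun k _ => Finset.sum_congr rfl fun i _ => by
      rw [hQi, hQs, neg_neg]
  have t5 : ∑ k, ∑ i, ∑ m, Γ i k m * Q j k m i = 0 := by
    refine Finset.sum_eq_zero fun k _ => ?_
    rw [← sum_skew_mul_symm_eq_zero h2 (fun a b => hQs j k b a) (fun a b => h.torsion a b k)]
    exact Finset.sum_congr rfl fun i _ => Finset.sum_congr rfl fun m _ => mul_comm _ _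
  have t6 : ∑ k, ∑ i, ∑ m, Q j k k m * Γ i i m = ∑ m, (Γ m).trace * T m j := by
    rw [sum_rotate]
    simp only [h.trace_eq_sum_torsion, hT, Finset.sum_mul_sum]
    refine Finset.sum_congr rfl fun m _ => ?_
    rw [Finset.sum_comm]
    exact Finset.sum_congr rfl fun i _ => Finset.sum_congr rfl fun k _ => by
      rw [hQi, hQs, neg_neg, mul_comm]
  have t7 : ∑ k, ∑ i, d j (Q k i k i) = d j (trace (P * ric d Γ)) := by
    simp only [← map_sum]
    congr 1
    simp only [hQ, Matrix.trace, Matrix.diag, Matrix.mul_apply, ric, Matrix.of_apply,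
      Finset.mul_sum]
    rw [sum_rotate]
    refine Finset.sum_congr rfl fun l _ => ?_
    rw [Finset.sum_comm]
    exact Finset.sum_congr rfl fun i _ => Finset.sum_congr rfl fun k _ => mul_comm _ _
  have t8 : ∑ k, ∑ i, ∑ m, Γ j k m * Q k i m i = - ∑ k, ∑ m, Γ k m j * T k m := by
    rw [sum_rotate]
    simp only [hT, Finset.mul_sum, ← Finset.sum_neg_distrib]
    exact Finset.sum_congr rfl fun m _ => Finset.sum_congr rfl fun k _ =>
      Finset.sum_congr rfl fun i _ => by rw [hQi, h.torsion j m k, mul_neg]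
  have t9 : ∑ k, ∑ i, ∑ m, Q k i k m * Γ j i m = - ∑ k, ∑ m, Γ k m j * T k m := by
    rw [sum_rotate]
    simp only [hT, Finset.mul_sum, ← Finset.sum_neg_distrib]
    refine Finset.sum_congr rfl fun m _ => ?_
    rw [Finset.sum_comm]
    exact Finset.sum_congr rfl fun i _ =>
      Finset.sum_congr rfl fun k _ => by rw [hQs, h.torsion j m i, neg_mul, mul_comm]
  rw [t1, t2, t3, t4, t5, t6, t7, t8, t9] at hsum
  simp only [hS, map_neg, mul_neg, Finset.sum_neg_distrib]
  linear_combination hsum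

end IsLeviCivita

end Algebra

section Algebra

open Matrix

variable {n : ℕ} {A : Type*} [CommRing A]

/-! ### The volume density and divergences -/

lemma derivation_prod {ι : Type*} [DecidableEq ι] (d : Derivation ℤ A A) (s : Finset ι)
    (f : ι → A) : d (∏ i ∈ s, f i) = ∑ i ∈ s, (∏ j ∈ s.erase i, f j) * d (f i) := by
  induction s using Finset.induction_on with
  | empty => simp
  | insert a s ha ih =>
    rw [Finset.prod_insert ha, Derivation.leibniz, ih, Finset.sum_insert ha,
      Finset.erase_insert ha, smul_eq_mul, smul_eq_mul, add_comm, Finset.mul_sum]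
    congr 1
    refine Finset.sum_congr rfl fun i hi => ?_
    have hne : a ≠ i := fun h => ha (h ▸ hi)
    rw [Finset.erase_insert_of_ne hne, Finset.prod_insert (by simp [ha]), mul_assoc]

/-- Jacobi's formula for the derivative of a determinant. -/
lemma derivation_det (d : Derivation ℤ A A) (M : Matrix (Fin n) (Fin n) A) :
    d M.det = trace (M.adjugate * M.map d) := by
  have h1 : ∀ i, (M.adjugate * M.map d) i i = (M.updateCol i fun k => d (M k i)).det := by
    intro i
    rw [← Matrix.cramer_apply, Matrix.cramer_eq_adjugate_mulVec]
    rfl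
  simp only [Matrix.trace, Matrix.diag, h1, Matrix.det_apply, map_sum, Units.smul_def, map_zsmul]
  rw [Finset.sum_comm]
  refine Finset.sum_congr rfl fun σ _ => ?_
  rw [derivation_prod, Finset.smul_sum]
  refine Finset.sum_congr rfl fun i _ => ?_
  congr 1
  rw [← Finset.prod_erase_mul _ _ (Finset.mem_univ i)]
  congr 1
  · exact Finset.prod_congr rfl fun j hj => by
      rw [Matrix.updateCol_ne (Finset.ne_of_mem_erase hj)]
  · rw [Matrix.updateCol_self]

namespace IsLeviCivita

variable {d : Fin n → Derivation ℤ A A} {G P : Matrix (Fin n) (Fin n) A}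
  {Γ : Fin n → Matrix (Fin n) (Fin n) A}

lemma derivation_det (h : IsLeviCivita d G P Γ) (k : Fin n) :
    d k G.det = 2 * (G.det * (Γ k).trace) := by
  have hadj : G.adjugate = G.det • P := by
    calc G.adjugate = G.adjugate * (G * P) := by rw [h.mul_inv, mul_one]
      _ = _ := by rw [← mul_assoc, Matrix.adjugate_mul, Matrix.smul_mul, one_mul]
  rw [CPESigma2.derivation_det, hadj, h.compat, Matrix.smul_mul, Matrix.trace_smul, smul_eq_mul,
    mul_add, Matrix.trace_add]
  have e1 : trace (P * ((Γ k)ᵀ * G)) = (Γ k).trace := by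
    rw [← mul_assoc, Matrix.trace_mul_comm, ← mul_assoc, h.mul_inv, one_mul,
      Matrix.trace_transpose]
  have e2 : trace (P * (G * Γ k)) = (Γ k).trace := by rw [← mul_assoc, h.inv_mul, one_mul]
  rw [e1, e2]; ring

/-- The logarithmic derivative of the volume density `w = √(det G)`. -/
lemma derivation_density (h2 : ∀ a : A, 2 * a = 0 → a = 0) (h : IsLeviCivita d G P Γ) {w : A}
    (hw : IsUnit w) (hw2 : w * w = G.det) (k : Fin n) : d k w = w * (Γ k).trace := by
  have h1 := h.derivation_det k
  rw [← hw2, Derivation.leibniz, smul_eq_mul] at h1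
  have h3 : 2 * (w * (d k w - w * (Γ k).trace)) = 0 := by linear_combination h1
  exact sub_eq_zero.mp ((hw.mul_right_eq_zero).mp (h2 _ h3))

/-- The Ricci matrix is symmetric: its skew part is `∂ⱼ tr Γᵢ - ∂ᵢ tr Γⱼ`, which vanishes because
`tr Γ` is the logarithmic derivative of the density. -/
lemma ric_symm (h : IsLeviCivita d G P Γ) (hcomm : ∀ i j a, d i (d j a) = d j (d i a)) {w : A}
    (hw : IsUnit w) (hdw : ∀ k, d k w = w * (Γ k).trace) : (ric d Γ)ᵀ = ric d Γ := by
  have htr : ∀ i j, d i (Γ j).trace = d j (Γ i).trace := by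
    intro i j
    have h1 := hcomm i j w
    rw [hdw, hdw, Derivation.leibniz, Derivation.leibniz, hdw, hdw] at h1
    simp only [smul_eq_mul] at h1
    refine hw.mul_left_cancel ?_
    linear_combination h1
  have hexp : ∀ i j, ric d Γ i j = ∑ k, d k (Γ i k j) - d i (Γ j).trace
      + (∑ k, ∑ a, Γ k k a * Γ i a j - ∑ k, ∑ a, Γ i k a * Γ k a j) := by
    intro i j
    simp only [ric, Matrix.of_apply, curv, Matrix.sub_apply, Matrix.add_apply, Matrix.map_apply,
      Matrix.mul_apply, Finset.sum_add_distrib, Finset.sum_sub_distrib,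
      h.trace_eq_sum_torsion, map_sum]
    ring
  ext i j
  rw [Matrix.transpose_apply, hexp, hexp, htr j i]
  have e1 : ∀ k, Γ j k i = Γ i k j := fun k => h.torsion j i k
  have e2 : ∑ k, ∑ a, Γ j k a * Γ k a i = ∑ k, ∑ a, Γ i k a * Γ k a j := by
    rw [Finset.sum_comm]
    exact Finset.sum_congr rfl fun k _ => Finset.sum_congr rfl fun a _ => by
      rw [h.torsion j k a, h.torsion a i k, mul_comm]
  simp only [e1, e2]

/-- `Σₖ (Γₖ z)ᵏ = Σₖ (tr Γₖ) zᵏ`, a form of torsion-freeness. -/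
lemma sum_mulVec_eq {D : Fin n → Matrix (Fin n) (Fin n) A} (hD : ∀ i j k, D i k j = D j k i)
    (z : Fin n → A) : ∑ k, (D k *ᵥ z) k = ∑ k, (D k).trace * z k := by
  simp only [Matrix.mulVec, dotProduct, Matrix.trace, Matrix.diag, Finset.sum_mul]
  rw [Finset.sum_comm]
  exact Finset.sum_congr rfl fun k _ => Finset.sum_congr rfl fun a _ => by rw [hD]

/-- A density times the divergence `∂ₖ Xᵏ + Γˡₗₖ Xᵏ` is a sum of partial derivatives. -/
lemma sum_derivation_density_mul {w : A} (hdw : ∀ k, d k w = w * (Γ k).trace) (X : Fin n → A) :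
    ∑ k, d k (w * X k) = w * (∑ k, d k (X k) + ∑ k, (Γ k).trace * X k) := by
  simp only [Derivation.leibniz, smul_eq_mul, hdw, Finset.sum_add_distrib, mul_add,
    Finset.mul_sum]
  congr 1
  exact Finset.sum_congr rfl fun _ _ => by ring

lemma derivation_mulVec (d : Derivation ℤ A A) (M : Matrix (Fin n) (Fin n) A) (z : Fin n → A)
    (k : Fin n) : d ((M *ᵥ z) k) = (M.map d *ᵥ z) k + (M *ᵥ fun j => d (z j)) k := by
  simp only [Matrix.mulVec, dotProduct, map_sum, Derivation.leibniz, smul_eq_mul,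
    Finset.sum_add_distrib, Matrix.map_apply]
  rw [add_comm]
  congr 1
  exact Finset.sum_congr rfl fun _ _ => mul_comm _ _

/-- The gradient `Gʲᵏ ∂ₖ u`. -/
def grad (d : Fin n → Derivation ℤ A A) (P : Matrix (Fin n) (Fin n) A) (u : A) : Fin n → A :=
  P *ᵥ fun j => d j u

lemma derivation_grad (h : IsLeviCivita d G P Γ) (u : A) (i : Fin n) :
    (fun j => d i (grad d P u j)) = -(Γ i *ᵥ grad d P u) + P *ᵥ (hess d Γ u i) := by
  have hh : hess d Γ u i = (fun j => d i (d j u)) - (Γ i)ᵀ *ᵥ fun j => d j u := by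
    funext j
    simp [hess, Matrix.mulVec, dotProduct]
  funext j
  rw [grad, derivation_mulVec, h.map_inv, hh]
  simp only [Matrix.mulVec_sub, Matrix.sub_mulVec, Matrix.neg_mulVec, Matrix.mulVec_mulVec,
    Pi.add_apply, Pi.sub_apply, Pi.neg_apply]
  ring

lemma sum_mulVec_hess (N : Matrix (Fin n) (Fin n) A) (u : A) :
    ∑ i, (N *ᵥ hess d Γ u i) i = trace (N * (hess d Γ u)ᵀ) := by
  simp only [Matrix.mulVec, dotProduct, Matrix.trace, Matrix.diag, Matrix.mul_apply,
    Matrix.transpose_apply]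

lemma hess_symm (h : IsLeviCivita d G P Γ) (hcomm : ∀ i j a, d i (d j a) = d j (d i a)) (u : A) :
    (hess d Γ u)ᵀ = hess d Γ u := by
  ext i j
  simp only [Matrix.transpose_apply, hess, Matrix.of_apply, hcomm j i]
  congr 1
  exact Finset.sum_congr rfl fun k _ => by rw [h.torsion]

/-- For `N` a mixed tensor, the divergence of `N (∇ u)`. -/
lemma sum_derivation_mulVec_grad (h : IsLeviCivita d G P Γ)
    (hcomm : ∀ i j a, d i (d j a) = d j (d i a)) {w : A} (hdw : ∀ k, d k w = w * (Γ k).trace)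
    (N : Matrix (Fin n) (Fin n) A) (u : A) :
    ∑ k, d k (w * (N *ᵥ grad d P u) k)
      = w * (∑ k, ((N.map (d k) + Γ k * N - N * Γ k) *ᵥ grad d P u) k
        + trace (N * P * hess d Γ u)) := by
  rw [sum_derivation_density_mul hdw, ← sum_mulVec_eq h.torsion]
  simp only [derivation_mulVec, h.derivation_grad, Matrix.mulVec_add, Matrix.mulVec_neg,
    Matrix.mulVec_mulVec, Pi.add_apply, Pi.neg_apply, Finset.sum_add_distrib,
    Finset.sum_neg_distrib, Matrix.add_mulVec, Matrix.sub_mulVec, Pi.sub_apply,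
    Finset.sum_sub_distrib, sum_mulVec_hess, h.hess_symm hcomm]
  ring

/-- `√(det G) Δu` is a sum of partial derivatives. -/
theorem density_mul_laplacian (h : IsLeviCivita d G P Γ)
    (hcomm : ∀ i j a, d i (d j a) = d j (d i a)) {w : A} (hdw : ∀ k, d k w = w * (Γ k).trace)
    (u : A) : w * trace (P * hess d Γ u) = ∑ k, d k (w * grad d P u k) := by
  have := h.sum_derivation_mulVec_grad hcomm hdw 1 u
  simp only [Matrix.one_mulVec, matrix_map_derivation_one, mul_one, one_mul, zero_add,
    sub_self, Matrix.zero_mulVec, Pi.zero_apply, Finset.sum_const_zero] at this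
  exact this.symm

/-- When the scalar curvature is constant, `√(det G) ⟨Ric, ∇²u⟩` is a sum of partial derivatives,
because the Ricci tensor is divergence-free. -/
theorem density_mul_ric_inner_hess (h2 : ∀ a : A, 2 * a = 0 → a = 0) (h : IsLeviCivita d G P Γ)
    (hcomm : ∀ i j a, d i (d j a) = d j (d i a)) {w : A} (hdw : ∀ k, d k w = w * (Γ k).trace)
    (hR : ∀ j, d j (trace (P * ric d Γ)) = 0) (u : A) :
    w * trace (P * (ric d Γ)ᵀ * P * hess d Γ u)
      = ∑ k, d k (w * ((P * (ric d Γ)ᵀ) *ᵥ grad d P u) k) := by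
  rw [h.sum_derivation_mulVec_grad hcomm hdw]
  set S := P * (ric d Γ)ᵀ with hS
  have hdiv : ∑ k, ((S.map (d k) + Γ k * S - S * Γ k) *ᵥ grad d P u) k = 0 := by
    have hb : ∀ j, ∑ k, (S.map (d k) + Γ k * S - S * Γ k) k j = 0 := by
      intro j
      have h1 := h.contracted_bianchi h2 hcomm j
      rw [hR, eq_comm] at h1
      rw [← h2 _ h1]
      simp only [Matrix.add_apply, Matrix.sub_apply, Matrix.map_apply, Finset.sum_add_distrib,
        Finset.sum_sub_distrib, ← hS]
      have e1 := sum_mulVec_eq h.torsion fun m => S m j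
      simp only [Matrix.mulVec, dotProduct] at e1
      have e2 : ∑ k, (S * Γ k) k j = ∑ k, ∑ m, Γ k m j * S k m := by
        simp only [Matrix.mul_apply]
        exact Finset.sum_congr rfl fun _ _ => Finset.sum_congr rfl fun _ _ => mul_comm _ _
      rw [e2, ← e1]
      simp only [Matrix.mul_apply]
    simp only [Matrix.mulVec, dotProduct]
    rw [Finset.sum_comm]
    simp only [← Finset.sum_mul, hb, zero_mul, Finset.sum_const_zero]
  rw [hdiv, zero_add]

end IsLeviCivita

end Algebra

section Algebra

open Matrix

variable {n : ℕ} {A : Type*} [CommRing A]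

/-! ### First variation of the scalar curvature -/

namespace IsLeviCivita

variable {d : Fin n → Derivation ℤ A A} {G P : Matrix (Fin n) (Fin n) A}
  {Γ : Fin n → Matrix (Fin n) (Fin n) A}

/-- The vector `Gⁱʲ Dᵏᵢⱼ - Gᵏʲ Dˡₗⱼ` formed from a variation `D` of the connection. -/
def variationVec (P : Matrix (Fin n) (Fin n) A) (D : Fin n → Matrix (Fin n) (Fin n) A)
    (k : Fin n) : A :=
  ∑ j, (D j * P) k j - (P *ᵥ fun j => (D j).trace) k

/-- The Palatini identity: the metric trace of the variation of the Ricci tensor is a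
divergence. -/
theorem density_mul_trace_variation_ric (h : IsLeviCivita d G P Γ) {w : A}
    (hdw : ∀ k, d k w = w * (Γ k).trace) {δ : Derivation ℤ A A}
    (hδ : ∀ i a, δ (d i a) = d i (δ a)) :
    w * trace (P * (ric d Γ).map δ)
      = ∑ k, d k (w * variationVec P (fun i => (Γ i).map δ) k) := by
  set D : Fin n → Matrix (Fin n) (Fin n) A := fun i => (Γ i).map δ with hD
  have hDt : ∀ i j k, D i k j = D j k i := fun i j k => by
    simp only [hD, Matrix.map_apply, h.torsion i j k]
  have hPs : ∀ i j, P i j = P j i := fun i j => congrFun (congrFun h.inv_symm j) i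
  have htrD : ∀ j, (D j).trace = ∑ k, D k k j := fun j =>
    Finset.sum_congr rfl fun k _ => hDt j k k
  have hcurv : ∀ k j, (curv d Γ k j).map δ = (D j).map (d k) - (D k).map (d j)
      + (D k * Γ j + Γ k * D j) - (D j * Γ k + Γ j * D k) := by
    intro k j
    simp only [curv, matrix_map_derivation_sub, matrix_map_derivation_add,
      matrix_map_derivation_mul, hD]
    rw [matrix_map_derivation_comm (hδ k), matrix_map_derivation_comm (hδ j)]
  have htr : trace (P * (ric d Γ).map δ) = ∑ k, ∑ j, ((curv d Γ k j).map δ * P) k j := by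
    simp only [Matrix.trace, Matrix.diag, Matrix.mul_apply, Matrix.map_apply, ric,
      Matrix.of_apply, map_sum, Finset.mul_sum]
    rw [sum_rotate]
    refine Finset.sum_congr rfl fun k _ => ?_
    rw [Finset.sum_comm]
    exact Finset.sum_congr rfl fun j _ => Finset.sum_congr rfl fun i _ => mul_comm _ _
  have hV1 : ∀ k, d k (∑ j, (D j * P) k j) = ∑ j, ((D j).map (d k) * P) k j
      - ∑ j, (D j * Γ k * P) k j - ∑ j, (D j * P * (Γ k)ᵀ) k j := by
    intro k
    rw [map_sum, ← Finset.sum_sub_distrib, ← Finset.sum_sub_distrib]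
    refine Finset.sum_congr rfl fun j _ => ?_
    have := congrFun (congrFun (matrix_map_derivation_mul (d k) (D j) P) k) j
    rw [Matrix.map_apply] at this
    rw [this, h.map_inv, ← Matrix.sub_apply, ← Matrix.sub_apply]
    refine congrFun (congrFun (?_ : _ = _) k) j
    noncomm_ring
  have hV2 : ∑ k, d k ((P *ᵥ fun j => (D j).trace) k)
      = - ∑ k, (Γ k).trace * (P *ᵥ fun j => (D j).trace) k
        - ∑ k, ((P * (Γ k)ᵀ) *ᵥ fun j => (D j).trace) k
        + ∑ k, (P *ᵥ fun j => d k (D j).trace) k := by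
    rw [← sum_mulVec_eq h.torsion]
    simp only [derivation_mulVec, h.map_inv, Matrix.sub_mulVec, Matrix.neg_mulVec,
      Matrix.mulVec_mulVec, Pi.sub_apply, Pi.neg_apply, Finset.sum_add_distrib,
      Finset.sum_sub_distrib, Finset.sum_neg_distrib]
  -- the four contractions that are identified through torsion-freeness
  have hb : ∑ k, ∑ j, ((D k).map (d j) * P) k j = ∑ k, (P *ᵥ fun j => d k (D j).trace) k := by
    simp only [Matrix.mul_apply, Matrix.map_apply, Matrix.mulVec, dotProduct, htrD, map_sum,
      Finset.mul_sum]
    rw [Finset.sum_comm]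
    refine Finset.sum_congr rfl fun j _ => ?_
    rw [Finset.sum_comm]
    exact Finset.sum_congr rfl fun a _ => Finset.sum_congr rfl fun k _ => by
      rw [hPs j a, mul_comm]
  have hc : ∑ k, ∑ j, (D k * Γ j * P) k j
      = ∑ k, ((P * (Γ k)ᵀ) *ᵥ fun j => (D j).trace) k := by
    rw [Finset.sum_comm]
    refine Finset.sum_congr rfl fun j _ => ?_
    have e1 := sum_mulVec_eq hDt fun a => (Γ j * P) a j
    have e2 : ∀ k, (D k * Γ j * P) k j = (D k *ᵥ fun a => (Γ j * P) a j) k := by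
      intro k; rw [mul_assoc, Matrix.mul_apply]; rfl
    have e3 : P * (Γ j)ᵀ = (Γ j * P)ᵀ := by rw [Matrix.transpose_mul, h.inv_symm]
    simp only [e2, e1, e3]
    exact Finset.sum_congr rfl fun a _ => mul_comm _ _
  have he : ∑ k, ∑ j, (Γ k * D j * P) k j = ∑ k, (Γ k).trace * ∑ j, (D j * P) k j := by
    simp only [Finset.mul_sum]
    rw [Finset.sum_comm]
    conv_rhs => rw [Finset.sum_comm]
    refine Finset.sum_congr rfl fun j _ => ?_
    rw [← sum_mulVec_eq h.torsion fun k => (D j * P) k j]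
    exact Finset.sum_congr rfl fun k _ => by rw [mul_assoc, Matrix.mul_apply]; rfl
  have hf : ∑ k, ∑ j, (Γ j * D k * P) k j = ∑ k, ∑ j, (D j * P * (Γ k)ᵀ) k j := by
    simp only [Matrix.mul_apply, Finset.sum_mul, Matrix.transpose_apply]
    conv_lhs => enter [2, k]; rw [sum_rotate]
    rw [Finset.sum_comm]
    exact Finset.sum_congr rfl fun a _ => Finset.sum_congr rfl fun k _ =>
      Finset.sum_congr rfl fun j _ => Finset.sum_congr rfl fun b _ => by
        rw [h.torsion j a k]; ring
  have hexp : trace (P * (ric d Γ).map δ)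
      = ∑ k, ∑ j, ((D j).map (d k) * P) k j - ∑ k, ∑ j, ((D k).map (d j) * P) k j
        + (∑ k, ∑ j, (D k * Γ j * P) k j + ∑ k, ∑ j, (Γ k * D j * P) k j)
        - (∑ k, ∑ j, (D j * Γ k * P) k j + ∑ k, ∑ j, (Γ j * D k * P) k j) := by
    rw [htr]
    simp only [hcurv, add_mul, sub_mul, Matrix.add_apply, Matrix.sub_apply,
      Finset.sum_add_distrib, Finset.sum_sub_distrib]
  rw [sum_derivation_density_mul hdw, hexp, hb, hc, he, hf]
  simp only [variationVec, map_sub, hV1, Finset.sum_sub_distrib, hV2, mul_sub]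
  ring

/-- The first variation of scalar curvature is `L²`-adjoint, up to a divergence, to
`u ↦ ∇²u - (Δu) G - u Ric`. -/
theorem density_mul_variation_scalar (h : IsLeviCivita d G P Γ)
    (hcomm : ∀ i j a, d i (d j a) = d j (d i a)) {w : A}
    (hdw : ∀ k, d k w = w * (Γ k).trace) {δ : Derivation ℤ A A}
    (hδ : ∀ i a, δ (d i a) = d i (δ a)) (u : A) :
    w * (u * δ (trace (P * ric d Γ))
        - trace (P * (hess d Γ u - trace (P * hess d Γ u) • G - u • ric d Γ) * P * G.map δ))
      = ∑ k, d k (w * (u * variationVec P (fun i => (Γ i).map δ) k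
          - ((P * G.map δ) *ᵥ grad d P u) k + trace (P * G.map δ) * grad d P u k)) := by
  set D : Fin n → Matrix (Fin n) (Fin n) A := fun i => (Γ i).map δ with hD
  set H := G.map δ with hH
  have hDt : ∀ i j k, D i k j = D j k i := fun i j k => by
    simp only [hD, Matrix.map_apply, h.torsion i j k]
  have hdH : ∀ k, H.map (d k) = (D k)ᵀ * G + (Γ k)ᵀ * H + H * Γ k + G * D k := by
    intro k
    rw [hH, ← matrix_map_derivation_comm (hδ k), h.compat, matrix_map_derivation_add,
      matrix_map_derivation_mul, matrix_map_derivation_mul, ← Matrix.transpose_map]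
    abel
  have hPH : ∀ k, (P * H).map (d k) + Γ k * (P * H) - P * H * Γ k = P * (D k)ᵀ * G + D k := by
    intro k
    rw [matrix_map_derivation_mul, h.map_inv, hdH]
    calc _ = P * (D k)ᵀ * G + P * G * D k := by noncomm_ring
      _ = _ := by rw [h.inv_mul, one_mul]
  have hHs : Hᵀ = H := by rw [hH, ← Matrix.transpose_map, h.symm]
  have htrPH : ∀ k, d k (trace (P * H)) = 2 * (D k).trace := by
    intro k
    have e1 : d k (trace (P * H)) = trace ((P * H).map (d k)) := by
      simp [Matrix.trace]
    have e2 := congrArg Matrix.trace (hPH k)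
    rw [Matrix.trace_sub, Matrix.trace_add, Matrix.trace_mul_comm (Γ k), Matrix.trace_add,
      Matrix.trace_mul_comm _ G, ← mul_assoc, h.mul_inv, one_mul, Matrix.trace_transpose] at e2
    rw [e1]
    linear_combination e2
  have hGv : G *ᵥ grad d P u = fun j => d j u := by
    rw [grad, Matrix.mulVec_mulVec, h.mul_inv, Matrix.one_mulVec]
  -- the two divergences making up `Y`
  have hY1 := h.sum_derivation_mulVec_grad hcomm hdw (P * H) u
  simp only [hPH, Matrix.add_mulVec, Pi.add_apply, Finset.sum_add_distrib,
    sum_mulVec_eq hDt] at hY1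
  have hY2 := h.sum_derivation_mulVec_grad hcomm hdw (trace (P * H) • 1) u
  have hsc : ∀ k, (trace (P * H) • (1 : Matrix (Fin n) (Fin n) A)).map (d k)
      = (2 * (D k).trace) • 1 := by
    intro k
    ext i j
    by_cases hij : i = j <;> simp [hij, htrPH]
  simp only [hsc, Matrix.smul_mul, one_mul, Matrix.mul_smul, mul_one, add_sub_cancel_right,
    Matrix.smul_mulVec, Matrix.one_mulVec, Pi.smul_apply, smul_eq_mul, Matrix.trace_smul] at hY2
  have hpal := h.density_mul_trace_variation_ric hdw hδ
  have hδP : P.map δ = -(P * H * P) := by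
    have h3 : (P.map δ * G + P * H) * P = 0 := by
      rw [hH, ← matrix_map_derivation_mul, h.inv_mul, matrix_map_derivation_one, zero_mul]
    rw [add_mul, mul_assoc (P.map δ), h.mul_inv, mul_one] at h3
    exact eq_neg_of_add_eq_zero_left h3
  have hδR : δ (trace (P * ric d Γ)) = -trace (P * H * P * ric d Γ)
      + trace (P * (ric d Γ).map δ) := by
    have e1 : δ (trace (P * ric d Γ)) = trace ((P * ric d Γ).map δ) := by
      simp [Matrix.trace]
    rw [e1, matrix_map_derivation_mul, hδP, Matrix.trace_add, neg_mul, Matrix.trace_neg]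
  have hVu : ∑ k, variationVec P D k * d k u
      = ∑ k, ((P * (D k)ᵀ * G) *ᵥ grad d P u) k - ∑ k, (D k).trace * grad d P u k := by
    have hPs : ∀ i j, P i j = P j i := fun i j => congrFun (congrFun h.inv_symm j) i
    simp only [variationVec, sub_mul, Finset.sum_sub_distrib, ← Matrix.mulVec_mulVec _ _ G, hGv]
    congr 1
    · have hT : ∀ j, P * (D j)ᵀ = (D j * P)ᵀ := fun j => by
        rw [Matrix.transpose_mul, h.inv_symm]
      simp only [hT, Finset.sum_mul]
      rw [Finset.sum_comm]
      rfl
    · simp only [grad, Matrix.mulVec, dotProduct, Finset.sum_mul, Finset.mul_sum]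
      rw [Finset.sum_comm]
      exact Finset.sum_congr rfl fun j _ => Finset.sum_congr rfl fun k _ => by
        rw [hPs j k]; ring
  have hlhs : trace (P * (hess d Γ u - trace (P * hess d Γ u) • G - u • ric d Γ) * P * H)
      = trace (P * H * P * hess d Γ u) - trace (P * hess d Γ u) * trace (P * H)
        - u * trace (P * H * P * ric d Γ) := by
    have e1 : ∀ X, trace (P * X * P * H) = trace (P * H * P * X) := by
      intro X
      rw [mul_assoc (P * X), Matrix.trace_mul_comm, ← mul_assoc]
    rw [e1]
    simp only [mul_sub, Matrix.trace_sub, Matrix.mul_smul, Matrix.trace_smul, smul_eq_mul]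
    rw [mul_assoc (P * H) P G, h.inv_mul, mul_one]
  have hsplit : ∑ k, d k (w * (u * variationVec P D k - ((P * H) *ᵥ grad d P u) k
        + trace (P * H) * grad d P u k))
      = u * ∑ k, d k (w * variationVec P D k) + w * ∑ k, variationVec P D k * d k u
        - ∑ k, d k (w * ((P * H) *ᵥ grad d P u) k)
        + ∑ k, d k (w * (trace (P * H) * grad d P u k)) := by
    have e1 : ∀ k, d k (w * (u * variationVec P D k - ((P * H) *ᵥ grad d P u) k
        + trace (P * H) * grad d P u k))
        = u * d k (w * variationVec P D k) + w * (variationVec P D k * d k u)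
          - d k (w * ((P * H) *ᵥ grad d P u) k) + d k (w * (trace (P * H) * grad d P u k)) := by
      intro k
      have : w * (u * variationVec P D k - ((P * H) *ᵥ grad d P u) k
          + trace (P * H) * grad d P u k) = u * (w * variationVec P D k)
          - w * ((P * H) *ᵥ grad d P u) k + w * (trace (P * H) * grad d P u k) := by ring
      rw [this, map_add, map_sub, (d k).leibniz u]
      simp only [smul_eq_mul]
      ring
    simp only [e1, Finset.sum_add_distrib, Finset.sum_sub_distrib, Finset.mul_sum]
  rw [hsplit, hY1, hY2, hVu, ← hpal, hδR, hlhs]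
  have e2 : ∑ k, 2 * (D k).trace * grad d P u k = 2 * ∑ k, (D k).trace * grad d P u k := by
    rw [Finset.mul_sum]; exact Finset.sum_congr rfl fun _ _ => by ring
  rw [e2]
  ring

end IsLeviCivita

end Algebra

section Germs

open Filter Topology Matrix

/-! ### Germs of smooth functions -/

variable {V W : Type*} [NormedAddCommGroup V] [NormedSpace ℝ V] [NormedAddCommGroup W]
  [NormedSpace ℝ W]

/-- The ring of germs at `p` of smooth functions. -/
def SmoothGerm (p : V) : Subring (Germ (𝓝 p) ℝ) where
  carrier := {a | ∃ f : V → ℝ, ContDiffAt ℝ ∞ f p ∧ a = ↑f}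
  mul_mem' := by
    rintro _ _ ⟨f, hf, rfl⟩ ⟨g, hg, rfl⟩
    exact ⟨f * g, hf.mul hg, rfl⟩
  one_mem' := ⟨1, contDiffAt_const, rfl⟩
  add_mem' := by
    rintro _ _ ⟨f, hf, rfl⟩ ⟨g, hg, rfl⟩
    exact ⟨f + g, hf.add hg, rfl⟩
  zero_mem' := ⟨0, contDiffAt_const, rfl⟩
  neg_mem' := by
    rintro _ ⟨f, hf, rfl⟩
    exact ⟨-f, hf.neg, rfl⟩

namespace SmoothGerm

variable {p : V}

/-- The function `f` represents the germ `a`. -/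
def Rep (a : SmoothGerm p) (f : V → ℝ) : Prop := (a : Germ (𝓝 p) ℝ) = ↑f

/-- The germ of a smooth function. -/
def mk (f : V → ℝ) (hf : ContDiffAt ℝ ∞ f p) : SmoothGerm p := ⟨↑f, f, hf, rfl⟩

lemma rep_mk (f : V → ℝ) (hf : ContDiffAt ℝ ∞ f p) : Rep (mk f hf) f := rfl

lemma exists_rep (a : SmoothGerm p) : ∃ f : V → ℝ, ContDiffAt ℝ ∞ f p ∧ Rep a f := a.2

lemma Rep.eventuallyEq {a : SmoothGerm p} {f g : V → ℝ} (hf : Rep a f) (hg : Rep a g) :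
    f =ᶠ[𝓝 p] g := Germ.coe_eq.mp (hf.symm.trans hg)

lemma Rep.congr {a : SmoothGerm p} {f g : V → ℝ} (hf : Rep a f) (hfg : f =ᶠ[𝓝 p] g) :
    Rep a g := Eq.trans hf (Germ.coe_eq.mpr hfg)

lemma Rep.contDiffAt {a : SmoothGerm p} {f : V → ℝ} (hf : Rep a f) : ContDiffAt ℝ ∞ f p := by
  obtain ⟨g, hg, hag⟩ := exists_rep a
  exact hg.congr_of_eventuallyEq (hf.eventuallyEq hag)

lemma Rep.eq {a b : SmoothGerm p} {f : V → ℝ} (ha : Rep a f) (hb : Rep b f) : a = b :=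
  Subtype.ext (Eq.trans ha (Eq.symm hb))

lemma Rep.add {a b : SmoothGerm p} {f g : V → ℝ} (ha : Rep a f) (hb : Rep b g) :
    Rep (a + b) (fun z => f z + g z) := congrArg₂ (· + ·) ha hb

lemma Rep.sub {a b : SmoothGerm p} {f g : V → ℝ} (ha : Rep a f) (hb : Rep b g) :
    Rep (a - b) (fun z => f z - g z) := congrArg₂ (· - ·) ha hb

lemma Rep.mul {a b : SmoothGerm p} {f g : V → ℝ} (ha : Rep a f) (hb : Rep b g) :
    Rep (a * b) (fun z => f z * g z) := congrArg₂ (· * ·) ha hb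

lemma rep_zero : Rep (0 : SmoothGerm p) (fun _ => 0) := rfl

lemma rep_one : Rep (1 : SmoothGerm p) (fun _ => 1) := rfl

lemma Rep.sum {ι : Type*} {s : Finset ι} {a : ι → SmoothGerm p} {f : ι → V → ℝ}
    (h : ∀ i, Rep (a i) (f i)) : Rep (∑ i ∈ s, a i) (fun z => ∑ i ∈ s, f i z) := by
  classical
  induction s using Finset.induction_on with
  | empty => exact rep_zero
  | insert i s hi ih =>
    simp only [Finset.sum_insert hi]
    exact (h i).add ih

/-- Evaluation at the base point. -/
def eval (p : V) : SmoothGerm p →+* ℝ := Germ.valueRingHom.comp (SmoothGerm p).subtype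

lemma Rep.eval_eq {a : SmoothGerm p} {f : V → ℝ} (h : Rep a f) : eval p a = f p := by
  change Germ.value (a : Germ (𝓝 p) ℝ) = f p
  rw [show (a : Germ (𝓝 p) ℝ) = ↑f from h]
  rfl

/-- Germs have no 2-torsion, as needed wherever a skew expression is shown to vanish. -/
lemma eq_zero_of_two_mul (a : SmoothGerm p) (h : 2 * a = 0) : a = 0 := by
  obtain ⟨f, -, ha⟩ := exists_rep a
  have h1 : Rep (2 * a) (fun z => f z + f z) := by rw [two_mul]; exact ha.add ha
  rw [h] at h1
  refine Rep.eq ha (rep_zero.congr ?_)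
  filter_upwards [rep_zero.eventuallyEq h1] with z hz
  linarith

lemma isUnit_of_rep {a : SmoothGerm p} {f : V → ℝ} (ha : Rep a f) (h0 : f p ≠ 0) : IsUnit a := by
  have hf := ha.contDiffAt
  refine IsUnit.of_mul_eq_one (mk (fun z => (f z)⁻¹) (hf.inv h0)) ?_
  refine Rep.eq (ha.mul (rep_mk _ _)) (rep_one.congr ?_)
  filter_upwards [hf.continuousAt.eventually_ne h0] with z hz
  rw [mul_inv_cancel₀ hz]

lemma contDiffAt_fderiv_apply {f : V → ℝ} (hf : ContDiffAt ℝ ∞ f p) (v : V) :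
    ContDiffAt ℝ ∞ (fun z => fderiv ℝ f z v) p :=
  (hf.fderiv_right (m := ∞) (by simp)).clm_apply contDiffAt_const

lemma eventually_differentiableAt {f : V → ℝ} (hf : ContDiffAt ℝ ∞ f p) :
    ∀ᶠ z in 𝓝 p, DifferentiableAt ℝ f z := by
  filter_upwards [(hf.of_le (m := 1) (by simp)).eventually (by simp)] with z hz
  exact hz.differentiableAt (by simp)

/-- The underlying function of the derivation `dir v`. -/
def dirFun (v : V) (a : SmoothGerm p) : SmoothGerm p :=
  mk (fun z => fderiv ℝ (exists_rep a).choose z v)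
    (contDiffAt_fderiv_apply (exists_rep a).choose_spec.1 v)

lemma Rep.dirFun {a : SmoothGerm p} {f : V → ℝ} (h : Rep a f) (v : V) :
    Rep (dirFun v a) (fun z => fderiv ℝ f z v) := by
  refine Rep.congr (rep_mk _ _) ?_
  filter_upwards [((exists_rep a).choose_spec.2.eventuallyEq h).fderiv (𝕜 := ℝ)] with z hz
  rw [hz]

/-- The derivative in the direction `v` as a derivation of the ring of germs. -/
def dir (v : V) : Derivation ℤ (SmoothGerm p) (SmoothGerm p) :=
  Derivation.mk'
    (AddMonoidHom.toIntLinearMap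
      { toFun := dirFun v
        map_zero' := by
          refine Rep.eq (rep_zero.dirFun v) (rep_zero.congr ?_)
          exact Eventually.of_forall fun z => by simp
        map_add' := by
          intro a b
          obtain ⟨f, hf, ha⟩ := exists_rep a
          obtain ⟨g, hg, hb⟩ := exists_rep b
          refine Rep.eq ((ha.add hb).dirFun v) (((ha.dirFun v).add (hb.dirFun v)).congr ?_)
          filter_upwards [eventually_differentiableAt hf, eventually_differentiableAt hg]
            with z h1 h2
          rw [fderiv_fun_add h1 h2]
          rfl })
    (by
      intro a b
      obtain ⟨f, hf, ha⟩ := exists_rep a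
      obtain ⟨g, hg, hb⟩ := exists_rep b
      refine Rep.eq ((ha.mul hb).dirFun v)
        (((ha.mul (hb.dirFun v)).add (hb.mul (ha.dirFun v))).congr ?_)
      filter_upwards [eventually_differentiableAt hf, eventually_differentiableAt hg]
        with z h1 h2
      rw [fderiv_fun_mul h1 h2]
      simp)

lemma Rep.dir {a : SmoothGerm p} {f : V → ℝ} (h : Rep a f) (v : V) :
    Rep (dir v a) (fun z => fderiv ℝ f z v) := h.dirFun v

lemma dir_comm (v w : V) (a : SmoothGerm p) : dir v (dir w a) = dir w (dir v a) := by
  obtain ⟨f, hf, ha⟩ := exists_rep a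
  refine Rep.eq ((ha.dir w).dir v) (((ha.dir v).dir w).congr ?_)
  have h2 : ∀ᶠ z in 𝓝 p, ContDiffAt ℝ 2 f z :=
    (hf.of_le (m := 2) (by norm_cast)).eventually (by simp)
  filter_upwards [h2] with z hz
  have hd : DifferentiableAt ℝ (fderiv ℝ f) z :=
    (hz.fderiv_right (m := 1) (by norm_num)).differentiableAt (by simp)
  have e : ∀ v w, fderiv ℝ (fun z => fderiv ℝ f z w) z v = fderiv ℝ (fderiv ℝ f) z v w := by
    intro v w
    rw [fderiv_clm_apply hd (differentiableAt_const w)]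
    simp
  rw [e, e]
  exact (hz.isSymmSndFDerivAt (by simp)).eq w v

/-- Pullback of germs along a smooth map. -/
def pull (φ : V → W) (hφ : ContDiffAt ℝ ∞ φ p) : SmoothGerm (φ p) →+* SmoothGerm p where
  toFun a := ⟨(a : Germ (𝓝 (φ p)) ℝ).compTendsto φ hφ.continuousAt, by
    obtain ⟨f, hf, ha⟩ := exists_rep a
    refine ⟨f ∘ φ, hf.comp p hφ, ?_⟩
    rw [show (a : Germ (𝓝 (φ p)) ℝ) = ↑f from ha]
    rfl⟩
  map_one' := rfl
  map_zero' := rfl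
  map_mul' a b := by
    obtain ⟨f, hf, ha⟩ := exists_rep a
    obtain ⟨g, hg, hb⟩ := exists_rep b
    apply Subtype.ext
    change Germ.compTendsto ((a : Germ (𝓝 (φ p)) ℝ) * (b : Germ (𝓝 (φ p)) ℝ)) φ
        hφ.continuousAt
      = Germ.compTendsto (a : Germ (𝓝 (φ p)) ℝ) φ hφ.continuousAt
        * Germ.compTendsto (b : Germ (𝓝 (φ p)) ℝ) φ hφ.continuousAt
    rw [show (a : Germ (𝓝 (φ p)) ℝ) = ↑f from ha, show (b : Germ (𝓝 (φ p)) ℝ) = ↑g from hb]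
    rfl
  map_add' a b := by
    obtain ⟨f, hf, ha⟩ := exists_rep a
    obtain ⟨g, hg, hb⟩ := exists_rep b
    apply Subtype.ext
    change Germ.compTendsto ((a : Germ (𝓝 (φ p)) ℝ) + (b : Germ (𝓝 (φ p)) ℝ)) φ
        hφ.continuousAt
      = Germ.compTendsto (a : Germ (𝓝 (φ p)) ℝ) φ hφ.continuousAt
        + Germ.compTendsto (b : Germ (𝓝 (φ p)) ℝ) φ hφ.continuousAt
    rw [show (a : Germ (𝓝 (φ p)) ℝ) = ↑f from ha, show (b : Germ (𝓝 (φ p)) ℝ) = ↑g from hb]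
    rfl

lemma Rep.pull {φ : V → W} (hφ : ContDiffAt ℝ ∞ φ p) {a : SmoothGerm (φ p)} {f : W → ℝ}
    (h : Rep a f) : Rep (pull φ hφ a) (f ∘ φ) := by
  change Germ.compTendsto (a : Germ (𝓝 (φ p)) ℝ) φ hφ.continuousAt = _
  rw [show (a : Germ (𝓝 (φ p)) ℝ) = ↑f from h]
  rfl

end SmoothGerm

end Germs

/-! ### The Koszul formula -/

section Koszul

open Matrix

variable {n : ℕ} {A : Type*} [CommRing A]

/-- The Koszul formula defines a Levi-Civita connection. -/
lemma isLeviCivita_koszul {d : Fin n → Derivation ℤ A A} {G P : Matrix (Fin n) (Fin n) A}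
    {c : A} (hc : 2 * c = 1) (hG : Gᵀ = G) (hP : P * G = 1) :
    IsLeviCivita d G P fun i => Matrix.of fun k j =>
      c * ∑ l, P k l * (d i (G j l) + d j (G i l) - d l (G i j)) := by
  have hGs : ∀ i j, G i j = G j i := fun i j => congrFun (congrFun hG j) i
  refine ⟨hG, hP, ?_, ?_⟩
  · intro i j k
    simp only [Matrix.of_apply]
    congr 1
    exact Finset.sum_congr rfl fun l _ => by rw [hGs i j, add_comm (d i (G j l))]
  · intro i
    have hGP : G * P = 1 := mul_eq_one_comm.mp hP
    have key : ∀ a j, (G * Matrix.of fun k j =>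
        c * ∑ l, P k l * (d i (G j l) + d j (G i l) - d l (G i j))) a j
        = c * (d i (G j a) + d j (G i a) - d a (G i j)) := by
      intro a j
      have e1 : (Matrix.of fun k j => c * ∑ l, P k l * (d i (G j l) + d j (G i l) - d l (G i j)))
          = c • (P * Matrix.of fun l j => d i (G j l) + d j (G i l) - d l (G i j)) := by
        ext k j
        simp [Matrix.mul_apply]
      rw [e1, Matrix.mul_smul, ← mul_assoc, hGP, one_mul]
      simp
    ext a j
    rw [Matrix.add_apply, key]
    have e2 := key j a
    have e3 : ∀ X : Matrix (Fin n) (Fin n) A, (Xᵀ * G) a j = (G * X) j a := by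
      intro X
      rw [← Matrix.transpose_apply (G * X), Matrix.transpose_mul, hG]
    rw [e3, e2, Matrix.map_apply, hGs j a]
    linear_combination -(d i (G a j)) * hc

end Koszul

section

open Filter Topology Matrix SmoothGerm

/-! ### Local Riemannian geometry through germs -/

variable {n : ℕ} {V : Type*} [NormedAddCommGroup V] [NormedSpace ℝ V] {p : V}

/-- The matrix-valued function `F` represents the matrix of germs `M`. -/
def RepMat (M : Matrix (Fin n) (Fin n) (SmoothGerm p)) (F : V → Matrix (Fin n) (Fin n) ℝ) : Prop :=
  ∀ i j, Rep (M i j) fun z => F z i j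

namespace RepMat

variable {M N : Matrix (Fin n) (Fin n) (SmoothGerm p)} {F H : V → Matrix (Fin n) (Fin n) ℝ}

lemma mul (hM : RepMat M F) (hN : RepMat N H) : RepMat (M * N) fun z => F z * H z :=
  fun i j => Rep.sum fun k => (hM i k).mul (hN k j)

lemma sub (hM : RepMat M F) (hN : RepMat N H) : RepMat (M - N) fun z => F z - H z :=
  fun i j => (hM i j).sub (hN i j)

lemma smul {a : SmoothGerm p} {f : V → ℝ} (ha : Rep a f) (hM : RepMat M F) :
    RepMat (a • M) fun z => f z • F z :=
  fun i j => ha.mul (hM i j)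

lemma transpose (hM : RepMat M F) : RepMat Mᵀ fun z => (F z)ᵀ := fun i j => hM j i

lemma trace (hM : RepMat M F) : Rep M.trace fun z => (F z).trace := Rep.sum fun i => hM i i

lemma map_dir (hM : RepMat M F) (v : V) :
    RepMat (M.map (dir v)) fun z => Matrix.of fun i j => fderiv ℝ (fun z => F z i j) z v :=
  fun i j => (hM i j).dir v

lemma mulVec (hM : RepMat M F) {a : Fin n → SmoothGerm p} {f : V → Fin n → ℝ}
    (ha : ∀ j, Rep (a j) fun z => f z j) (i : Fin n) :
    Rep ((M *ᵥ a) i) fun z => (F z *ᵥ f z) i :=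
  Rep.sum fun j => (hM i j).mul (ha j)

lemma eventuallyEq (hM : RepMat M F) (hN : RepMat M H) : F =ᶠ[𝓝 p] H := by
  have : ∀ᶠ z in 𝓝 p, ∀ i j, F z i j = H z i j :=
    eventually_all.mpr fun i => eventually_all.mpr fun j => (hM i j).eventuallyEq (hN i j)
  filter_upwards [this] with z hz
  ext i j; exact hz i j

lemma congr (hM : RepMat M F) (hFH : F =ᶠ[𝓝 p] H) : RepMat M H := fun i j =>
  (hM i j).congr (hFH.mono fun _ hz => congrFun (congrFun hz i) j)

lemma map_eval (hM : RepMat M F) : M.map (eval p) = F p := by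
  ext i j; exact (hM i j).eval_eq

lemma det (hM : RepMat M F) : Rep M.det fun z => (F z).det := by
  have hprod : ∀ (s : Finset (Fin n)) (σ : Equiv.Perm (Fin n)),
      Rep (∏ i ∈ s, M (σ i) i) fun z => ∏ i ∈ s, F z (σ i) i := by
    intro s σ
    induction s using Finset.induction_on with
    | empty => exact rep_one
    | insert i s hi ih => simpa only [Finset.prod_insert hi] using (hM (σ i) i).mul ih
  simp only [Matrix.det_apply]
  refine Rep.sum fun σ => ?_
  rcases Int.units_eq_one_or (Equiv.Perm.sign σ) with h | h
  · simpa only [h, one_smul] using hprod Finset.univ σ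
  · have := rep_zero.sub (hprod Finset.univ σ)
    simpa only [h, Units.neg_smul, one_smul, zero_sub] using this

end RepMat

lemma exists_repMat (M : Matrix (Fin n) (Fin n) (SmoothGerm p)) : ∃ F, RepMat M F :=
  ⟨fun z => Matrix.of fun i j => (exists_rep (M i j)).choose z,
    fun i j => (exists_rep (M i j)).choose_spec.2⟩

lemma repMat_one : RepMat (1 : Matrix (Fin n) (Fin n) (SmoothGerm p)) fun _ => 1 := by
  intro i j
  by_cases h : i = j
  · subst h
    simp only [Matrix.one_apply_eq]
    exact rep_one
  · simp only [Matrix.one_apply_ne h]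
    exact rep_zero

/-- `G` is, near `p`, a smooth field of symmetric matrices, nondegenerate at `p`. Definiteness is
not required, as the Levi-Civita connection does not need it. -/
structure IsMetricAt (G : V → Matrix (Fin n) (Fin n) ℝ) (p : V) : Prop where
  smooth : ∀ i j, ContDiffAt ℝ ∞ (fun z => G z i j) p
  symm : ∀ᶠ z in 𝓝 p, (G z)ᵀ = G z
  det_ne_zero : (G p).det ≠ 0

/-- Christoffel symbols formed with derivatives in the directions `b`. -/
def chrDir (b : Fin n → V) (G : V → Matrix (Fin n) (Fin n) ℝ) (k i j : Fin n) (z : V) : ℝ :=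
  (1 / 2) * ∑ l, (G z)⁻¹ k l *
    (fderiv ℝ (fun z => G z j l) z (b i) + fderiv ℝ (fun z => G z i l) z (b j)
      - fderiv ℝ (fun z => G z i j) z (b l))

/-- The Ricci matrix formed with derivatives in the directions `b`. -/
def ricDir (b : Fin n → V) (G : V → Matrix (Fin n) (Fin n) ℝ) (z : V) :
    Matrix (Fin n) (Fin n) ℝ :=
  Matrix.of fun i j =>
    ∑ k, (fderiv ℝ (chrDir b G k i j) z (b k) - fderiv ℝ (chrDir b G k k j) z (b i))
    + ∑ k, ∑ l, (chrDir b G k k l z * chrDir b G l i j z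
        - chrDir b G k i l z * chrDir b G l k j z)

/-- The Hessian matrix formed with derivatives in the directions `b`. -/
def hessDir (b : Fin n → V) (G : V → Matrix (Fin n) (Fin n) ℝ) (u : V → ℝ) (z : V) :
    Matrix (Fin n) (Fin n) ℝ :=
  Matrix.of fun i j =>
    fderiv ℝ (fun z => fderiv ℝ u z (b j)) z (b i)
      - ∑ k, chrDir b G k i j z * fderiv ℝ u z (b k)

/-- The data of a metric and its Levi-Civita connection in the ring of germs at `p`. -/
structure IsGermOf (b : Fin n → V) (G : V → Matrix (Fin n) (Fin n) ℝ)
    (g g' : Matrix (Fin n) (Fin n) (SmoothGerm p))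
    (Γ : Fin n → Matrix (Fin n) (Fin n) (SmoothGerm p)) : Prop where
  leviCivita : IsLeviCivita (fun i => dir (b i)) g g' Γ
  metric : RepMat g G
  inverse : RepMat g' fun z => (G z)⁻¹
  connection : ∀ i, RepMat (Γ i) fun z => Matrix.of fun k j => chrDir b G k i j z

/-- A metric has a Levi-Civita connection in the ring of germs, represented by its Christoffel
symbols: the determinant is invertible there, and the Koszul formula applies. -/
lemma IsMetricAt.exists_germs {G : V → Matrix (Fin n) (Fin n) ℝ} (hG : IsMetricAt G p)
    (b : Fin n → V) : ∃ g g' Γ, IsGermOf (p := p) b G g g' Γ := by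
  set g : Matrix (Fin n) (Fin n) (SmoothGerm p) :=
    Matrix.of fun i j => SmoothGerm.mk (fun z => G z i j) (hG.smooth i j) with hg
  have hgrep : RepMat g G := fun i j => rep_mk _ (hG.smooth i j)
  have hunit : IsUnit g.det := isUnit_of_rep hgrep.det hG.det_ne_zero
  have hinv : g⁻¹ * g = 1 := Matrix.nonsing_inv_mul _ hunit
  obtain ⟨F, hF⟩ := exists_repMat g⁻¹
  have hFinv : F =ᶠ[𝓝 p] fun z => (G z)⁻¹ := by
    have h1 := hF.mul hgrep
    rw [hinv] at h1
    filter_upwards [h1.eventuallyEq repMat_one] with z hz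
    exact (Matrix.inv_eq_left_inv hz).symm
  have hinvrep := hF.congr hFinv
  have hsymm : gᵀ = g := by
    refine Matrix.ext fun i j => ?_
    refine Rep.eq (hgrep j i) ((hgrep i j).congr ?_)
    filter_upwards [hG.symm] with z hz
    exact congrFun (congrFun hz j) i
  set c : SmoothGerm p := SmoothGerm.mk (fun _ => 1 / 2) contDiffAt_const with hc
  have hcrep : Rep c fun _ => 1 / 2 := rep_mk _ _
  have hc2 : 2 * c = 1 := by
    rw [two_mul]
    refine Rep.eq (hcrep.add hcrep) (rep_one.congr ?_)
    exact Eventually.of_forall fun _ => by norm_num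
  refine ⟨g, g⁻¹, _, isLeviCivita_koszul hc2 hsymm hinv, hgrep, hinvrep, ?_⟩
  intro i k j
  exact hcrep.mul (Rep.sum fun l => (hinvrep k l).mul
    ((((hgrep j l).dir _).add ((hgrep i l).dir _)).sub ((hgrep i j).dir _)))

namespace IsGermOf

variable {b : Fin n → V} {G : V → Matrix (Fin n) (Fin n) ℝ}
  {g g' : Matrix (Fin n) (Fin n) (SmoothGerm p)}
  {Γ : Fin n → Matrix (Fin n) (Fin n) (SmoothGerm p)}

lemma rep_ric (h : IsGermOf b G g g' Γ) : RepMat (ric (fun i => dir (b i)) Γ) (ricDir b G) := by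
  intro i j
  have hc := h.connection
  change Rep (∑ k, curv (fun i => dir (b i)) Γ k i k j) _
  have h1 := Rep.sum (s := Finset.univ) fun k =>
    ((((hc i k j).dir (b k)).sub ((hc k k j).dir (b i))).add ((hc k).mul (hc i) k j)).sub
      ((hc i).mul (hc k) k j)
  refine Rep.congr h1 (Eventually.of_forall fun z => ?_)
  simp only [ricDir, Matrix.of_apply, Matrix.mul_apply, Finset.sum_sub_distrib,
    Finset.sum_add_distrib]
  ring

lemma rep_scal (h : IsGermOf b G g g' Γ) :
    Rep (trace (g' * ric (fun i => dir (b i)) Γ)) fun z => trace ((G z)⁻¹ * ricDir b G z) :=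
  (h.inverse.mul h.rep_ric).trace

lemma rep_hess (h : IsGermOf b G g g' Γ) {a : SmoothGerm p} {u : V → ℝ} (ha : Rep a u) :
    RepMat (hess (fun i => dir (b i)) Γ a) (hessDir b G u) := fun i j =>
  ((ha.dir (b j)).dir (b i)).sub (Rep.sum fun k => (h.connection i k j).mul (ha.dir (b k)))

lemma rep_grad (h : IsGermOf b G g g' Γ) {a : SmoothGerm p} {u : V → ℝ} (ha : Rep a u)
    (i : Fin n) : Rep (IsLeviCivita.grad (fun i => dir (b i)) g' a i)
      fun z => ((G z)⁻¹ *ᵥ fun j => fderiv ℝ u z (b j)) i :=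
  h.inverse.mulVec (fun j => ha.dir (b j)) i

/-- The germ of the volume density `√(det G)`. -/
lemma exists_density (h : IsGermOf b G g g' Γ) (hpos : 0 < (G p).det) :
    ∃ w : SmoothGerm p, Rep w (fun z => √(G z).det) ∧ IsUnit w ∧
      ∀ k, dir (b k) w = w * (Γ k).trace := by
  have hdet := h.metric.det
  have hs : ContDiffAt ℝ ∞ (fun z => √(G z).det) p := hdet.contDiffAt.sqrt hpos.ne'
  refine ⟨SmoothGerm.mk _ hs, rep_mk _ _, ?_, ?_⟩
  · exact isUnit_of_rep (rep_mk _ hs) (Real.sqrt_pos.mpr hpos).ne'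
  · refine h.leviCivita.derivation_density eq_zero_of_two_mul
      (isUnit_of_rep (rep_mk _ hs) (Real.sqrt_pos.mpr hpos).ne') ?_
    refine Rep.eq ((rep_mk _ hs).mul (rep_mk _ hs)) (hdet.congr ?_)
    filter_upwards [hdet.contDiffAt.continuousAt.eventually (lt_mem_nhds hpos)] with z hz
    exact (Real.mul_self_sqrt hz.le).symm

end IsGermOf

end

section

open Filter Topology Matrix SmoothGerm

variable {n : ℕ}

/-! ### Coordinate expressions: change of coordinates and divergences -/

/-- The coordinate directions of `ℝⁿ`. -/
def stdDir (i : Fin n) : EuclideanSpace ℝ (Fin n) := EuclideanSpace.single i 1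

lemma ricciCoord_eq_ricDir (G : EuclideanSpace ℝ (Fin n) → Matrix (Fin n) (Fin n) ℝ) :
    ricciCoord G = ricDir stdDir G := rfl

/-- The Jacobian matrix of `φ`. -/
def jac (φ : EuclideanSpace ℝ (Fin n) → EuclideanSpace ℝ (Fin n)) (z : EuclideanSpace ℝ (Fin n)) :
    Matrix (Fin n) (Fin n) ℝ :=
  Matrix.of fun a i => partialDeriv i (fun z => φ z a) z

lemma fderiv_apply_coord {φ : EuclideanSpace ℝ (Fin n) → EuclideanSpace ℝ (Fin n)}
    {z : EuclideanSpace ℝ (Fin n)} (h : DifferentiableAt ℝ φ z) (v : EuclideanSpace ℝ (Fin n))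
    (a : Fin n) :
    fderiv ℝ φ z v a = fderiv ℝ (fun z => φ z a) z v := by
  have := ((EuclideanSpace.proj (𝕜 := ℝ) a).hasFDerivAt.comp z h.hasFDerivAt).fderiv
  have e : (fun z => φ z a) = (EuclideanSpace.proj (𝕜 := ℝ) a) ∘ φ := rfl
  rw [e, this]
  rfl

lemma eq_sum_stdDir (v : EuclideanSpace ℝ (Fin n)) : v = ∑ a, v a • stdDir a := by
  ext i
  simp [stdDir, Pi.single_apply]

lemma contDiffAt_coord {φ : EuclideanSpace ℝ (Fin n) → EuclideanSpace ℝ (Fin n)}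
    {y : EuclideanSpace ℝ (Fin n)} (hφ : ContDiffAt ℝ ∞ φ y) (a : Fin n) :
    ContDiffAt ℝ ∞ (fun z => φ z a) y :=
  (EuclideanSpace.proj (𝕜 := ℝ) a).contDiff.contDiffAt.comp y hφ

/-- Under a change of coordinates, the Ricci matrix and the Hessians transform as tensors. -/
theorem coord_change {φ : EuclideanSpace ℝ (Fin n) → EuclideanSpace ℝ (Fin n)}
    {y : EuclideanSpace ℝ (Fin n)} (hφ : ContDiffAt ℝ ∞ φ y)
    {G G' : EuclideanSpace ℝ (Fin n) → Matrix (Fin n) (Fin n) ℝ} (hG : IsMetricAt G (φ y))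
    (hG' : IsMetricAt G' y)
    (hdet : (jac φ y).det ≠ 0)
    (h : ∀ᶠ z in 𝓝 y, G' z = (jac φ z)ᵀ * G (φ z) * jac φ z) :
    ricciCoord G' y = (jac φ y)ᵀ * ricciCoord G (φ y) * jac φ y ∧
    ∀ u : EuclideanSpace ℝ (Fin n) → ℝ, ContDiffAt ℝ ∞ u (φ y) →
      hessianCoord G' (u ∘ φ) y = (jac φ y)ᵀ * hessianCoord G u (φ y) * jac φ y := by
  obtain ⟨g, gi, Γ, hg⟩ := hG.exists_germs stdDir
  obtain ⟨g', gi', Γ', hg'⟩ := hG'.exists_germs stdDir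
  set σ := pull φ hφ with hσ
  set J : Matrix (Fin n) (Fin n) (SmoothGerm y) :=
    Matrix.of fun a i => dir (stdDir i) (SmoothGerm.mk _ (contDiffAt_coord hφ a)) with hJ
  have hJrep : RepMat J (jac φ) := fun a i => (rep_mk _ (contDiffAt_coord hφ a)).dir _
  have hJunit : IsUnit J.det := isUnit_of_rep hJrep.det hdet
  have hmapσ : ∀ {M : Matrix (Fin n) (Fin n) (SmoothGerm (φ y))} {F},
      RepMat M F → RepMat (M.map σ) fun z => F (φ z) := fun hM i j => (hM i j).pull hφ
  have hchange : IsCoordChange (fun i => dir (stdDir i)) (fun i => dir (stdDir i)) σ J J⁻¹ := by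
    refine ⟨Matrix.nonsing_inv_mul _ hJunit, ?_, fun i j a => dir_comm _ _ _⟩
    intro i b
    obtain ⟨f, hf, hb⟩ := exists_rep b
    refine Rep.eq ((hb.pull hφ).dir _)
      ((Rep.sum fun a => (hJrep a i).mul ((hb.dir (stdDir a)).pull hφ)).congr ?_)
    have hφd : ∀ᶠ z in 𝓝 y, DifferentiableAt ℝ φ z := by
      filter_upwards [(hφ.of_le (m := 1) (by simp)).eventually (by simp)] with z hz
      exact hz.differentiableAt (by simp)
    filter_upwards [hφd, hφ.continuousAt.eventually (eventually_differentiableAt hf)] with z h1 h2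
    rw [fderiv_comp z h2 h1, ContinuousLinearMap.comp_apply,
      eq_sum_stdDir (fderiv ℝ φ z (stdDir i)), map_sum]
    refine Finset.sum_congr rfl fun a _ => ?_
    rw [map_smul, smul_eq_mul, fderiv_apply_coord h1]
    rfl
  have hGJ : g' = Jᵀ * g.map σ * J := by
    refine Matrix.ext fun i j => ?_
    exact Rep.eq (hg'.metric i j)
      ((((hJrep.transpose.mul (hmapσ hg.metric)).mul hJrep).congr (h.mono fun z hz => hz.symm)) i j)
  have htens : ∀ {M' : Matrix (Fin n) (Fin n) (SmoothGerm y)}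
      {M : Matrix (Fin n) (Fin n) (SmoothGerm (φ y))} {F' F}, RepMat M' F' → RepMat M F →
      M' = Jᵀ * M.map σ * J → F' y = (jac φ y)ᵀ * F (φ y) * jac φ y := by
    intro M' M F' F hM' hM hMM
    have := ((hJrep.transpose.mul (hmapσ hM)).mul hJrep).map_eval
    rw [← hMM, hM'.map_eval] at this
    exact this
  refine ⟨htens hg'.rep_ric hg.rep_ric (hchange.ricci eq_zero_of_two_mul
    (fun i j a => dir_comm _ _ _) hg.leviCivita hg'.leviCivita hGJ), fun u hu => ?_⟩
  exact htens (hg'.rep_hess ((rep_mk u hu).pull hφ)) (hg.rep_hess (rep_mk u hu))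
    (hchange.hessian eq_zero_of_two_mul hg.leviCivita hg'.leviCivita hGJ _)

lemma IsMetricAt.contDiffAt_ricciCoord {G : EuclideanSpace ℝ (Fin n) → Matrix (Fin n) (Fin n) ℝ}
    {y : EuclideanSpace ℝ (Fin n)}
    (hG : IsMetricAt G y) (i j : Fin n) : ContDiffAt ℝ ∞ (fun z => ricciCoord G z i j) y := by
  obtain ⟨g, gi, Γ, hg⟩ := hG.exists_germs stdDir
  exact (hg.rep_ric i j).contDiffAt

lemma IsMetricAt.contDiffAt_inv {G : EuclideanSpace ℝ (Fin n) → Matrix (Fin n) (Fin n) ℝ}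
    {y : EuclideanSpace ℝ (Fin n)}
    (hG : IsMetricAt G y) (i j : Fin n) : ContDiffAt ℝ ∞ (fun z => (G z)⁻¹ i j) y := by
  obtain ⟨g, gi, Γ, hg⟩ := hG.exists_germs stdDir
  exact (hg.inverse i j).contDiffAt

lemma IsMetricAt.contDiffAt_det {G : EuclideanSpace ℝ (Fin n) → Matrix (Fin n) (Fin n) ℝ}
    {y : EuclideanSpace ℝ (Fin n)}
    (hG : IsMetricAt G y) : ContDiffAt ℝ ∞ (fun z => (G z).det) y := by
  obtain ⟨g, gi, Γ, hg⟩ := hG.exists_germs stdDir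
  exact hg.metric.det.contDiffAt

lemma IsMetricAt.ricciCoord_symm {G : EuclideanSpace ℝ (Fin n) → Matrix (Fin n) (Fin n) ℝ}
    {y : EuclideanSpace ℝ (Fin n)}
    (hG : IsMetricAt G y) (hpos : 0 < (G y).det) : (ricciCoord G y)ᵀ = ricciCoord G y := by
  obtain ⟨g, gi, Γ, hg⟩ := hG.exists_germs stdDir
  obtain ⟨w, -, hw, hdw⟩ := hg.exists_density hpos
  have h1 := hg.leviCivita.ric_symm (fun i j a => dir_comm _ _ _) hw hdw
  have h2 := hg.rep_ric.map_eval
  have h3 := hg.rep_ric.transpose.map_eval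
  rw [h1, h2] at h3
  exact h3.symm

/-- The gradient in coordinates. -/
def gradCoord (G : EuclideanSpace ℝ (Fin n) → Matrix (Fin n) (Fin n) ℝ)
    (u : EuclideanSpace ℝ (Fin n) → ℝ) (z : EuclideanSpace ℝ (Fin n)) : Fin n → ℝ :=
  (G z)⁻¹ *ᵥ fun j => partialDeriv j u z

/-- The vector density `√(det G) ∇u`. -/
def gradDensity (G : EuclideanSpace ℝ (Fin n) → Matrix (Fin n) (Fin n) ℝ)
    (u : EuclideanSpace ℝ (Fin n) → ℝ) (k : Fin n) (z : EuclideanSpace ℝ (Fin n)) : ℝ :=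
  √(G z).det * gradCoord G u z k

/-- The vector density `√(det G) Ric(∇u)`. -/
def ricGradDensity (G : EuclideanSpace ℝ (Fin n) → Matrix (Fin n) (Fin n) ℝ)
    (u : EuclideanSpace ℝ (Fin n) → ℝ) (k : Fin n) (z : EuclideanSpace ℝ (Fin n)) : ℝ :=
  √(G z).det * (((G z)⁻¹ * (ricciCoord G z)ᵀ) *ᵥ gradCoord G u z) k

/-- `√(det G) Δu` is the coordinate divergence of the vector density `√(det G) ∇u`. -/
theorem laplacian_eq_divergence {G : EuclideanSpace ℝ (Fin n) → Matrix (Fin n) (Fin n) ℝ}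
    {y : EuclideanSpace ℝ (Fin n)}
    (hG : IsMetricAt G y) (hpos : 0 < (G y).det) {u : EuclideanSpace ℝ (Fin n) → ℝ}
    (hu : ContDiffAt ℝ ∞ u y) :
    √(G y).det * trace ((G y)⁻¹ * hessianCoord G u y)
      = ∑ k, partialDeriv k (gradDensity G u k) y ∧
    ∀ k, ContDiffAt ℝ ∞ (gradDensity G u k) y := by
  obtain ⟨g, gi, Γ, hg⟩ := hG.exists_germs stdDir
  obtain ⟨w, hwr, hw, hdw⟩ := hg.exists_density hpos
  have hur := rep_mk u hu
  have hX : ∀ k, Rep (w * IsLeviCivita.grad (fun i => dir (stdDir i)) gi (SmoothGerm.mk u hu) k)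
      (gradDensity G u k) := fun k => hwr.mul (hg.rep_grad hur k)
  refine ⟨?_, fun k => (hX k).contDiffAt⟩
  have h1 := hg.leviCivita.density_mul_laplacian (fun i j a => dir_comm _ _ _) hdw
    (SmoothGerm.mk u hu)
  have hl := hwr.mul (hg.inverse.mul (hg.rep_hess hur)).trace
  have hr := Rep.sum (s := Finset.univ) fun k => (hX k).dir (stdDir k)
  have e1 := hl.eval_eq
  rw [h1, hr.eval_eq] at e1
  exact e1.symm

/-- When the scalar curvature is constant, `√(det G) ⟨Ric, ∇²u⟩` is the coordinate divergence of
`√(det G) Ric(∇u)`, as the divergence of `Ric` vanishes by the contracted Bianchi identity. -/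
theorem ric_inner_hess_eq_divergence {G : EuclideanSpace ℝ (Fin n) → Matrix (Fin n) (Fin n) ℝ}
    {y : EuclideanSpace ℝ (Fin n)}
    (hG : IsMetricAt G y) (hpos : 0 < (G y).det) {c : ℝ}
    (hR : ∀ᶠ z in 𝓝 y, scalarCoord G z = c) {u : EuclideanSpace ℝ (Fin n) → ℝ}
    (hu : ContDiffAt ℝ ∞ u y) :
    √(G y).det * trace ((G y)⁻¹ * ricciCoord G y * (G y)⁻¹ * hessianCoord G u y)
      = ∑ k, partialDeriv k (ricGradDensity G u k) y ∧
    ∀ k, ContDiffAt ℝ ∞ (ricGradDensity G u k) y := by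
  obtain ⟨g, gi, Γ, hg⟩ := hG.exists_germs stdDir
  obtain ⟨w, hwr, hw, hdw⟩ := hg.exists_density hpos
  have hur := rep_mk u hu
  have hX : ∀ k, Rep (w * ((gi * (ric (fun i => dir (stdDir i)) Γ)ᵀ) *ᵥ
      IsLeviCivita.grad (fun i => dir (stdDir i)) gi (SmoothGerm.mk u hu)) k)
      (ricGradDensity G u k) := fun k => hwr.mul
        ((hg.inverse.mul hg.rep_ric.transpose).mulVec (f := gradCoord G u)
          (fun j => hg.rep_grad hur j) k)
  refine ⟨?_, fun k => (hX k).contDiffAt⟩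
  have hRz : ∀ j, dir (stdDir j) (trace (gi * ric (fun i => dir (stdDir i)) Γ)) = 0 := by
    intro j
    have h2 := hg.rep_scal.congr (g := fun _ => c) hR
    refine Rep.eq (h2.dir _) (rep_zero.congr (Eventually.of_forall fun z => ?_))
    simp
  have h1 := hg.leviCivita.density_mul_ric_inner_hess eq_zero_of_two_mul
    (fun i j a => dir_comm _ _ _) hdw hRz (SmoothGerm.mk u hu)
  have hl := hwr.mul
    (((hg.inverse.mul hg.rep_ric.transpose).mul hg.inverse).mul (hg.rep_hess hur)).trace
  have hr := Rep.sum (s := Finset.univ) fun k => (hX k).dir (stdDir k)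
  have e1 := hl.eval_eq
  rw [h1, hr.eval_eq] at e1
  rw [← ricciCoord_eq_ricDir, hG.ricciCoord_symm hpos] at e1
  exact e1.symm

end

section

open Filter Topology Matrix SmoothGerm

variable {n : ℕ}

/-! ### The linearization of the scalar curvature in coordinates -/

/-- The coordinate directions of `ℝⁿ` in `ℝ × ℝⁿ`. -/
def famDir (i : Fin n) : ℝ × EuclideanSpace ℝ (Fin n) := (0, stdDir i)

/-- The affine family `G + t H`, as a function of `(t, z)`. -/
def fam (G H : EuclideanSpace ℝ (Fin n) → Matrix (Fin n) (Fin n) ℝ)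
    (q : ℝ × EuclideanSpace ℝ (Fin n)) : Matrix (Fin n) (Fin n) ℝ :=
  G q.2 + q.1 • H q.2

lemma fderiv_slice {F : ℝ × EuclideanSpace ℝ (Fin n) → ℝ} {q : ℝ × EuclideanSpace ℝ (Fin n)}
    (h : DifferentiableAt ℝ F q) (v : EuclideanSpace ℝ (Fin n)) :
    fderiv ℝ F q (0, v) = fderiv ℝ (fun z => F (q.1, z)) q.2 v := by
  have h1 : HasFDerivAt (fun z : EuclideanSpace ℝ (Fin n) => (q.1, z))
      (ContinuousLinearMap.inr ℝ ℝ (EuclideanSpace ℝ (Fin n))) q.2 :=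
    hasFDerivAt_prodMk_right q.1 q.2
  have h2 := (HasFDerivAt.comp (g := F) q.2 h.hasFDerivAt h1).fderiv
  have e : (fun z => F (q.1, z)) = F ∘ fun z : EuclideanSpace ℝ (Fin n) => (q.1, z) := rfl
  rw [e, h2]
  rfl

lemma hasDerivAt_slice {F : ℝ × EuclideanSpace ℝ (Fin n) → ℝ} {q : ℝ × EuclideanSpace ℝ (Fin n)}
    (h : DifferentiableAt ℝ F q) :
    HasDerivAt (fun t => F (t, q.2)) (fderiv ℝ F q (1, 0)) q.1 := by
  have h1 : HasDerivAt (fun t : ℝ => (t, q.2)) ((1 : ℝ), (0 : EuclideanSpace ℝ (Fin n))) q.1 :=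
    (hasDerivAt_id q.1).prodMk (hasDerivAt_const q.1 q.2)
  exact HasFDerivAt.comp_hasDerivAt q.1 h.hasFDerivAt h1

variable {G H : EuclideanSpace ℝ (Fin n) → Matrix (Fin n) (Fin n) ℝ} {y : EuclideanSpace ℝ (Fin n)}

lemma isMetricAt_fam (hG : IsMetricAt G y) (hH : ∀ i j, ContDiffAt ℝ ∞ (fun z => H z i j) y)
    (hHs : ∀ᶠ z in 𝓝 y, (H z)ᵀ = H z) : IsMetricAt (fam G H) ((0 : ℝ), y) := by
  refine ⟨fun i j => ?_, ?_, ?_⟩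
  · have h1 : ContDiffAt ℝ ∞ (fun q : ℝ × EuclideanSpace ℝ (Fin n) => G q.2 i j) (0, y) :=
      ContDiffAt.comp (g := fun z => G z i j) (0, y) (hG.smooth i j) contDiffAt_snd
    have h2 : ContDiffAt ℝ ∞ (fun q : ℝ × EuclideanSpace ℝ (Fin n) => H q.2 i j) (0, y) :=
      ContDiffAt.comp (g := fun z => H z i j) (0, y) (hH i j) contDiffAt_snd
    exact h1.add (contDiffAt_fst.mul h2)
  · have hs : Tendsto (Prod.snd : ℝ × EuclideanSpace ℝ (Fin n) → EuclideanSpace ℝ (Fin n))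
      (𝓝 (0, y)) (𝓝 y) := continuous_snd.tendsto _
    filter_upwards [hs.eventually hG.symm, hs.eventually hHs] with q h1 h2
    simp only [fam, Matrix.transpose_add, Matrix.transpose_smul, h1, h2]
  · simpa [fam] using hG.det_ne_zero

lemma eventually_snd {P : EuclideanSpace ℝ (Fin n) → Prop} (h : ∀ᶠ z in 𝓝 y, P z) :
    ∀ᶠ q : ℝ × EuclideanSpace ℝ (Fin n) in 𝓝 ((0 : ℝ), y), P q.2 :=
  (continuous_snd.tendsto ((0 : ℝ), y)).eventually h

lemma eventually_slice {P : ℝ × EuclideanSpace ℝ (Fin n) → Prop} {q : ℝ × EuclideanSpace ℝ (Fin n)}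
    (h : ∀ᶠ q' in 𝓝 q, P q') :
    ∀ᶠ z in 𝓝 q.2, P (q.1, z) := by
  have : Tendsto (fun z : EuclideanSpace ℝ (Fin n) => (q.1, z)) (𝓝 q.2) (𝓝 q) :=
    (Continuous.prodMk_right q.1).tendsto q.2
  exact this.eventually h

/-- The Christoffel symbols of the family are those of its members. -/
lemma chrDir_fam (hG : ∀ i j, ContDiffAt ℝ ∞ (fun z => G z i j) y)
    (hH : ∀ i j, ContDiffAt ℝ ∞ (fun z => H z i j) y) :
    ∀ᶠ q in 𝓝 ((0 : ℝ), y), ∀ k i j, chrDir famDir (fam G H) k i j q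
      = christoffel (fun z => G z + q.1 • H z) k i j q.2 := by
  have hd : ∀ᶠ z in 𝓝 y, ∀ i j, DifferentiableAt ℝ (fun z => G z i j) z ∧
      DifferentiableAt ℝ (fun z => H z i j) z :=
    eventually_all.mpr fun i => eventually_all.mpr fun j =>
      (eventually_differentiableAt (hG i j)).and (eventually_differentiableAt (hH i j))
  filter_upwards [eventually_snd hd] with q hq k i j
  have e : ∀ i j l, fderiv ℝ (fun q => fam G H q i j) q (famDir l)
      = partialDeriv l (fun z => (G z + q.1 • H z) i j) q.2 := by
    intro i j l
    have h1 : DifferentiableAt ℝ (fun q : ℝ × EuclideanSpace ℝ (Fin n) => G q.2 i j) q :=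
      DifferentiableAt.comp (g := fun z => G z i j) q (hq i j).1 differentiableAt_snd
    have h2 : DifferentiableAt ℝ (fun q : ℝ × EuclideanSpace ℝ (Fin n) => H q.2 i j) q :=
      DifferentiableAt.comp (g := fun z => H z i j) q (hq i j).2 differentiableAt_snd
    exact fderiv_slice (F := fun q => fam G H q i j) (h1.add (differentiableAt_fst.mul h2)) _
  simp only [chrDir, christoffel, e]
  rfl

/-- The Ricci matrix of the family is that of its members. -/
lemma ricDir_fam (hG : IsMetricAt G y) (hH : ∀ i j, ContDiffAt ℝ ∞ (fun z => H z i j) y)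
    (hHs : ∀ᶠ z in 𝓝 y, (H z)ᵀ = H z) :
    ∀ᶠ q in 𝓝 ((0 : ℝ), y), ricDir famDir (fam G H) q
      = ricciCoord (fun z => G z + q.1 • H z) q.2 := by
  obtain ⟨g, gi, Γ, hg⟩ := (isMetricAt_fam hG hH hHs).exists_germs famDir
  have hd : ∀ᶠ q in 𝓝 ((0 : ℝ), y), ∀ k i j,
      DifferentiableAt ℝ (chrDir famDir (fam G H) k i j) q :=
    eventually_all.mpr fun k => eventually_all.mpr fun i => eventually_all.mpr fun j =>
      eventually_differentiableAt (hg.connection i k j).contDiffAt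
  have hc := chrDir_fam hG.smooth hH
  filter_upwards [hd, hc, hc.eventually_nhds] with q h1 h2 h3
  have e : ∀ k i j l, fderiv ℝ (chrDir famDir (fam G H) k i j) q (famDir l)
      = partialDeriv l (christoffel (fun z => G z + q.1 • H z) k i j) q.2 := by
    intro k i j l
    rw [famDir, fderiv_slice (h1 k i j)]
    have : (fun z => chrDir famDir (fam G H) k i j (q.1, z))
        =ᶠ[𝓝 q.2] christoffel (fun z => G z + q.1 • H z) k i j := by
      filter_upwards [eventually_slice h3] with z hz using hz k i j
    rw [this.fderiv_eq]
    rfl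
  simp only [ricDir, ricciCoord, e, h2]

lemma tendsto_mk_zero (y : EuclideanSpace ℝ (Fin n)) : Tendsto (fun t : ℝ => (t, y)) (𝓝 0)
    (𝓝 ((0 : ℝ), y)) :=
  (Continuous.prodMk_left y).tendsto 0

/-- The scalar curvature of `G + t H` at a fixed point is the restriction to a line of a function on
`ℝ × ℝⁿ`, so that its derivative in `t` is computed by a derivation of germs. -/
lemma scalarCoord_fam (hG : IsMetricAt G y) (hH : ∀ i j, ContDiffAt ℝ ∞ (fun z => H z i j) y)
    (hHs : ∀ᶠ z in 𝓝 y, (H z)ᵀ = H z) :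
    (fun t : ℝ => scalarCoord (fun z => G z + t • H z) y)
      =ᶠ[𝓝 0] fun t => trace ((fam G H (t, y))⁻¹ * ricDir famDir (fam G H) (t, y)) := by
  filter_upwards [(tendsto_mk_zero y).eventually (ricDir_fam hG hH hHs)] with t ht
  rw [ht]
  rfl

/-- At a point where `Ric = c G`, the linearization of `|Ric|²` is `2 c` times that of the scalar
curvature. -/
theorem hasDerivAt_normSq_ricci (hG : IsMetricAt G y)
    (hH : ∀ i j, ContDiffAt ℝ ∞ (fun z => H z i j) y) (hHs : ∀ᶠ z in 𝓝 y, (H z)ᵀ = H z)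
    {c : ℝ} (hc : ricciCoord G y = c • G y) :
    HasDerivAt (fun t : ℝ => scalarCoord (fun z => G z + t • H z) y)
      (deriv (fun t : ℝ => scalarCoord (fun z => G z + t • H z) y) 0) 0 ∧
    HasDerivAt (fun t : ℝ => trace ((G y + t • H y)⁻¹ * ricciCoord (fun z => G z + t • H z) y *
      (G y + t • H y)⁻¹ * ricciCoord (fun z => G z + t • H z) y))
      (2 * c * deriv (fun t : ℝ => scalarCoord (fun z => G z + t • H z) y) 0) 0 := by
  obtain ⟨g, gi, Γ, hg⟩ := (isMetricAt_fam hG hH hHs).exists_germs famDir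
  have hs := hasDerivAt_slice (SmoothGerm.eventually_differentiableAt
    hg.rep_scal.contDiffAt).self_of_nhds
  have hs' := hs.congr_of_eventuallyEq (scalarCoord_fam hG hH hHs)
  rw [hs'.deriv]
  refine ⟨hs', ?_⟩
  have hq := ((hg.inverse.mul hg.rep_ric).mul hg.inverse).mul hg.rep_ric
  have hn := hasDerivAt_slice (SmoothGerm.eventually_differentiableAt
    hq.trace.contDiffAt).self_of_nhds
  have hev : (fun t : ℝ => trace ((G y + t • H y)⁻¹ * ricciCoord (fun z => G z + t • H z) y *
      (G y + t • H y)⁻¹ * ricciCoord (fun z => G z + t • H z) y)) =ᶠ[𝓝 0]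
      fun t => trace ((fam G H (t, y))⁻¹ * ricDir famDir (fam G H) (t, y) *
        (fam G H (t, y))⁻¹ * ricDir famDir (fam G H) (t, y)) := by
    filter_upwards [(tendsto_mk_zero y).eventually (ricDir_fam hG hH hHs)] with t ht
    rw [ht]
    rfl
  refine HasDerivAt.congr_deriv (hn.congr_of_eventuallyEq hev) ?_
  set δ := dir (p := ((0 : ℝ), y)) ((1 : ℝ), (0 : EuclideanSpace ℝ (Fin n))) with hδ
  set S := ric (fun i => dir (famDir i)) Γ with hS
  -- the identity in the ring of germs, evaluated at the point
  have e1 := (hg.rep_scal.dir ((1 : ℝ), (0 : EuclideanSpace ℝ (Fin n)))).eval_eq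
  have e2 := (hq.trace.dir ((1 : ℝ), (0 : EuclideanSpace ℝ (Fin n)))).eval_eq
  have htr : ∀ M : Matrix (Fin n) (Fin n) (SmoothGerm ((0 : ℝ), y)),
      δ M.trace = (M.map δ).trace := fun M => by simp [Matrix.trace]
  rw [← hδ, htr, matrix_map_derivation_mul] at e1
  rw [← hδ, htr, matrix_map_derivation_mul, matrix_map_derivation_mul,
    matrix_map_derivation_mul] at e2
  have hm : ∀ M N : Matrix (Fin n) (Fin n) (SmoothGerm ((0 : ℝ), y)),
      (M * N).map (eval ((0 : ℝ), y)) = M.map (eval _) * N.map (eval _) := fun M N =>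
    Matrix.map_mul
  have ha : ∀ M N : Matrix (Fin n) (Fin n) (SmoothGerm ((0 : ℝ), y)),
      (M + N).map (eval ((0 : ℝ), y)) = M.map (eval _) + N.map (eval _) := fun M N => by
    ext i j; simp
  have het : ∀ M : Matrix (Fin n) (Fin n) (SmoothGerm ((0 : ℝ), y)),
      eval ((0 : ℝ), y) M.trace = (M.map (eval _)).trace := fun M => by simp [Matrix.trace]
  rw [het] at e1 e2
  simp only [hm, ha] at e1 e2
  have hSv : S.map (eval ((0 : ℝ), y)) = c • g.map (eval _) := by
    rw [hg.rep_ric.map_eval, hg.metric.map_eval, (ricDir_fam hG hH hHs).self_of_nhds]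
    simpa [fam] using hc
  have hgv : gi.map (eval ((0 : ℝ), y)) * g.map (eval _) = 1 := by
    rw [← hm, hg.leviCivita.inv_mul]
    exact Matrix.map_one _ (map_zero _) (map_one _)
  rw [← e1, ← e2, hSv]
  set g₀ := g.map (eval ((0 : ℝ), y))
  set p₀ := gi.map (eval ((0 : ℝ), y))
  have hgv' : g₀ * p₀ = 1 := mul_eq_one_comm.mp hgv
  have hA : ∀ X : Matrix (Fin n) (Fin n) ℝ, X * g₀ * p₀ = X := fun X => by
    rw [mul_assoc, hgv', mul_one]
  have hB : ∀ X : Matrix (Fin n) (Fin n) ℝ, X * p₀ * g₀ = X := fun X => by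
    rw [mul_assoc, hgv, mul_one]
  simp only [Matrix.mul_smul, Matrix.smul_mul, add_mul, hgv, hA, hB, one_mul,
    Matrix.trace_add, Matrix.trace_smul, smul_eq_mul]
  ring

end

section

open Filter Topology Matrix SmoothGerm

variable {n : ℕ} {G H : EuclideanSpace ℝ (Fin n) → Matrix (Fin n) (Fin n) ℝ}
  {y : EuclideanSpace ℝ (Fin n)}

/-- The vector `Gⁱʲ Γ̇ᵏᵢⱼ - Gᵏʲ Γ̇ˡₗⱼ`, where `Γ̇` is the derivative of the Christoffel symbols of
`G + t H` at `t = 0`. -/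
def variationVecCoord (G H : EuclideanSpace ℝ (Fin n) → Matrix (Fin n) (Fin n) ℝ) (k : Fin n)
    (z : EuclideanSpace ℝ (Fin n)) : ℝ :=
  IsLeviCivita.variationVec (G z)⁻¹
    (fun i => Matrix.of fun k j => fderiv ℝ (chrDir famDir (fam G H) k i j) (0, z) (1, 0)) k

/-- The vector density whose divergence is the integrand of the adjointness relation between the
linearized scalar curvature and `u ↦ ∇²u - (Δu) G - u Ric`. -/
def variationDensity (G H : EuclideanSpace ℝ (Fin n) → Matrix (Fin n) (Fin n) ℝ)
    (u : EuclideanSpace ℝ (Fin n) → ℝ) (k : Fin n) (z : EuclideanSpace ℝ (Fin n)) : ℝ :=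
  √(G z).det * (u z * variationVecCoord G H k z - (((G z)⁻¹ * H z) *ᵥ gradCoord G u z) k
    + trace ((G z)⁻¹ * H z) * gradCoord G u z k)

/-- `u ↦ ∇²u - (Δu) G - u Ric` is the formal adjoint of the linearized scalar curvature: the
difference of the two pairings, times `√(det G)`, is a coordinate divergence. -/
theorem variation_scalar_eq_divergence (hG : IsMetricAt G y) (hpos : 0 < (G y).det)
    (hH : ∀ i j, ContDiffAt ℝ ∞ (fun z => H z i j) y) (hHs : ∀ᶠ z in 𝓝 y, (H z)ᵀ = H z)
    {u : EuclideanSpace ℝ (Fin n) → ℝ} (hu : ContDiffAt ℝ ∞ u y) :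
    √(G y).det * (u y * deriv (fun t : ℝ => scalarCoord (fun z => G z + t • H z) y) 0
        - trace ((G y)⁻¹ * (hessianCoord G u y - trace ((G y)⁻¹ * hessianCoord G u y) • G y
          - u y • ricciCoord G y) * (G y)⁻¹ * H y))
      = ∑ k, partialDeriv k (variationDensity G H u k) y ∧
    ∀ k, ContDiffAt ℝ ∞ (variationDensity G H u k) y := by
  have hF := isMetricAt_fam hG hH hHs
  obtain ⟨g, gi, Γ, hg⟩ := hF.exists_germs famDir
  have hfam0 : ∀ z, fam G H ((0 : ℝ), z) = G z := fun z => by simp [fam]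
  have hpos' : 0 < (fam G H ((0 : ℝ), y)).det := by rwa [hfam0]
  obtain ⟨w, hwr, hw, hdw⟩ := hg.exists_density hpos'
  have hu' : ContDiffAt ℝ ∞ (fun q : ℝ × EuclideanSpace ℝ (Fin n) => u q.2) (0, y) :=
    ContDiffAt.comp (g := u) (0, y) hu contDiffAt_snd
  set a := SmoothGerm.mk _ hu'
  have har : SmoothGerm.Rep a fun q => u q.2 := rep_mk _ hu'
  set δ := dir (p := ((0 : ℝ), y)) ((1 : ℝ), (0 : EuclideanSpace ℝ (Fin n))) with hδ
  have hδg : RepMat (g.map δ) fun q => H q.2 := by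
    refine (hg.metric.map_dir _).congr ?_
    have hd : ∀ᶠ q in 𝓝 ((0 : ℝ), y), ∀ i j, DifferentiableAt ℝ (fun q => fam G H q i j) q :=
      eventually_all.mpr fun i => eventually_all.mpr fun j =>
        eventually_differentiableAt (hg.metric i j).contDiffAt
    filter_upwards [hd] with q hq
    ext i j
    have h1 := hasDerivAt_slice (hq i j)
    have h2 : HasDerivAt (fun t : ℝ => fam G H (t, q.2) i j) (H q.2 i j) q.1 := by
      have := ((hasDerivAt_id q.1).mul_const (H q.2 i j)).const_add (G q.2 i j)
      simpa [fam] using this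
    exact h1.unique h2
  have hD : ∀ i, RepMat ((Γ i).map δ) fun q => Matrix.of fun k j =>
      fderiv ℝ (chrDir famDir (fam G H) k i j) q (1, 0) := fun i k j =>
    (hg.connection i k j).dir _
  have hV : ∀ k, SmoothGerm.Rep (IsLeviCivita.variationVec gi (fun i => (Γ i).map δ) k) fun q =>
      IsLeviCivita.variationVec (fam G H q)⁻¹ (fun i => Matrix.of fun k j =>
        fderiv ℝ (chrDir famDir (fam G H) k i j) q (1, 0)) k := fun k =>
    (SmoothGerm.Rep.sum fun j => ((hD j).mul hg.inverse) k j).sub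
      (hg.inverse.mulVec (f := fun q j => (Matrix.of fun k l =>
        fderiv ℝ (chrDir famDir (fam G H) k j l) q (1, 0)).trace) (fun j => (hD j).trace) k)
  have hgr := fun k => hg.rep_grad har k
  -- the vector density on `ℝ × ℝⁿ`, which restricts to `variationDensity` on the slice `t = 0`
  obtain ⟨X, hX, hslice⟩ : ∃ X : Fin n → ℝ × EuclideanSpace ℝ (Fin n) → ℝ,
      (∀ k, SmoothGerm.Rep (w * (a * IsLeviCivita.variationVec gi (fun i => (Γ i).map δ) k
        - ((gi * g.map δ) *ᵥ IsLeviCivita.grad (fun i => dir (famDir i)) gi a) k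
        + trace (gi * g.map δ) * IsLeviCivita.grad (fun i => dir (famDir i)) gi a k)) (X k)) ∧
      ∀ k, ∀ᶠ z in 𝓝 y, X k (0, z) = variationDensity G H u k z := by
    refine ⟨_, fun k => hwr.mul (((har.mul (hV k)).sub ((hg.inverse.mul hδg).mulVec
      (f := fun q => (fam G H q)⁻¹ *ᵥ fun j => fderiv ℝ (fun q => u q.2) q (famDir j)) hgr k)).add
      ((hg.inverse.mul hδg).trace.mul (hgr k))), fun k => ?_⟩
    have hd := eventually_slice (q := ((0 : ℝ), y)) (eventually_differentiableAt hu')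
    filter_upwards [hd] with z hz
    have e : ∀ j, fderiv ℝ (fun q : ℝ × EuclideanSpace ℝ (Fin n) => u q.2) (0, z) (famDir j)
        = partialDeriv j u z := fun j => fderiv_slice hz _
    simp only [hfam0, e]
    rfl
  have hcont : ∀ k, ContDiffAt ℝ ∞ (variationDensity G H u k) y := by
    intro k
    have h1 := (hX k).contDiffAt
    have h2 : ContDiffAt ℝ ∞ (fun z : EuclideanSpace ℝ (Fin n) => ((0 : ℝ), z)) y :=
      contDiffAt_const.prodMk contDiffAt_id
    have h3 := ContDiffAt.comp (f := fun z : EuclideanSpace ℝ (Fin n) => ((0 : ℝ), z)) y h1 h2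
    refine h3.congr_of_eventuallyEq ?_
    filter_upwards [hslice k] with z hz
    exact hz.symm
  refine ⟨?_, hcont⟩
  have key := hg.leviCivita.density_mul_variation_scalar (fun i j a => dir_comm _ _ _) hdw
    (δ := δ) (fun i a => dir_comm _ _ _) a
  have hr := SmoothGerm.Rep.sum (s := Finset.univ) fun k => (hX k).dir (famDir k)
  have hk := congrArg (eval ((0 : ℝ), y)) key
  rw [hr.eval_eq] at hk
  have hright : ∀ k, fderiv ℝ (X k) ((0 : ℝ), y) (famDir k)
      = partialDeriv k (variationDensity G H u k) y := fun k => by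
    rw [famDir, fderiv_slice (eventually_differentiableAt (hX k).contDiffAt).self_of_nhds,
      Filter.EventuallyEq.fderiv_eq (hslice k)]
    rfl
  have hL := (hwr.mul ((har.mul (hg.rep_scal.dir ((1 : ℝ), (0 : EuclideanSpace ℝ (Fin n))))).sub
    (((hg.inverse.mul ((((hg.rep_hess har).sub (RepMat.smul
      (hg.inverse.mul (hg.rep_hess har)).trace hg.metric)).sub (hg.rep_ric.smul har)))).mul
      hg.inverse).mul hδg).trace)).eval_eq
  have hk2 := hL.symm.trans hk
  have hs := (hasDerivAt_slice (eventually_differentiableAt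
    hg.rep_scal.contDiffAt).self_of_nhds).congr_of_eventuallyEq (scalarCoord_fam hG hH hHs)
  have hric : ricDir famDir (fam G H) ((0 : ℝ), y) = ricciCoord G y := by
    rw [(ricDir_fam hG hH hHs).self_of_nhds]
    simp
  have hhess : hessDir famDir (fam G H) (fun q => u q.2) ((0 : ℝ), y) = hessianCoord G u y := by
    have e1 := (chrDir_fam hG.smooth hH).self_of_nhds
    have hd := eventually_differentiableAt hu'
    have e2 : ∀ j, fderiv ℝ (fun q : ℝ × EuclideanSpace ℝ (Fin n) => u q.2) (0, y) (famDir j)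
        = partialDeriv j u y := fun j => fderiv_slice hd.self_of_nhds _
    have e3 : ∀ i j, fderiv ℝ (fun q => fderiv ℝ (fun q : ℝ × EuclideanSpace ℝ (Fin n) => u q.2) q
        (famDir j)) (0, y) (famDir i) = partialDeriv i (partialDeriv j u) y := by
      intro i j
      refine (fderiv_slice (eventually_differentiableAt
        (contDiffAt_fderiv_apply hu' (famDir j))).self_of_nhds (stdDir i)).trans ?_
      have : (fun z => fderiv ℝ (fun q : ℝ × EuclideanSpace ℝ (Fin n) => u q.2) (0, z) (famDir j))
          =ᶠ[𝓝 y] partialDeriv j u := by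
        filter_upwards [eventually_slice (q := ((0 : ℝ), y)) hd] with z hz
        exact fderiv_slice hz _
      exact congrArg (fun L : EuclideanSpace ℝ (Fin n) →L[ℝ] ℝ => L (stdDir i))
        (Filter.EventuallyEq.fderiv_eq this)
    ext i j
    simp only [hessDir, hessianCoord, Matrix.of_apply, e1, e2, e3, zero_smul, add_zero]
  simp only [hfam0, hric, hhess] at hk2
  rw [hs.deriv, hk2]
  exact Finset.sum_congr rfl fun k _ => hright k

end

section

open Filter Topology Matrix
open scoped MatrixOrder Matrix.Norms.L2Operator

variable {n : ℕ}

/-! ### The `σ₂`-curvature in terms of the Ricci and scalar curvatures -/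

lemma two_mul_esymm_two (s : Multiset ℝ) :
    2 * s.esymm 2 = s.sum ^ 2 - (s.map fun x => x ^ 2).sum := by
  induction s using Multiset.induction_on with
  | empty => simp [Multiset.esymm, Multiset.powersetCard_zero_right]
  | cons a s ih =>
    have h1 : (a ::ₘ s).esymm 2 = s.esymm 2 + a * s.sum := by
      rw [Multiset.esymm, Multiset.esymm, Multiset.powersetCard_cons, Multiset.map_add,
        Multiset.sum_add, Multiset.powersetCard_one, Multiset.map_map, Multiset.map_map]
      simp only [Function.comp_def, Multiset.prod_cons, Multiset.prod_singleton]
      exact congrArg₂ (· + ·) rfl (by rw [Multiset.sum_map_mul_left, Multiset.map_id'])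
    rw [h1, mul_add, ih, Multiset.sum_cons, Multiset.map_cons, Multiset.sum_cons]
    ring

lemma two_mul_esymm_two_roots_charpoly_of_isHermitian {C : Matrix (Fin n) (Fin n) ℝ}
    (hC : C.IsHermitian) :
    2 * C.charpoly.roots.esymm 2 = C.trace ^ 2 - (C * C).trace := by
  have hsq : (C * C).trace = ∑ i, hC.eigenvalues i ^ 2 := by
    have h1 := hC.spectral_theorem
    set U := hC.eigenvectorUnitary
    set D : Matrix (Fin n) (Fin n) ℝ := diagonal (RCLike.ofReal ∘ hC.eigenvalues) with hD
    calc (C * C).trace = (Unitary.conjStarAlgAut ℝ _ U (D * D)).trace := by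
          rw [map_mul, ← h1]
      _ = (D * D).trace := by
          rw [Unitary.conjStarAlgAut_apply, Matrix.trace_mul_comm, ← mul_assoc]
          simp
      _ = _ := by
          rw [hD, Matrix.diagonal_mul_diagonal, Matrix.trace_diagonal]
          exact Finset.sum_congr rfl fun i _ => by simp [sq]
  rw [two_mul_esymm_two, hC.roots_charpoly_eq_eigenvalues, hsq, hC.trace_eq_sum_eigenvalues]
  simp only [Multiset.map_map]
  rfl

lemma exists_inv_eq_transpose_mul_self {G : Matrix (Fin n) (Fin n) ℝ} (hG : G.PosDef) :
    ∃ B : Matrix (Fin n) (Fin n) ℝ, IsUnit B.det ∧ G⁻¹ = Bᵀ * B := by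
  obtain ⟨B, hB⟩ := CStarAlgebra.nonneg_iff_eq_star_mul_self.mp
    (Matrix.nonneg_iff_posSemidef.mpr hG.inv.posSemidef)
  rw [Matrix.star_eq_conjTranspose, Matrix.conjTranspose_eq_transpose_of_trivial] at hB
  refine ⟨B, isUnit_iff_ne_zero.mpr fun h0 => hG.inv.det_pos.ne' ?_, hB⟩
  rw [hB, Matrix.det_mul, h0, mul_zero]

/-- The eigenvalues of a symmetric matrix with respect to a positive definite one are real, so
that their second elementary symmetric function is given by traces. -/
lemma two_mul_esymm_two_roots_charpoly {G A : Matrix (Fin n) (Fin n) ℝ} (hG : G.PosDef)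
    (hA : Aᵀ = A) : 2 * (G⁻¹ * A).charpoly.roots.esymm 2
      = (G⁻¹ * A).trace ^ 2 - (G⁻¹ * A * (G⁻¹ * A)).trace := by
  obtain ⟨B, -, hB⟩ := exists_inv_eq_transpose_mul_self hG
  have hC : (B * A * Bᵀ).IsHermitian := by
    rw [Matrix.IsHermitian, Matrix.conjTranspose_eq_transpose_of_trivial]
    simp [Matrix.transpose_mul, hA, mul_assoc]
  have h1 := two_mul_esymm_two_roots_charpoly_of_isHermitian hC
  rw [hB, mul_assoc Bᵀ, Matrix.charpoly_mul_comm, h1, Matrix.trace_mul_comm Bᵀ]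
  congr 1
  rw [mul_assoc Bᵀ, Matrix.trace_mul_comm Bᵀ]
  simp only [mul_assoc]

/-- The squared norm of the Ricci tensor in coordinates. -/
def normSqRicciCoord (G : EuclideanSpace ℝ (Fin n) → Matrix (Fin n) (Fin n) ℝ)
    (y : EuclideanSpace ℝ (Fin n)) : ℝ :=
  trace ((G y)⁻¹ * ricciCoord G y * (G y)⁻¹ * ricciCoord G y)

/-- `σ₂ = n / (8 (n - 1)) R² - |Ric|² / 2`. -/
theorem sigmaTwoCoord_eq (hn : 3 ≤ n)
    {G : EuclideanSpace ℝ (Fin n) → Matrix (Fin n) (Fin n) ℝ} {y : EuclideanSpace ℝ (Fin n)}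
    (hpos : (G y).PosDef) (hs : (ricciCoord G y)ᵀ = ricciCoord G y) :
    sigmaTwoCoord G y = n / (8 * ((n : ℝ) - 1)) * scalarCoord G y ^ 2
      - normSqRicciCoord G y / 2 := by
  have hGt : (G y)ᵀ = G y := by
    have := hpos.isHermitian
    rwa [Matrix.IsHermitian, Matrix.conjTranspose_eq_transpose_of_trivial] at this
  have hA : (schoutenCoord G y)ᵀ = schoutenCoord G y := by
    simp only [schoutenCoord, Matrix.transpose_sub, Matrix.transpose_smul, hs, hGt]
  have h1 := two_mul_esymm_two_roots_charpoly hpos hA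
  have hinv : (G y)⁻¹ * G y = 1 :=
    Matrix.nonsing_inv_mul _ (Matrix.isUnit_iff_isUnit_det _ |>.mp hpos.isUnit)
  set s := scalarCoord G y / (2 * ((n : ℝ) - 1)) with hsdef
  have hPA : (G y)⁻¹ * schoutenCoord G y = (G y)⁻¹ * ricciCoord G y - s • 1 := by
    rw [schoutenCoord, mul_sub, Matrix.mul_smul, hinv]
  rw [hPA] at h1
  have ht1 : ((G y)⁻¹ * ricciCoord G y - s • 1).trace = scalarCoord G y - n * s := by
    rw [Matrix.trace_sub, Matrix.trace_smul, Matrix.trace_one, Fintype.card_fin, smul_eq_mul,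
      mul_comm s]
    rfl
  have ht2 : (((G y)⁻¹ * ricciCoord G y - s • 1) * ((G y)⁻¹ * ricciCoord G y - s • 1)).trace
      = normSqRicciCoord G y - 2 * s * scalarCoord G y + n * s ^ 2 := by
    simp only [sub_mul, mul_sub, Matrix.trace_sub, Matrix.smul_mul, Matrix.mul_smul, one_mul,
      mul_one, Matrix.trace_smul, smul_eq_mul, Matrix.trace_one, Fintype.card_fin]
    rw [normSqRicciCoord, ← mul_assoc]
    change _ - s * scalarCoord G y - (s * scalarCoord G y - s * (s * n)) = _
    ring
  rw [ht1, ht2] at h1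
  have hn1 : (n : ℝ) - 1 ≠ 0 := by
    have : (3 : ℝ) ≤ n := by exact_mod_cast hn
    linarith
  have hR : scalarCoord G y = s * (2 * ((n : ℝ) - 1)) := by
    rw [hsdef]; field_simp
  rw [sigmaTwoCoord, hPA]
  rw [hR] at h1 ⊢
  have h8 : (n : ℝ) / (8 * ((n : ℝ) - 1)) * (s * (2 * ((n : ℝ) - 1))) ^ 2
      = n * ((n : ℝ) - 1) * s ^ 2 / 2 := by
    field_simp
    ring
  rw [h8]
  linear_combination h1 / 2

lemma matrix_inv_smul {c : ℝ} (hc : c ≠ 0) (N : Matrix (Fin n) (Fin n) ℝ) :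
    (c • N)⁻¹ = c⁻¹ • N⁻¹ := by
  by_cases hu : IsUnit N.det
  · exact Matrix.inv_smul' N (Units.mk0 c hc) hu
  · have hu' : ¬IsUnit (c • N).det := by
      simpa [Matrix.det_smul, hc] using hu
    rw [Matrix.nonsing_inv_apply_not_isUnit _ hu, Matrix.nonsing_inv_apply_not_isUnit _ hu',
      smul_zero]

/-- The Ricci matrix does not change when the metric is rescaled by a constant. -/
lemma ricciCoord_smul {c : ℝ} (hc : c ≠ 0)
    (G : EuclideanSpace ℝ (Fin n) → Matrix (Fin n) (Fin n) ℝ) :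
    ricciCoord (fun z => c • G z) = ricciCoord G := by
  have h1 : ∀ k i j, christoffel (fun z => c • G z) k i j = christoffel G k i j := by
    intro k i j
    funext z
    have hp : ∀ i j l, partialDeriv l (fun z => (c • G z) i j) z
        = c * partialDeriv l (fun z => G z i j) z := by
      intro i j l
      have : (fun z => (c • G z) i j) = c • fun z => G z i j := rfl
      simp only [partialDeriv, this]
      rw [fderiv_const_smul_field]
      rfl
    simp only [christoffel, hp]
    simp only [matrix_inv_smul hc, Matrix.smul_apply, smul_eq_mul]
    congr 1
    refine Finset.sum_congr rfl fun l _ => ?_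
    field_simp
  funext y
  simp only [ricciCoord, h1]

lemma sigmaTwoCoord_smul (hn : 3 ≤ n) {c : ℝ} (hc : 0 < c)
    {G : EuclideanSpace ℝ (Fin n) → Matrix (Fin n) (Fin n) ℝ} {y : EuclideanSpace ℝ (Fin n)}
    (hpos : (G y).PosDef) (hs : (ricciCoord G y)ᵀ = ricciCoord G y) :
    sigmaTwoCoord (fun z => c • G z) y = c⁻¹ ^ 2 * sigmaTwoCoord G y := by
  have hR : scalarCoord (fun z => c • G z) y = c⁻¹ * scalarCoord G y := by
    simp only [scalarCoord, ricciCoord_smul hc.ne', matrix_inv_smul hc.ne', Matrix.smul_mul,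
      Matrix.trace_smul, smul_eq_mul]
  have hN : normSqRicciCoord (fun z => c • G z) y = c⁻¹ ^ 2 * normSqRicciCoord G y := by
    simp only [normSqRicciCoord, ricciCoord_smul hc.ne', matrix_inv_smul hc.ne', Matrix.smul_mul,
      Matrix.mul_smul, Matrix.trace_smul, smul_eq_mul]
    ring
  have hs' : (ricciCoord (fun z => c • G z) y)ᵀ = ricciCoord (fun z => c • G z) y := by
    rw [ricciCoord_smul hc.ne', hs]
  rw [sigmaTwoCoord_eq hn hpos hs, sigmaTwoCoord_eq hn (hpos.smul hc) hs', hR, hN]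
  ring

/-- The linearization of `σ₂` in the direction of the metric itself, from `σ₂(c g) = c⁻² σ₂(g)`. -/
lemma hasDerivAt_sigmaTwoCoord_self (hn : 3 ≤ n)
    {G : EuclideanSpace ℝ (Fin n) → Matrix (Fin n) (Fin n) ℝ} {y : EuclideanSpace ℝ (Fin n)}
    (hpos : (G y).PosDef) (hs : (ricciCoord G y)ᵀ = ricciCoord G y) :
    HasDerivAt (fun t : ℝ => sigmaTwoCoord (fun z => G z + t • G z) y)
      (-2 * sigmaTwoCoord G y) 0 := by
  have h1 : HasDerivAt (fun t : ℝ => (1 + t)⁻¹ ^ 2 * sigmaTwoCoord G y)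
      (-2 * sigmaTwoCoord G y) 0 := by
    have h2 : HasDerivAt (fun t : ℝ => 1 + t) 1 0 := (hasDerivAt_id 0).const_add 1
    have h3 := ((h2.inv (by norm_num)).pow 2).mul_const (sigmaTwoCoord G y)
    refine h3.congr_deriv ?_
    norm_num
  refine h1.congr_of_eventuallyEq ?_
  have h0 : ∀ᶠ t : ℝ in 𝓝 0, -1 < t := lt_mem_nhds (by norm_num)
  filter_upwards [h0] with t ht
  rw [← sigmaTwoCoord_smul hn (by linarith) hpos hs]
  congr 1
  funext z
  rw [add_smul, one_smul]

/-- Positive definiteness is stable under small symmetric perturbations `t B`: compare `t B` with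
`-‖t B‖` and `A` with its smallest eigenvalue, in the Loewner order. -/
lemma eventually_posDef_add_smul {A B : Matrix (Fin n) (Fin n) ℝ} (hA : A.PosDef) (hB : Bᵀ = B) :
    ∀ᶠ t : ℝ in 𝓝 0, (A + t • B).PosDef := by
  rcases isEmpty_or_nonempty (Fin n) with hn | hn
  · exact Eventually.of_forall fun t => by rwa [Subsingleton.elim (A + t • B) A]
  obtain ⟨r, hr, hrA⟩ := (CFC.exists_pos_algebraMap_le_iff (a := A) hA.isHermitian).2
    fun x hx => hA.isStrictlyPositive.spectrum_pos hx
  have hev : ∀ᶠ t : ℝ in 𝓝 0, ‖t • B‖ < r := by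
    have hc : Continuous fun t : ℝ => ‖t • B‖ := by fun_prop
    exact hc.continuousAt.eventually_lt continuousAt_const (by simpa using hr)
  filter_upwards [hev] with t ht
  have hsa : IsSelfAdjoint (t • B) := by
    rw [IsSelfAdjoint, Matrix.star_eq_conjTranspose, Matrix.conjTranspose_eq_transpose_of_trivial,
      Matrix.transpose_smul, hB]
  have h1 := Matrix.le_iff.mp hrA
  have h2 : (t • B - algebraMap ℝ _ (-‖t • B‖)).PosSemidef :=
    Matrix.le_iff.mp (algebraMap_le_of_le_spectrum fun x hx =>
      neg_le_of_abs_le (spectrum.norm_le_norm_of_mem hx))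
  have h3 : ((r - ‖t • B‖) • (1 : Matrix (Fin n) (Fin n) ℝ)).PosDef :=
    Matrix.PosDef.one.smul (sub_pos.mpr ht)
  have h4 := (h3.add_posSemidef h1).add_posSemidef h2
  convert h4 using 1
  simp only [Algebra.algebraMap_eq_smul_one, sub_smul, neg_smul]
  abel

lemma IsMetricAt.add_smul {G H : EuclideanSpace ℝ (Fin n) → Matrix (Fin n) (Fin n) ℝ}
    {y : EuclideanSpace ℝ (Fin n)} (hG : IsMetricAt G y)
    (hH : ∀ i j, ContDiffAt ℝ ∞ (fun z => H z i j) y) (hHs : ∀ᶠ z in 𝓝 y, (H z)ᵀ = H z) {t : ℝ}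
    (ht : (G y + t • H y).det ≠ 0) : IsMetricAt (fun z => G z + t • H z) y := by
  refine ⟨fun i j => (hG.smooth i j).add (contDiffAt_const.mul (hH i j)), ?_, ht⟩
  filter_upwards [hG.symm, hHs] with z h1 h2
  rw [Matrix.transpose_add, Matrix.transpose_smul, h1, h2]

/-- At an Einstein point the linearization of `σ₂` is a multiple of that of the scalar
curvature. -/
lemma deriv_sigmaTwoCoord_of_einstein (hn : 3 ≤ n)
    {G H : EuclideanSpace ℝ (Fin n) → Matrix (Fin n) (Fin n) ℝ} {y : EuclideanSpace ℝ (Fin n)}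
    (hG : IsMetricAt G y) (hpos : (G y).PosDef)
    (hH : ∀ i j, ContDiffAt ℝ ∞ (fun z => H z i j) y) (hHs : ∀ᶠ z in 𝓝 y, (H z)ᵀ = H z)
    {c : ℝ} (hc : ricciCoord G y = c • G y) :
    deriv (fun t : ℝ => sigmaTwoCoord (fun z => G z + t • H z) y) 0
      = (n / (4 * ((n : ℝ) - 1)) * (n * c) - c)
        * deriv (fun t : ℝ => scalarCoord (fun z => G z + t • H z) y) 0 := by
  obtain ⟨hR, hN⟩ := hasDerivAt_normSq_ricci hG hH hHs hc
  set R' := deriv (fun t : ℝ => scalarCoord (fun z => G z + t • H z) y) 0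
  have hR0 : scalarCoord (fun z => G z + (0 : ℝ) • H z) y = n * c := by
    have hinv : (G y)⁻¹ * G y = 1 :=
      Matrix.nonsing_inv_mul _ (Matrix.isUnit_iff_isUnit_det _ |>.mp hpos.isUnit)
    simp only [zero_smul, add_zero, scalarCoord, hc, Matrix.mul_smul, hinv, Matrix.trace_smul,
      Matrix.trace_one, Fintype.card_fin, smul_eq_mul]
    ring
  have h1 := ((hR.pow 2).const_mul (n / (8 * ((n : ℝ) - 1)))).sub (hN.div_const 2)
  have h2 : (fun t : ℝ => sigmaTwoCoord (fun z => G z + t • H z) y) =ᶠ[𝓝 0]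
      fun t : ℝ => n / (8 * ((n : ℝ) - 1)) * scalarCoord (fun z => G z + t • H z) y ^ 2
        - trace ((G y + t • H y)⁻¹ * ricciCoord (fun z => G z + t • H z) y *
          (G y + t • H y)⁻¹ * ricciCoord (fun z => G z + t • H z) y) / 2 := by
    filter_upwards [eventually_posDef_add_smul hpos hHs.self_of_nhds] with t ht
    exact sigmaTwoCoord_eq hn ht
      ((hG.add_smul hH hHs ht.det_pos.ne').ricciCoord_symm ht.det_pos)
  rw [(h1.congr_of_eventuallyEq h2).deriv, hR0]
  have hn1 : (n : ℝ) - 1 ≠ 0 := by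
    have : (3 : ℝ) ≤ n := by exact_mod_cast hn
    linarith
  field_simp
  ring

end

section

open Filter Topology Matrix

variable {n : ℕ} {M : Type*} [TopologicalSpace M] [ChartedSpace (EuclideanSpace ℝ (Fin n)) M]

/-! ### Tensor fields in the charts of a manifold -/

lemma mfderiv_extChartAt_symm_eq (x : M) {y : EuclideanSpace ℝ (Fin n)} :
    mfderiv 𝓘(ℝ, EuclideanSpace ℝ (Fin n)) (𝓡 n) (extChartAt (𝓡 n) x).symm y
      = mfderivWithin 𝓘(ℝ, EuclideanSpace ℝ (Fin n)) (𝓡 n) (extChartAt (𝓡 n) x).symm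
        (Set.range (𝓡 n)) y := by
  rw [ModelWithCorners.range_eq_univ, mfderivWithin_univ]

lemma mem_target_self (x : M) : extChartAt (𝓡 n) x x ∈ (extChartAt (𝓡 n) x).target :=
  mem_extChartAt_target x

lemma target_mem_nhds {x : M} {y : EuclideanSpace ℝ (Fin n)}
    (hy : y ∈ (extChartAt (𝓡 n) x).target) : (extChartAt (𝓡 n) x).target ∈ 𝓝 y :=
  (isOpen_extChartAt_target x).mem_nhds hy

/-- The transition map from the chart at `x` to the chart at `x₀`. -/
def transition (x x₀ : M) : EuclideanSpace ℝ (Fin n) → EuclideanSpace ℝ (Fin n) :=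
  extChartAt (𝓡 n) x₀ ∘ (extChartAt (𝓡 n) x).symm

/-- The derivative of the inverse of the chart at `x`, on the model space. -/
def chartFrame (x : M) (y : EuclideanSpace ℝ (Fin n)) :
    EuclideanSpace ℝ (Fin n) →L[ℝ] EuclideanSpace ℝ (Fin n) :=
  mfderiv 𝓘(ℝ, EuclideanSpace ℝ (Fin n)) (𝓡 n) (extChartAt (𝓡 n) x).symm y

/-- The value of a tensor field at a point, as a bilinear form on the model space. -/
def toBilin (h : TwoTensorField n M) (p : M) :
    EuclideanSpace ℝ (Fin n) →L[ℝ] EuclideanSpace ℝ (Fin n) →L[ℝ] ℝ := h p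

lemma coordMatrix_apply (h : TwoTensorField n M) (x : M) (y : EuclideanSpace ℝ (Fin n))
    (i j : Fin n) : coordMatrix h x y i j = toBilin h ((extChartAt (𝓡 n) x).symm y)
      (chartFrame x y (stdDir i)) (chartFrame x y (stdDir j)) := rfl

lemma map_sum_stdDir (D : EuclideanSpace ℝ (Fin n) →L[ℝ] EuclideanSpace ℝ (Fin n))
    (w : EuclideanSpace ℝ (Fin n)) : D w = ∑ i, w i • D (stdDir i) := by
  conv_lhs => rw [eq_sum_stdDir w]
  simp only [map_sum, map_smul]

lemma bilin_sum_sum (b : EuclideanSpace ℝ (Fin n) →L[ℝ] EuclideanSpace ℝ (Fin n) →L[ℝ] ℝ)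
    (v : Fin n → EuclideanSpace ℝ (Fin n)) (c d : Fin n → ℝ) :
    b (∑ i, c i • v i) (∑ j, d j • v j) = ∑ i, ∑ j, b (v i) (v j) * c i * d j := by
  simp only [map_sum, map_smul, _root_.sum_apply, _root_.smul_apply, smul_eq_mul, Finset.mul_sum]
  rw [Finset.sum_comm]
  exact Finset.sum_congr rfl fun i _ => Finset.sum_congr rfl fun j _ => by ring

lemma coordMatrix_add_smul (g h : TwoTensorField n M) (t : ℝ) (x : M) :
    coordMatrix (g + t • h) x = fun z => coordMatrix g x z + t • coordMatrix h x z := by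
  funext z
  ext i j
  rfl

lemma coordMatrix_zero (x : M) : coordMatrix (0 : TwoTensorField n M) x = 0 := by
  funext z
  ext i j
  rfl

lemma transition_transition {x x₀ : M} {y : EuclideanSpace ℝ (Fin n)}
    (hy : y ∈ (extChartAt (𝓡 n) x).target)
    (hy' : (extChartAt (𝓡 n) x).symm y ∈ (extChartAt (𝓡 n) x₀).source) :
    transition x₀ x (transition x x₀ y) = y := by
  simp only [transition, Function.comp_apply]
  rw [(extChartAt (𝓡 n) x₀).left_inv hy', (extChartAt (𝓡 n) x).right_inv hy]

lemma symm_transition {x x₀ : M} {y : EuclideanSpace ℝ (Fin n)}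
    (hy' : (extChartAt (𝓡 n) x).symm y ∈ (extChartAt (𝓡 n) x₀).source) :
    (extChartAt (𝓡 n) x₀).symm (transition x x₀ y) = (extChartAt (𝓡 n) x).symm y :=
  (extChartAt (𝓡 n) x₀).left_inv hy'

lemma jac_mul_jac {φ ψ : EuclideanSpace ℝ (Fin n) → EuclideanSpace ℝ (Fin n)}
    {y : EuclideanSpace ℝ (Fin n)} (hφ : DifferentiableAt ℝ φ y)
    (hψ : DifferentiableAt ℝ ψ (φ y)) : jac (ψ ∘ φ) y = jac ψ (φ y) * jac φ y := by
  ext a i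
  have h1 := fderiv_apply_coord (hψ.comp y hφ) (stdDir i) a
  rw [fderiv_comp y hψ hφ, ContinuousLinearMap.comp_apply,
    eq_sum_stdDir (fderiv ℝ φ y (stdDir i)), map_sum] at h1
  rw [Matrix.mul_apply]
  refine h1.symm.trans ?_
  rw [WithLp.ofLp_sum, Finset.sum_apply]
  refine Finset.sum_congr rfl fun b _ => ?_
  rw [map_smul, PiLp.smul_apply, smul_eq_mul, fderiv_apply_coord hφ, fderiv_apply_coord hψ,
    mul_comm]
  rfl

lemma jac_id (y : EuclideanSpace ℝ (Fin n)) : jac id y = (1 : Matrix (Fin n) (Fin n) ℝ) := by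
  ext a i
  have h1 := fderiv_apply_coord (differentiableAt_id (𝕜 := ℝ) (x := y)) (stdDir i) a
  refine h1.symm.trans ?_
  simp [stdDir, Matrix.one_apply]

variable [IsManifold (𝓡 n) ∞ M]

lemma contMDiffAt_extChartAt_symm {x : M} {y : EuclideanSpace ℝ (Fin n)}
    (hy : y ∈ (extChartAt (𝓡 n) x).target) :
    ContMDiffAt 𝓘(ℝ, EuclideanSpace ℝ (Fin n)) (𝓡 n) ∞ (extChartAt (𝓡 n) x).symm y :=
  (contMDiffOn_extChartAt_symm x).contMDiffAt (target_mem_nhds hy)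

/-- The coordinate vector field `∂ᵢ` is smooth. -/
lemma contMDiffAt_coordVector {x : M} {y : EuclideanSpace ℝ (Fin n)}
    (hy : y ∈ (extChartAt (𝓡 n) x).target) (v : EuclideanSpace ℝ (Fin n)) :
    ContMDiffAt 𝓘(ℝ, EuclideanSpace ℝ (Fin n))
      ((𝓡 n).prod 𝓘(ℝ, EuclideanSpace ℝ (Fin n))) ∞
      (fun z => Bundle.TotalSpace.mk' (EuclideanSpace ℝ (Fin n))
        (E := fun p : M => TangentSpace (𝓡 n) p) ((extChartAt (𝓡 n) x).symm z)
        (mfderiv 𝓘(ℝ, EuclideanSpace ℝ (Fin n)) (𝓡 n) (extChartAt (𝓡 n) x).symm z v)) y := by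
  have h1 := ContMDiffOn.contMDiffOn_tangentMapWithin (m := ∞)
    (contMDiffOn_extChartAt_symm (I := 𝓡 n) (n := ∞) x) (by simp)
    (isOpen_extChartAt_target x).uniqueMDiffOn
  have h2 : ContMDiff 𝓘(ℝ, EuclideanSpace ℝ (Fin n))
      (𝓘(ℝ, EuclideanSpace ℝ (Fin n)).prod 𝓘(ℝ, EuclideanSpace ℝ (Fin n))) ∞
      (fun z => Bundle.TotalSpace.mk' (EuclideanSpace ℝ (Fin n))
        (E := fun p : EuclideanSpace ℝ (Fin n) =>
          TangentSpace 𝓘(ℝ, EuclideanSpace ℝ (Fin n)) p) z v) := by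
    intro z
    refine (Bundle.contMDiffAt_section (F := EuclideanSpace ℝ (Fin n)) z).mpr ?_
    simpa using! contMDiffAt_const
  have h3 := (h1.comp h2.contMDiffOn (s := (extChartAt (𝓡 n) x).target)
    (fun z hz => hz)).contMDiffAt (target_mem_nhds hy)
  refine h3.congr_of_eventuallyEq ?_
  filter_upwards [target_mem_nhds hy] with z hz
  simp only [Function.comp_apply, tangentMapWithin]
  rw [mfderivWithin_of_isOpen (isOpen_extChartAt_target x) hz]

/-- The components of a smooth tensor field are smooth. -/
lemma IsSmoothSymmetric.contDiffAt_coordMatrix {h : TwoTensorField n M} (hh : IsSmoothSymmetric h)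
    {x : M} {y : EuclideanSpace ℝ (Fin n)} (hy : y ∈ (extChartAt (𝓡 n) x).target) (i j : Fin n) :
    ContDiffAt ℝ ∞ (fun z => coordMatrix h x z i j) y := by
  have h1 := (hh.2 ((extChartAt (𝓡 n) x).symm y)).comp y (contMDiffAt_extChartAt_symm hy)
  have h2 := ContMDiffAt.clm_bundle_apply₂ (F₁ := EuclideanSpace ℝ (Fin n))
    (F₂ := EuclideanSpace ℝ (Fin n)) (F₃ := ℝ) (E₁ := fun p : M => TangentSpace (𝓡 n) p)
    (E₂ := fun p : M => TangentSpace (𝓡 n) p) (E₃ := fun _ : M => ℝ)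
    (b := (extChartAt (𝓡 n) x).symm) (ψ := fun z => h ((extChartAt (𝓡 n) x).symm z))
    h1 (contMDiffAt_coordVector hy (EuclideanSpace.single i 1))
    (contMDiffAt_coordVector hy (EuclideanSpace.single j 1))
  rw [Bundle.contMDiffAt_totalSpace] at h2
  exact h2.2.contDiffAt

lemma IsSmoothSymmetric.transpose_coordMatrix {h : TwoTensorField n M} (hh : IsSmoothSymmetric h)
    (x : M) (y : EuclideanSpace ℝ (Fin n)) : (coordMatrix h x y)ᵀ = coordMatrix h x y := by
  ext i j
  exact hh.1 _ _ _

lemma isSmoothSymmetric_inner (g : Metric n M) : IsSmoothSymmetric g.inner :=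
  ⟨g.symm, g.contMDiff⟩

set_option synthInstance.maxHeartbeats 400000 in
lemma isSmoothSymmetric_zero : IsSmoothSymmetric (0 : TwoTensorField n M) :=
  ⟨fun _ _ _ => rfl, Bundle.contMDiff_zeroSection ℝ
    (fun x : M => TangentSpace (𝓡 n) x →L[ℝ] TangentSpace (𝓡 n) x →L[ℝ] ℝ)⟩

lemma posDef_coordMatrix (g : Metric n M) {x : M} {y : EuclideanSpace ℝ (Fin n)}
    (hy : y ∈ (extChartAt (𝓡 n) x).target) : (coordMatrix g.inner x y).PosDef := by
  refine Matrix.PosDef.of_dotProduct_mulVec_pos ?_ fun v hv => ?_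
  · rw [Matrix.IsHermitian, Matrix.conjTranspose_eq_transpose_of_trivial]
    exact (isSmoothSymmetric_inner g).transpose_coordMatrix x y
  · have hinj : Function.Injective (chartFrame x y) := by
      have := isInvertible_mfderivWithin_extChartAt_symm hy
      rw [← mfderiv_extChartAt_symm_eq] at this
      exact this.injective
    set w : EuclideanSpace ℝ (Fin n) := WithLp.toLp 2 v with hw
    have hne : chartFrame x y w ≠ 0 := by
      intro h0
      have : w = 0 := hinj (h0.trans (map_zero _).symm)
      apply hv
      have := congrArg WithLp.ofLp this
      simpa [hw] using this
    have hpos : 0 < toBilin g.inner ((extChartAt (𝓡 n) x).symm y) (chartFrame x y w)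
        (chartFrame x y w) := g.pos _ _ hne
    rw [map_sum_stdDir, bilin_sum_sum] at hpos
    refine hpos.trans_eq ?_
    simp only [dotProduct, Matrix.mulVec, star_trivial, Finset.mul_sum]
    refine Finset.sum_congr rfl fun i _ => Finset.sum_congr rfl fun j _ => ?_
    rw [coordMatrix_apply]
    ring

lemma isMetricAt_coordMatrix (g : Metric n M) {x : M} {y : EuclideanSpace ℝ (Fin n)}
    (hy : y ∈ (extChartAt (𝓡 n) x).target) : IsMetricAt (coordMatrix g.inner x) y :=
  ⟨fun i j => (isSmoothSymmetric_inner g).contDiffAt_coordMatrix hy i j,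
    Eventually.of_forall fun z => (isSmoothSymmetric_inner g).transpose_coordMatrix x z,
    (posDef_coordMatrix g hy).det_pos.ne'⟩

/-- The overlap of two charts, in the coordinates of the first. -/
lemma overlap_mem_nhds {x x₀ : M} {y : EuclideanSpace ℝ (Fin n)}
    (hy : y ∈ (extChartAt (𝓡 n) x).target)
    (hy' : (extChartAt (𝓡 n) x).symm y ∈ (extChartAt (𝓡 n) x₀).source) :
    ∀ᶠ z in 𝓝 y, z ∈ (extChartAt (𝓡 n) x).target ∧
      (extChartAt (𝓡 n) x).symm z ∈ (extChartAt (𝓡 n) x₀).source := by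
  refine Eventually.and (target_mem_nhds hy) ?_
  exact (contMDiffAt_extChartAt_symm hy).continuousAt.eventually
    ((isOpen_extChartAt_source x₀).mem_nhds hy')

lemma contDiffAt_transition {x x₀ : M} {y : EuclideanSpace ℝ (Fin n)}
    (hy : y ∈ (extChartAt (𝓡 n) x).target)
    (hy' : (extChartAt (𝓡 n) x).symm y ∈ (extChartAt (𝓡 n) x₀).source) :
    ContDiffAt ℝ ∞ (transition x x₀) y := by
  have h1 : ContMDiffAt (𝓡 n) 𝓘(ℝ, EuclideanSpace ℝ (Fin n)) ∞ (extChartAt (𝓡 n) x₀)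
      ((extChartAt (𝓡 n) x).symm y) :=
    contMDiffAt_extChartAt' (by rwa [extChartAt_source] at hy')
  exact (h1.comp y (contMDiffAt_extChartAt_symm hy)).contDiffAt

lemma det_jac_transition_ne_zero {x x₀ : M} {y : EuclideanSpace ℝ (Fin n)}
    (hy : y ∈ (extChartAt (𝓡 n) x).target)
    (hy' : (extChartAt (𝓡 n) x).symm y ∈ (extChartAt (𝓡 n) x₀).source) :
    (jac (transition x x₀) y).det ≠ 0 := by
  have h1 : transition x₀ x ∘ transition x x₀ =ᶠ[𝓝 y] id := by
    filter_upwards [overlap_mem_nhds hy hy'] with z hz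
    exact transition_transition hz.1 hz.2
  have h2 : jac (transition x₀ x ∘ transition x x₀) y = jac id y := by
    ext a i
    have : (fun z => (transition x₀ x ∘ transition x x₀) z a) =ᶠ[𝓝 y] fun z => id z a := by
      filter_upwards [h1] with z hz
      rw [hz]
    simp only [jac, Matrix.of_apply, partialDeriv, this.fderiv_eq]
  have hd : ContDiffAt ℝ ∞ (transition x₀ x) (transition x x₀ y) :=
    contDiffAt_transition ((extChartAt (𝓡 n) x₀).map_source hy')
      (by rw [symm_transition hy']; exact (extChartAt (𝓡 n) x).map_target hy)
  rw [jac_mul_jac ((contDiffAt_transition hy hy').differentiableAt (by simp))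
    (hd.differentiableAt (by simp)), jac_id] at h2
  have h3 := congrArg Matrix.det h2
  rw [Matrix.det_mul, Matrix.det_one] at h3
  exact right_ne_zero_of_mul_eq_one h3

/-- The matrices of a tensor field in two charts are congruent through the Jacobian matrix of the
transition map. -/
lemma coordMatrix_eq_of_transition (h : TwoTensorField n M) {x x₀ : M}
    {y : EuclideanSpace ℝ (Fin n)} (hy : y ∈ (extChartAt (𝓡 n) x).target)
    (hy' : (extChartAt (𝓡 n) x).symm y ∈ (extChartAt (𝓡 n) x₀).source) :
    coordMatrix h x y = (jac (transition x x₀) y)ᵀ * coordMatrix h x₀ (transition x x₀ y) *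
      jac (transition x x₀) y := by
  have hφ := contDiffAt_transition hy hy'
  have hφd : DifferentiableAt ℝ (transition x x₀) y := hφ.differentiableAt (by simp)
  have hyt : transition x x₀ y ∈ (extChartAt (𝓡 n) x₀).target :=
    (extChartAt (𝓡 n) x₀).map_source hy'
  have heq : (extChartAt (𝓡 n) x).symm =ᶠ[𝓝 y]
      (extChartAt (𝓡 n) x₀).symm ∘ transition x x₀ := by
    filter_upwards [overlap_mem_nhds hy hy'] with z hz
    exact (symm_transition hz.2).symm
  have hD : ∀ i, chartFrame x y (stdDir i) = ∑ a, jac (transition x x₀) y a i •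
      chartFrame x₀ (transition x x₀ y) (stdDir a) := by
    intro i
    have h1 : chartFrame x y = (chartFrame x₀ (transition x x₀ y)).comp
        (fderiv ℝ (transition x x₀) y) := by
      have h2 := heq.mfderiv_eq (I := 𝓘(ℝ, EuclideanSpace ℝ (Fin n))) (I' := 𝓡 n)
      rw [mfderiv_comp y ((contMDiffAt_extChartAt_symm hyt).mdifferentiableAt
        (by simp)) hφd.mdifferentiableAt, mfderiv_eq_fderiv] at h2
      exact h2
    rw [h1, ContinuousLinearMap.comp_apply, map_sum_stdDir]
    refine Finset.sum_congr rfl fun a _ => ?_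
    rw [fderiv_apply_coord hφd]
    rfl
  ext i j
  rw [coordMatrix_apply, hD i, hD j, bilin_sum_sum, ← symm_transition hy']
  simp only [Matrix.mul_apply, Matrix.transpose_apply, Finset.sum_mul]
  rw [Finset.sum_comm]
  refine Finset.sum_congr rfl fun b _ => Finset.sum_congr rfl fun a _ => ?_
  rw [coordMatrix_apply]
  ring

end

section

open Filter Topology Matrix

variable {n : ℕ}

/-! ### Invariance of the curvature quantities under changes of charts -/

lemma congruence_inv_mul {J G A : Matrix (Fin n) (Fin n) ℝ} (hJ : J.det ≠ 0) :
    (Jᵀ * G * J)⁻¹ * (Jᵀ * A * J) = J⁻¹ * (G⁻¹ * A) * J := by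
  have hJ' : IsUnit J.det := isUnit_iff_ne_zero.mpr hJ
  have hJt : IsUnit Jᵀ.det := by rwa [Matrix.det_transpose]
  rw [Matrix.mul_inv_rev, Matrix.mul_inv_rev]
  have h1 : (Jᵀ)⁻¹ * (Jᵀ * A * J) = A * J := by
    rw [mul_assoc Jᵀ, Matrix.nonsing_inv_mul_cancel_left _ _ hJt]
  simp only [mul_assoc] at h1 ⊢
  rw [h1]

lemma trace_congruence {J G A : Matrix (Fin n) (Fin n) ℝ} (hJ : J.det ≠ 0) :
    trace ((Jᵀ * G * J)⁻¹ * (Jᵀ * A * J)) = trace (G⁻¹ * A) := by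
  have hJ' : IsUnit J.det := isUnit_iff_ne_zero.mpr hJ
  rw [congruence_inv_mul hJ, Matrix.trace_mul_comm, ← mul_assoc, Matrix.mul_nonsing_inv _ hJ',
    one_mul]

lemma trace_congruence_inner {J G A B : Matrix (Fin n) (Fin n) ℝ} (hJ : J.det ≠ 0) :
    trace ((Jᵀ * G * J)⁻¹ * (Jᵀ * A * J) * (Jᵀ * G * J)⁻¹ * (Jᵀ * B * J))
      = trace (G⁻¹ * A * G⁻¹ * B) := by
  have hJ' : IsUnit J.det := isUnit_iff_ne_zero.mpr hJ
  rw [mul_assoc _ _ (Jᵀ * B * J), congruence_inv_mul hJ, congruence_inv_mul hJ]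
  have h1 : J⁻¹ * (G⁻¹ * A) * J * (J⁻¹ * (G⁻¹ * B) * J)
      = J⁻¹ * ((G⁻¹ * A * G⁻¹ * B) * J) := by
    simp only [mul_assoc, Matrix.mul_nonsing_inv_cancel_left _ _ hJ']
  rw [h1, Matrix.trace_mul_comm, mul_assoc, Matrix.mul_nonsing_inv _ hJ', mul_one]

lemma partialDeriv_congr {u v : EuclideanSpace ℝ (Fin n) → ℝ} {y : EuclideanSpace ℝ (Fin n)}
    (h : u =ᶠ[𝓝 y] v) (i : Fin n) : partialDeriv i u =ᶠ[𝓝 y] partialDeriv i v := by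
  filter_upwards [eventually_eventually_nhds.mpr h] with z hz
  simp only [partialDeriv, Filter.EventuallyEq.fderiv_eq hz]

lemma hessianCoord_congr (G : EuclideanSpace ℝ (Fin n) → Matrix (Fin n) (Fin n) ℝ)
    {u v : EuclideanSpace ℝ (Fin n) → ℝ} {y : EuclideanSpace ℝ (Fin n)} (h : u =ᶠ[𝓝 y] v) :
    hessianCoord G u y = hessianCoord G v y := by
  ext i j
  have h1 := fun k => (partialDeriv_congr h k).self_of_nhds
  have h2 := (partialDeriv_congr (partialDeriv_congr h j) i).self_of_nhds
  simp only [hessianCoord, Matrix.of_apply, h1, h2]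

lemma contDiffAt_partialDeriv {u : EuclideanSpace ℝ (Fin n) → ℝ} {y : EuclideanSpace ℝ (Fin n)}
    (hu : ContDiffAt ℝ ∞ u y) (i : Fin n) : ContDiffAt ℝ ∞ (partialDeriv i u) y :=
  (hu.fderiv_right (m := ∞) (by simp)).clm_apply contDiffAt_const

lemma partialDeriv_add {u v : EuclideanSpace ℝ (Fin n) → ℝ} {y : EuclideanSpace ℝ (Fin n)}
    (hu : ContDiffAt ℝ ∞ u y) (hv : ContDiffAt ℝ ∞ v y) (i : Fin n) :
    partialDeriv i (u + v) =ᶠ[𝓝 y] partialDeriv i u + partialDeriv i v := by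
  filter_upwards [SmoothGerm.eventually_differentiableAt hu,
    SmoothGerm.eventually_differentiableAt hv] with z h1 h2
  simp only [partialDeriv, Pi.add_apply, fderiv_add h1 h2]
  rfl

lemma hessianCoord_add (G : EuclideanSpace ℝ (Fin n) → Matrix (Fin n) (Fin n) ℝ)
    {u v : EuclideanSpace ℝ (Fin n) → ℝ} {y : EuclideanSpace ℝ (Fin n)}
    (hu : ContDiffAt ℝ ∞ u y) (hv : ContDiffAt ℝ ∞ v y) :
    hessianCoord G (u + v) y = hessianCoord G u y + hessianCoord G v y := by
  ext i j
  have h1 := fun k => (partialDeriv_add hu hv k).self_of_nhds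
  have h2 := (partialDeriv_congr (partialDeriv_add hu hv j) i).self_of_nhds
  have h3 := (partialDeriv_add (contDiffAt_partialDeriv hu j) (contDiffAt_partialDeriv hv j)
    i).self_of_nhds
  simp only [hessianCoord, Matrix.of_apply, Matrix.add_apply, h1, h2, h3, Pi.add_apply, mul_add,
    Finset.sum_add_distrib]
  ring

variable {M : Type*} [TopologicalSpace M] [ChartedSpace (EuclideanSpace ℝ (Fin n)) M]

/-- The squared norm of the Ricci tensor. -/
def normSqRicci (g : TwoTensorField n M) (x : M) : ℝ :=
  normSqRicciCoord (coordMatrix g x) (extChartAt (𝓡 n) x x)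

/-- The inner product of the Ricci tensor and the Hessian of `u`. -/
def ricInnerHess (g : TwoTensorField n M) (u : M → ℝ) (x : M) : ℝ :=
  trace ((coordMatrix g x (extChartAt (𝓡 n) x x))⁻¹ *
    ricciCoord (coordMatrix g x) (extChartAt (𝓡 n) x x) *
    (coordMatrix g x (extChartAt (𝓡 n) x x))⁻¹ *
    hessianCoord (coordMatrix g x) (u ∘ (extChartAt (𝓡 n) x).symm) (extChartAt (𝓡 n) x x))

/-- The matrix of `∇²u - (Δu) g - u Ric`, the formal adjoint of the linearized scalar curvature
applied to `u`. -/
def adjointScalarCoord (G : EuclideanSpace ℝ (Fin n) → Matrix (Fin n) (Fin n) ℝ)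
    (u : EuclideanSpace ℝ (Fin n) → ℝ) (y : EuclideanSpace ℝ (Fin n)) :
    Matrix (Fin n) (Fin n) ℝ :=
  hessianCoord G u y - trace ((G y)⁻¹ * hessianCoord G u y) • G y - u y • ricciCoord G y

/-- The linearization of the scalar curvature in the direction `h`. -/
def linearizedScalar (g h : TwoTensorField n M) (x : M) : ℝ :=
  deriv (fun t : ℝ => scalarCurvature (g + t • h) x) 0

/-- The integrand `u DR(h) - ⟨∇²u - (Δu) g - u Ric, h⟩`. -/
def adjointDefect (g h : TwoTensorField n M) (u : M → ℝ) (x : M) : ℝ :=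
  u x * linearizedScalar g h x
    - trace ((coordMatrix g x (extChartAt (𝓡 n) x x))⁻¹ *
      adjointScalarCoord (coordMatrix g x) (u ∘ (extChartAt (𝓡 n) x).symm) (extChartAt (𝓡 n) x x) *
      (coordMatrix g x (extChartAt (𝓡 n) x x))⁻¹ *
      coordMatrix h x (extChartAt (𝓡 n) x x))

lemma transition_self (p x₀ : M) :
    transition p x₀ (extChartAt (𝓡 n) p p) = extChartAt (𝓡 n) x₀ p := by
  simp only [transition, Function.comp_apply, extChartAt_to_inv]

lemma symm_self_mem {p x₀ : M} (hp : p ∈ (extChartAt (𝓡 n) x₀).source) :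
    (extChartAt (𝓡 n) p).symm (extChartAt (𝓡 n) p p) ∈ (extChartAt (𝓡 n) x₀).source := by
  rwa [extChartAt_to_inv]

variable [IsManifold (𝓡 n) ∞ M]

lemma contDiffAt_comp_extChartAt_symm {u : M → ℝ} (hu : ContMDiff (𝓡 n) 𝓘(ℝ, ℝ) ∞ u) {x : M}
    {y : EuclideanSpace ℝ (Fin n)} (hy : y ∈ (extChartAt (𝓡 n) x).target) :
    ContDiffAt ℝ ∞ (u ∘ (extChartAt (𝓡 n) x).symm) y :=
  (hu.contMDiffAt.comp y (contMDiffAt_extChartAt_symm hy)).contDiffAt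

section chart

variable {p x₀ : M} (hp : p ∈ (extChartAt (𝓡 n) x₀).source)
include hp

/-- All tensors at `p` are transformed by the same invertible matrix when the chart at `p` is
replaced by another chart around `p`. -/
lemma exists_chart_change : ∃ J : Matrix (Fin n) (Fin n) ℝ, J.det ≠ 0 ∧
    (∀ h : TwoTensorField n M, coordMatrix h p (extChartAt (𝓡 n) p p)
      = Jᵀ * coordMatrix h x₀ (extChartAt (𝓡 n) x₀ p) * J) ∧
    ∀ k : TwoTensorField n M, IsMetricAt (coordMatrix k x₀) (extChartAt (𝓡 n) x₀ p) →
      IsMetricAt (coordMatrix k p) (extChartAt (𝓡 n) p p) →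
      ricciCoord (coordMatrix k p) (extChartAt (𝓡 n) p p)
        = Jᵀ * ricciCoord (coordMatrix k x₀) (extChartAt (𝓡 n) x₀ p) * J ∧
      ∀ u : M → ℝ, ContMDiff (𝓡 n) 𝓘(ℝ, ℝ) ∞ u →
        hessianCoord (coordMatrix k p) (u ∘ (extChartAt (𝓡 n) p).symm) (extChartAt (𝓡 n) p p)
          = Jᵀ * hessianCoord (coordMatrix k x₀) (u ∘ (extChartAt (𝓡 n) x₀).symm)
            (extChartAt (𝓡 n) x₀ p) * J := by
  have hy := mem_target_self (n := n) p
  have hy' := symm_self_mem hp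
  have ht := transition_self (n := n) p x₀
  refine ⟨jac (transition p x₀) (extChartAt (𝓡 n) p p), det_jac_transition_ne_zero hy hy',
    fun h => ?_, fun k hk hk' => ?_⟩
  · rw [coordMatrix_eq_of_transition h hy hy', ht]
  · have hch := coord_change (contDiffAt_transition hy hy') (G := coordMatrix k x₀)
      (G' := coordMatrix k p) (by rwa [ht]) hk' (det_jac_transition_ne_zero hy hy')
      (by
        filter_upwards [overlap_mem_nhds hy hy'] with z hz
        exact coordMatrix_eq_of_transition k hz.1 hz.2)
    rw [ht] at hch
    refine ⟨hch.1, fun u hu => ?_⟩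
    rw [← hch.2 _ (contDiffAt_comp_extChartAt_symm hu ((extChartAt (𝓡 n) x₀).map_source hp))]
    refine hessianCoord_congr _ ?_
    filter_upwards [overlap_mem_nhds hy hy'] with z hz
    simp only [Function.comp_apply, symm_transition hz.2]

variable (g : Metric n M)

lemma scalarCurvature_eq : scalarCurvature g.inner p
    = scalarCoord (coordMatrix g.inner x₀) (extChartAt (𝓡 n) x₀ p) := by
  obtain ⟨J, hJ, hc, hk⟩ := exists_chart_change hp
  obtain ⟨hr, -⟩ := hk g.inner (isMetricAt_coordMatrix g ((extChartAt (𝓡 n) x₀).map_source hp))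
    (isMetricAt_coordMatrix g (mem_target_self p))
  rw [scalarCurvature, scalarCoord, scalarCoord, hc, hr, trace_congruence hJ]

lemma normSqRicci_eq : normSqRicci g.inner p
    = normSqRicciCoord (coordMatrix g.inner x₀) (extChartAt (𝓡 n) x₀ p) := by
  obtain ⟨J, hJ, hc, hk⟩ := exists_chart_change hp
  obtain ⟨hr, -⟩ := hk g.inner (isMetricAt_coordMatrix g ((extChartAt (𝓡 n) x₀).map_source hp))
    (isMetricAt_coordMatrix g (mem_target_self p))
  rw [normSqRicci, normSqRicciCoord, normSqRicciCoord, hc, hr, trace_congruence_inner hJ]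

variable {u : M → ℝ} (hu : ContMDiff (𝓡 n) 𝓘(ℝ, ℝ) ∞ u)
include hu

lemma laplacian_eq : laplacian g.inner u p
    = trace ((coordMatrix g.inner x₀ (extChartAt (𝓡 n) x₀ p))⁻¹ *
      hessianCoord (coordMatrix g.inner x₀) (u ∘ (extChartAt (𝓡 n) x₀).symm)
        (extChartAt (𝓡 n) x₀ p)) := by
  obtain ⟨J, hJ, hc, hk⟩ := exists_chart_change hp
  obtain ⟨-, hh⟩ := hk g.inner (isMetricAt_coordMatrix g ((extChartAt (𝓡 n) x₀).map_source hp))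
    (isMetricAt_coordMatrix g (mem_target_self p))
  rw [laplacian, hc, hh u hu, trace_congruence hJ]

lemma ricInnerHess_eq : ricInnerHess g.inner u p
    = trace ((coordMatrix g.inner x₀ (extChartAt (𝓡 n) x₀ p))⁻¹ *
      ricciCoord (coordMatrix g.inner x₀) (extChartAt (𝓡 n) x₀ p) *
      (coordMatrix g.inner x₀ (extChartAt (𝓡 n) x₀ p))⁻¹ *
      hessianCoord (coordMatrix g.inner x₀) (u ∘ (extChartAt (𝓡 n) x₀).symm)
        (extChartAt (𝓡 n) x₀ p)) := by
  obtain ⟨J, hJ, hc, hk⟩ := exists_chart_change hp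
  obtain ⟨hr, hh⟩ := hk g.inner (isMetricAt_coordMatrix g ((extChartAt (𝓡 n) x₀).map_source hp))
    (isMetricAt_coordMatrix g (mem_target_self p))
  rw [ricInnerHess, hc, hr, hh u hu, trace_congruence_inner hJ]

lemma adjointDefect_eq {h : TwoTensorField n M} (hh : IsSmoothSymmetric h) :
    adjointDefect g.inner h u p = u p * deriv (fun t : ℝ => scalarCoord
        (fun z => coordMatrix g.inner x₀ z + t • coordMatrix h x₀ z) (extChartAt (𝓡 n) x₀ p)) 0
      - trace ((coordMatrix g.inner x₀ (extChartAt (𝓡 n) x₀ p))⁻¹ *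
        adjointScalarCoord (coordMatrix g.inner x₀) (u ∘ (extChartAt (𝓡 n) x₀).symm)
          (extChartAt (𝓡 n) x₀ p) *
        (coordMatrix g.inner x₀ (extChartAt (𝓡 n) x₀ p))⁻¹ *
        coordMatrix h x₀ (extChartAt (𝓡 n) x₀ p)) := by
  obtain ⟨J, hJ, hc, hk⟩ := exists_chart_change hp
  have hx := (extChartAt (𝓡 n) x₀).map_source hp
  have hx' := mem_target_self (n := n) p
  have hm := isMetricAt_coordMatrix g hx
  have hm' := isMetricAt_coordMatrix g hx'
  obtain ⟨hr, hs⟩ := hk g.inner hm hm'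
  have hA : adjointScalarCoord (coordMatrix g.inner p) (u ∘ (extChartAt (𝓡 n) p).symm)
        (extChartAt (𝓡 n) p p)
      = Jᵀ * adjointScalarCoord (coordMatrix g.inner x₀) (u ∘ (extChartAt (𝓡 n) x₀).symm)
        (extChartAt (𝓡 n) x₀ p) * J := by
    simp only [adjointScalarCoord, hc, hr, hs u hu, trace_congruence hJ, Function.comp_apply,
      extChartAt_to_inv, (extChartAt (𝓡 n) x₀).left_inv hp, mul_sub, sub_mul, Matrix.mul_smul,
      Matrix.smul_mul]
  have hlin : linearizedScalar g.inner h p = deriv (fun t : ℝ => scalarCoord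
        (fun z => coordMatrix g.inner x₀ z + t • coordMatrix h x₀ z)
            (extChartAt (𝓡 n) x₀ p)) 0 := by
    refine Filter.EventuallyEq.deriv_eq ?_
    filter_upwards [eventually_posDef_add_smul (posDef_coordMatrix g hx)
      (hh.transpose_coordMatrix x₀ _), eventually_posDef_add_smul (posDef_coordMatrix g hx')
      (hh.transpose_coordMatrix p _)] with t h1 h2
    have k1 : IsMetricAt (coordMatrix (g.inner + t • h) x₀) (extChartAt (𝓡 n) x₀ p) := by
      rw [coordMatrix_add_smul]
      exact hm.add_smul (fun i j => hh.contDiffAt_coordMatrix hx i j)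
        (Eventually.of_forall fun z => hh.transpose_coordMatrix x₀ z) h1.det_pos.ne'
    have k2 : IsMetricAt (coordMatrix (g.inner + t • h) p) (extChartAt (𝓡 n) p p) := by
      rw [coordMatrix_add_smul]
      exact hm'.add_smul (fun i j => hh.contDiffAt_coordMatrix hx' i j)
        (Eventually.of_forall fun z => hh.transpose_coordMatrix p z) h2.det_pos.ne'
    rw [scalarCurvature, scalarCoord, (hk _ k1 k2).1, hc, trace_congruence hJ,
      ← coordMatrix_add_smul]
    rfl
  rw [adjointDefect, hA, hlin, hc g.inner, hc h, trace_congruence_inner hJ]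

end chart

end

section

open Filter Topology Matrix

variable {n : ℕ} {M : Type*} [TopologicalSpace M] [ChartedSpace (EuclideanSpace ℝ (Fin n)) M]

/-! ### Operators in divergence form -/

variable [IsManifold (𝓡 n) ∞ M]

/-- `P` is an additive differential operator such that, in every chart, `√(det G) P u` is the
divergence `∑ₖ ∂ₖ Xᵏ` of smooth functions `Xᵏ` which vanish where `u` is locally zero. -/
structure HasDivergenceForm (g : Metric n M) (P : (M → ℝ) → M → ℝ) : Prop where
  add : ∀ u v : M → ℝ, ContMDiff (𝓡 n) 𝓘(ℝ, ℝ) ∞ u → ContMDiff (𝓡 n) 𝓘(ℝ, ℝ) ∞ v →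
    P (u + v) = P u + P v
  exists_density : ∀ x₀ : M, ∃ X : (EuclideanSpace ℝ (Fin n) → ℝ) → Fin n →
      EuclideanSpace ℝ (Fin n) → ℝ,
    (∀ u : M → ℝ, ContMDiff (𝓡 n) 𝓘(ℝ, ℝ) ∞ u → ∀ y ∈ (extChartAt (𝓡 n) x₀).target,
      √(coordMatrix g.inner x₀ y).det * P u ((extChartAt (𝓡 n) x₀).symm y)
        = ∑ k, partialDeriv k (X (u ∘ (extChartAt (𝓡 n) x₀).symm) k) y ∧
      ∀ k, ContDiffAt ℝ ∞ (X (u ∘ (extChartAt (𝓡 n) x₀).symm) k) y) ∧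
    ∀ w k y, w =ᶠ[𝓝 y] 0 → X w k y = 0

lemma gradCoord_eq_zero (G : EuclideanSpace ℝ (Fin n) → Matrix (Fin n) (Fin n) ℝ)
    {w : EuclideanSpace ℝ (Fin n) → ℝ} {y : EuclideanSpace ℝ (Fin n)} (h : w =ᶠ[𝓝 y] 0) :
    gradCoord G w y = 0 := by
  have h1 : ∀ j, partialDeriv j w y = 0 := fun j => by
    rw [(partialDeriv_congr h j).self_of_nhds]
    simp [partialDeriv, Pi.zero_def]
  simp only [gradCoord, h1]
  exact Matrix.mulVec_zero _

variable (g : Metric n M)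

theorem hasDivergenceForm_laplacian : HasDivergenceForm g (laplacian g.inner) := by
  refine ⟨fun u v hu hv => ?_, fun x₀ => ⟨fun w => gradDensity (coordMatrix g.inner x₀) w,
    fun u hu y hy => ?_, fun w k y h => ?_⟩⟩
  · funext p
    have h1 := hessianCoord_add (coordMatrix g.inner p)
      (contDiffAt_comp_extChartAt_symm hu (mem_target_self p))
      (contDiffAt_comp_extChartAt_symm hv (mem_target_self p))
    rw [Pi.add_apply, laplacian, laplacian, laplacian, ← Matrix.trace_add, ← Matrix.mul_add, ← h1]
    rfl
  · rw [laplacian_eq ((extChartAt (𝓡 n) x₀).map_target hy) g hu,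
      (extChartAt (𝓡 n) x₀).right_inv hy]
    exact laplacian_eq_divergence (isMetricAt_coordMatrix g hy) (posDef_coordMatrix g hy).det_pos
      (contDiffAt_comp_extChartAt_symm hu hy)
  · simp [gradDensity, gradCoord_eq_zero _ h]

theorem hasDivergenceForm_ricInnerHess {c : ℝ} (hc : ∀ x : M, scalarCurvature g.inner x = c) :
    HasDivergenceForm g (ricInnerHess g.inner) := by
  refine ⟨fun u v hu hv => ?_, fun x₀ => ⟨fun w => ricGradDensity (coordMatrix g.inner x₀) w,
    fun u hu y hy => ?_, fun w k y h => ?_⟩⟩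
  · funext p
    have h1 := hessianCoord_add (coordMatrix g.inner p)
      (contDiffAt_comp_extChartAt_symm hu (mem_target_self p))
      (contDiffAt_comp_extChartAt_symm hv (mem_target_self p))
    rw [Pi.add_apply, ricInnerHess, ricInnerHess, ricInnerHess, ← Matrix.trace_add,
      ← Matrix.mul_add, ← h1]
    rfl
  · rw [ricInnerHess_eq ((extChartAt (𝓡 n) x₀).map_target hy) g hu,
      (extChartAt (𝓡 n) x₀).right_inv hy]
    refine ric_inner_hess_eq_divergence (isMetricAt_coordMatrix g hy)
      (posDef_coordMatrix g hy).det_pos (c := c) ?_ (contDiffAt_comp_extChartAt_symm hu hy)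
    filter_upwards [target_mem_nhds hy] with z hz
    rw [← hc ((extChartAt (𝓡 n) x₀).symm z),
      scalarCurvature_eq ((extChartAt (𝓡 n) x₀).map_target hz) g,
      (extChartAt (𝓡 n) x₀).right_inv hz]
  · simp [ricGradDensity, gradCoord_eq_zero _ h]

theorem hasDivergenceForm_adjointDefect {h : TwoTensorField n M} (hh : IsSmoothSymmetric h) :
    HasDivergenceForm g (adjointDefect g.inner h) := by
  refine ⟨fun u v hu hv => ?_, fun x₀ => ⟨fun w => variationDensity (coordMatrix g.inner x₀)
    (coordMatrix h x₀) w, fun u hu y hy => ?_, fun w k y h => ?_⟩⟩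
  · funext p
    have h1 : adjointScalarCoord (coordMatrix g.inner p) ((u + v) ∘ (extChartAt (𝓡 n) p).symm)
          (extChartAt (𝓡 n) p p)
        = adjointScalarCoord (coordMatrix g.inner p) (u ∘ (extChartAt (𝓡 n) p).symm)
          (extChartAt (𝓡 n) p p)
        + adjointScalarCoord (coordMatrix g.inner p) (v ∘ (extChartAt (𝓡 n) p).symm)
          (extChartAt (𝓡 n) p p) := by
      have h2 : hessianCoord (coordMatrix g.inner p) ((u + v) ∘ (extChartAt (𝓡 n) p).symm)
          (extChartAt (𝓡 n) p p)
          = hessianCoord (coordMatrix g.inner p) (u ∘ (extChartAt (𝓡 n) p).symm)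
            (extChartAt (𝓡 n) p p)
          + hessianCoord (coordMatrix g.inner p) (v ∘ (extChartAt (𝓡 n) p).symm)
            (extChartAt (𝓡 n) p p) := hessianCoord_add (coordMatrix g.inner p)
        (contDiffAt_comp_extChartAt_symm hu (mem_target_self p))
        (contDiffAt_comp_extChartAt_symm hv (mem_target_self p))
      simp only [adjointScalarCoord, h2, Matrix.mul_add, Matrix.trace_add, add_smul,
        Function.comp_apply, Pi.add_apply]
      abel
    simp only [Pi.add_apply, adjointDefect, h1, Matrix.mul_add, Matrix.add_mul, Matrix.trace_add]
    ring
  · rw [adjointDefect_eq ((extChartAt (𝓡 n) x₀).map_target hy) g hu hh,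
      (extChartAt (𝓡 n) x₀).right_inv hy]
    exact variation_scalar_eq_divergence (isMetricAt_coordMatrix g hy)
      (posDef_coordMatrix g hy).det_pos (fun i j => hh.contDiffAt_coordMatrix hy i j)
      (Eventually.of_forall fun z => hh.transpose_coordMatrix x₀ z)
      (contDiffAt_comp_extChartAt_symm hu hy)
  · have h0 : w y = 0 := h.self_of_nhds
    simp [variationDensity, gradCoord_eq_zero _ h, h0]

end

section

open Filter Topology Matrix MeasureTheory

variable {n : ℕ} {M : Type*} [TopologicalSpace M] [ChartedSpace (EuclideanSpace ℝ (Fin n)) M]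

/-! ### The Riemannian volume measure -/

lemma det_fderiv_eq_det_jac {φ : EuclideanSpace ℝ (Fin n) → EuclideanSpace ℝ (Fin n)}
    {y : EuclideanSpace ℝ (Fin n)} (hφ : DifferentiableAt ℝ φ y) :
    (fderiv ℝ φ y).det = (jac φ y).det := by
  rw [ContinuousLinearMap.det, ← LinearMap.det_toMatrix (EuclideanSpace.basisFun (Fin n) ℝ).toBasis]
  congr 1
  ext a i
  rw [LinearMap.toMatrix_apply]
  simp only [OrthonormalBasis.coe_toBasis, OrthonormalBasis.coe_toBasis_repr_apply,
    EuclideanSpace.basisFun_apply, EuclideanSpace.basisFun_repr]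
  exact fderiv_apply_coord hφ (stdDir i) a

lemma measurableSet_target (x : M) : MeasurableSet (extChartAt (𝓡 n) x).target :=
  (isOpen_extChartAt_target x).measurableSet

lemma continuousOn_symm (x : M) :
    ContinuousOn (extChartAt (𝓡 n) x).symm (extChartAt (𝓡 n) x).target :=
  continuousOn_extChartAt_symm x

lemma continuousOn_density [IsManifold (𝓡 n) ∞ M] (g : Metric n M) (x : M) : ContinuousOn
    (fun y => √(coordMatrix g.inner x y).det) (extChartAt (𝓡 n) x).target := fun _ hy =>
  ((isMetricAt_coordMatrix g hy).contDiffAt_det.continuousAt.sqrt).continuousWithinAt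

lemma aemeasurable_density [IsManifold (𝓡 n) ∞ M] (g : Metric n M) (x : M) : AEMeasurable
    (fun y => ENNReal.ofReal √(coordMatrix g.inner x y).det)
    (volume.restrict (extChartAt (𝓡 n) x).target) :=
  ((continuousOn_density g x).aemeasurable (measurableSet_target x)).ennreal_ofReal

variable [MeasurableSpace M] [BorelSpace M]

lemma measurableSet_target_inter_preimage (x : M) {A : Set M} (hA : MeasurableSet A) :
    MeasurableSet ((extChartAt (𝓡 n) x).target ∩ (extChartAt (𝓡 n) x).symm ⁻¹' A) := by
  have h1 : Measurable ((extChartAt (𝓡 n) x).target.domRestrict (extChartAt (𝓡 n) x).symm) :=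
    (continuousOn_symm x).domRestrict.measurable
  have h2 := (measurableSet_target (n := n) x).subtype_image (h1 hA)
  convert h2 using 1
  ext z
  constructor
  · rintro ⟨h3, h4⟩
    exact ⟨⟨z, h3⟩, h4, rfl⟩
  · rintro ⟨w, hw, rfl⟩
    exact ⟨w.2, hw⟩

variable [IsManifold (𝓡 n) ∞ M] (g : Metric n M)

lemma aemeasurable_symm (x : M) : AEMeasurable (extChartAt (𝓡 n) x).symm
    ((volume.restrict (extChartAt (𝓡 n) x).target).withDensity
      fun y => ENNReal.ofReal √(coordMatrix g.inner x y).det) :=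
  ((continuousOn_symm x).aemeasurable (measurableSet_target x)).mono_ac
    (withDensity_absolutelyContinuous _ _)

lemma chartVolume_apply (x : M) {A : Set M} (hA : MeasurableSet A) :
    chartVolume g.inner x A
      = ∫⁻ y in (extChartAt (𝓡 n) x).target ∩ (extChartAt (𝓡 n) x).symm ⁻¹' A,
          ENNReal.ofReal √(coordMatrix g.inner x y).det := by
  have hB := measurableSet_target_inter_preimage (n := n) x hA
  rw [chartVolume, Measure.map_apply_of_aemeasurable (aemeasurable_symm g x) hA]
  have hnull : (volume.restrict (extChartAt (𝓡 n) x).target).withDensity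
      (fun y => ENNReal.ofReal √(coordMatrix g.inner x y).det) (extChartAt (𝓡 n) x).targetᶜ = 0 :=
    withDensity_absolutelyContinuous _ _ (by
      rw [Measure.restrict_apply (measurableSet_target (n := n) x).compl]; simp)
  have h1 : (extChartAt (𝓡 n) x).symm ⁻¹' A =ᵐ[(volume.restrict
      (extChartAt (𝓡 n) x).target).withDensity
        fun y => ENNReal.ofReal √(coordMatrix g.inner x y).det]
      ((extChartAt (𝓡 n) x).target ∩ (extChartAt (𝓡 n) x).symm ⁻¹' A : Set _) := by
    have h2 : ∀ᵐ y ∂((volume.restrict (extChartAt (𝓡 n) x).target).withDensity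
        fun y => ENNReal.ofReal √(coordMatrix g.inner x y).det),
        y ∈ (extChartAt (𝓡 n) x).target := hnull
    filter_upwards [h2] with y hy
    exact propext ⟨fun h => ⟨hy, h⟩, fun h => h.2⟩
  rw [measure_congr h1, withDensity_apply _ hB, Measure.restrict_restrict hB,
    Set.inter_eq_left.mpr Set.inter_subset_left]

lemma chartVolume_compl_source (x : M) :
    chartVolume g.inner x (extChartAt (𝓡 n) x).sourceᶜ = 0 := by
  rw [chartVolume_apply g x (isOpen_extChartAt_source (I := 𝓡 n) x).measurableSet.compl]
  have : (extChartAt (𝓡 n) x).target ∩ (extChartAt (𝓡 n) x).symm ⁻¹' (extChartAt (𝓡 n) x).sourceᶜ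
      = ∅ := by
    ext z
    simp only [Set.mem_inter_iff, Set.mem_preimage, Set.mem_compl_iff, Set.mem_empty_iff_false,
      iff_false, not_and, not_not]
    exact fun hz => (extChartAt (𝓡 n) x).map_target hz
  rw [this]
  simp

/-- The measures of two charts agree on the overlap of the charts. -/
lemma chartVolume_eq_of_subset {x x₀ : M} {A : Set M} (hA : MeasurableSet A)
    (hx : A ⊆ (extChartAt (𝓡 n) x).source) (hx₀ : A ⊆ (extChartAt (𝓡 n) x₀).source) :
    chartVolume g.inner x A = chartVolume g.inner x₀ A := by
  rw [chartVolume_apply g x hA, chartVolume_apply g x₀ hA]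
  set B := (extChartAt (𝓡 n) x).target ∩ (extChartAt (𝓡 n) x).symm ⁻¹' A with hB
  have hBm : MeasurableSet B := measurableSet_target_inter_preimage (n := n) x hA
  have himg : (extChartAt (𝓡 n) x₀).target ∩ (extChartAt (𝓡 n) x₀).symm ⁻¹' A
      = transition x x₀ '' B := by
    ext z
    constructor
    · rintro ⟨h1, h2⟩
      refine ⟨transition x₀ x z, ⟨(extChartAt (𝓡 n) x).map_source (hx h2), ?_⟩,
        transition_transition h1 (hx h2)⟩
      rw [Set.mem_preimage, symm_transition (hx h2)]
      exact h2
    · rintro ⟨w, ⟨h1, h2⟩, rfl⟩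
      refine ⟨(extChartAt (𝓡 n) x₀).map_source (hx₀ h2), ?_⟩
      rw [Set.mem_preimage, symm_transition (hx₀ h2)]
      exact h2
  have hd : ∀ y ∈ B, DifferentiableAt ℝ (transition x x₀) y := fun y hy =>
    (contDiffAt_transition hy.1 (hx₀ hy.2)).differentiableAt (by simp)
  rw [himg, lintegral_image_eq_lintegral_abs_det_fderiv_mul volume hBm
    (fun y hy => (hd y hy).hasFDerivAt.hasFDerivWithinAt)]
  · refine setLIntegral_congr_fun hBm fun y hy => ?_
    rw [← ENNReal.ofReal_mul (abs_nonneg _), det_fderiv_eq_det_jac (hd y hy),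
      coordMatrix_eq_of_transition g.inner hy.1 (hx₀ hy.2), Matrix.det_mul, Matrix.det_mul,
      Matrix.det_transpose]
    congr 1
    rw [← Real.sqrt_sq_eq_abs, ← Real.sqrt_mul (sq_nonneg _)]
    congr 1
    ring
  · intro y hy z hz hyz
    rw [← transition_transition hy.1 (hx₀ hy.2), hyz, transition_transition hz.1 (hx₀ hz.2)]

/-- The Riemannian volume measure is `√(det G) dy` in each chart. It is the supremum of the chart
measures, and on the domain of the chart at `x₀` none of them exceeds that of this chart. -/
theorem volumeMeasure_restrict_source (x₀ : M) :
    (volumeMeasure g.inner).restrict (extChartAt (𝓡 n) x₀).source = chartVolume g.inner x₀ := by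
  set S := (extChartAt (𝓡 n) x₀).source
  have hS : MeasurableSet S := (isOpen_extChartAt_source x₀).measurableSet
  -- a measure that bounds all the chart measures bounds their supremum
  have hle : volumeMeasure g.inner
      ≤ chartVolume g.inner x₀ + (volumeMeasure g.inner).restrict Sᶜ := by
    refine iSup_le fun x => Measure.le_iff.mpr fun A hA => ?_
    have hSx : MeasurableSet (extChartAt (𝓡 n) x).source :=
      (isOpen_extChartAt_source x).measurableSet
    have h1 : chartVolume g.inner x (A ∩ S) ≤ chartVolume g.inner x₀ A := by
      calc chartVolume g.inner x (A ∩ S)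
          ≤ chartVolume g.inner x (A ∩ S ∩ (extChartAt (𝓡 n) x).source)
            + chartVolume g.inner x (extChartAt (𝓡 n) x).sourceᶜ :=
            (measure_mono fun z hz => (em (z ∈ (extChartAt (𝓡 n) x).source)).imp
              (fun h => ⟨hz, h⟩) fun h => h).trans (measure_union_le _ _)
        _ = chartVolume g.inner x₀ (A ∩ S ∩ (extChartAt (𝓡 n) x).source) := by
            rw [chartVolume_compl_source, add_zero]
            exact chartVolume_eq_of_subset g ((hA.inter hS).inter hSx)
              Set.inter_subset_right fun z hz => hz.1.2
        _ ≤ _ := measure_mono fun z hz => hz.1.1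
    rw [← measure_inter_add_sdiff A hS, Measure.add_apply, Measure.restrict_apply hA]
    refine add_le_add h1 ?_
    exact (le_iSup (chartVolume g.inner) x : _ ≤ volumeMeasure g.inner) _
  refine le_antisymm (Measure.le_iff.mpr fun A hA => ?_) (Measure.le_iff.mpr fun A hA => ?_)
  · rw [Measure.restrict_apply hA]
    refine (hle _).trans ?_
    rw [Measure.add_apply, Measure.restrict_apply (hA.inter hS), Set.inter_assoc,
      Set.inter_compl_self, Set.inter_empty, measure_empty, add_zero]
    exact measure_mono Set.inter_subset_left
  · have h2 : chartVolume g.inner x₀ A ≤ chartVolume g.inner x₀ (A ∩ S) := by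
      refine (measure_mono fun z hz => (em (z ∈ S)).imp (fun h => ⟨hz, h⟩) fun h => h).trans
        ((measure_union_le (A ∩ S) Sᶜ).trans ?_)
      rw [chartVolume_compl_source, add_zero]
    rw [Measure.restrict_apply hA]
    exact h2.trans ((le_iSup (chartVolume g.inner) x₀ : _ ≤ volumeMeasure g.inner) _)

/-- Nonempty open sets have positive volume, so a nonnegative continuous function with vanishing
integral is zero. -/
lemma isOpenPosMeasure_volumeMeasure : (volumeMeasure g.inner).IsOpenPosMeasure := by
  refine ⟨fun U hU hne h0 => ?_⟩
  obtain ⟨p, hp⟩ := hne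
  have h1 : chartVolume g.inner p U = 0 :=
    le_antisymm (((le_iSup (chartVolume g.inner) p : _ ≤ volumeMeasure g.inner) U).trans h0.le)
      bot_le
  rw [chartVolume_apply g p hU.measurableSet] at h1
  set B := (extChartAt (𝓡 n) p).target ∩ (extChartAt (𝓡 n) p).symm ⁻¹' U with hB
  have hBm : MeasurableSet B := measurableSet_target_inter_preimage (n := n) p hU.measurableSet
  have hBo : IsOpen B := (continuousOn_symm p).isOpen_inter_preimage (isOpen_extChartAt_target p) hU
  rw [setLIntegral_eq_zero_iff' hBm ((aemeasurable_density g p).mono_measure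
    (Measure.restrict_mono Set.inter_subset_left le_rfl))] at h1
  have h2 : volume B = 0 := by
    refine measure_mono_null (fun y hy => ?_) h1
    simp only [Set.mem_ofPred_eq, Set.mem_compl_iff, not_forall]
    refine ⟨hy, ?_⟩
    rw [ENNReal.ofReal_eq_zero, not_le]
    exact Real.sqrt_pos.mpr (posDef_coordMatrix g hy.1).det_pos
  refine hBo.measure_ne_zero volume ⟨extChartAt (𝓡 n) p p, mem_target_self p, ?_⟩ h2
  rwa [Set.mem_preimage, extChartAt_to_inv]

end

section

open Filter Topology Matrix MeasureTheory

variable {n : ℕ}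

/-! ### Integrals of divergences -/

lemma integral_partialDeriv_eq_zero {X : EuclideanSpace ℝ (Fin n) → ℝ} (hX : ContDiff ℝ ∞ X)
    (hc : HasCompactSupport X) (k : Fin n) :
    Integrable (partialDeriv k X) ∧ ∫ y, partialDeriv k X y = 0 := by
  have hcont : Continuous (partialDeriv k X) :=
    (hX.continuous_fderiv (by simp)).clm_apply continuous_const
  have hint : Integrable (partialDeriv k X) :=
    hcont.integrable_of_hasCompactSupport (hc.fderiv_apply (𝕜 := ℝ) _)
  refine ⟨hint, ?_⟩
  have h1 := integral_mul_fderiv_eq_neg_fderiv_mul_of_integrable (𝕜 := ℝ)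
    (μ := (volume : Measure (EuclideanSpace ℝ (Fin n)))) (f := fun _ => (1 : ℝ)) (g := X)
    (v := EuclideanSpace.single k 1) (by simp) (by simp only [one_mul]; exact hint)
    (by simpa using hX.continuous.integrable_of_hasCompactSupport hc)
    (fun _ _ => differentiableAt_const _) (fun _ _ => hX.contDiffAt.differentiableAt (by simp))
  simpa using! h1

variable {M : Type*} [TopologicalSpace M] [ChartedSpace (EuclideanSpace ℝ (Fin n)) M]
  [IsManifold (𝓡 n) ∞ M] {g : Metric n M} {P : (M → ℝ) → M → ℝ}

namespace HasDivergenceForm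

lemma map_zero (hP : HasDivergenceForm g P) : P 0 = 0 := by
  have h := hP.add 0 0 contMDiff_const contMDiff_const
  simpa using h

lemma map_sum (hP : HasDivergenceForm g P) {ι : Type*} (s : Finset ι) (u : ι → M → ℝ)
    (hu : ∀ i, ContMDiff (𝓡 n) 𝓘(ℝ, ℝ) ∞ (u i)) : P (∑ i ∈ s, u i) = ∑ i ∈ s, P (u i) := by
  classical
  have h : ContMDiff (𝓡 n) 𝓘(ℝ, ℝ) ∞ (∑ i ∈ s, u i) ∧ P (∑ i ∈ s, u i) = ∑ i ∈ s, P (u i) := by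
    induction s using Finset.induction_on with
    | empty =>
      simp only [Finset.sum_empty]
      exact ⟨contMDiff_const, hP.map_zero⟩
    | insert i s hi ih =>
      rw [Finset.sum_insert hi, Finset.sum_insert hi, ← ih.2]
      exact ⟨(hu i).add ih.1, hP.add _ _ (hu i) ih.1⟩
  exact h.2

variable [MeasurableSpace M] [BorelSpace M] [CompactSpace M]

/-- A function supported in a chart is integrated in that chart, where `P u` is the divergence of
a compactly supported smooth vector field. -/
lemma integral_eq_zero_of_tsupport_subset (hP : HasDivergenceForm g P) {u : M → ℝ}
    (hu : ContMDiff (𝓡 n) 𝓘(ℝ, ℝ) ∞ u) {x₀ : M}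
    (hsupp : tsupport u ⊆ (extChartAt (𝓡 n) x₀).source) :
    Integrable (P u) (volumeMeasure g.inner) ∧ ∫ x, P u x ∂(volumeMeasure g.inner) = 0 := by
  classical
  obtain ⟨X, hX, hX0⟩ := hP.exists_density x₀
  set T := (extChartAt (𝓡 n) x₀).target with hT
  set S := (extChartAt (𝓡 n) x₀).source with hS
  have hTo : IsOpen T := isOpen_extChartAt_target x₀
  have hSo : IsOpen S := isOpen_extChartAt_source x₀
  set w := u ∘ (extChartAt (𝓡 n) x₀).symm with hw
  set K := extChartAt (𝓡 n) x₀ '' tsupport u with hK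
  have hKc : IsCompact K := (isClosed_tsupport u).isCompact.image_of_continuousOn
    ((continuousOn_extChartAt x₀).mono hsupp)
  have hKT : K ⊆ T := by
    rintro _ ⟨p, hp, rfl⟩
    exact (extChartAt (𝓡 n) x₀).map_source (hsupp hp)
  -- the function `w` vanishes near the points of the chart outside `K`
  have hw0 : ∀ y ∈ T, y ∉ K → w =ᶠ[𝓝 y] 0 := by
    intro y hy hyK
    filter_upwards [hTo.mem_nhds hy, hKc.isClosed.isOpen_compl.mem_nhds hyK] with z hz hzK
    change u ((extChartAt (𝓡 n) x₀).symm z) = 0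
    refine image_eq_zero_of_notMem_tsupport fun hmem => hzK ⟨_, hmem, ?_⟩
    exact (extChartAt (𝓡 n) x₀).right_inv hz
  -- outside `T` the functions `X w k` carry no information; `Y` cuts them off, and is smooth since
  -- `X w k` vanishes on `T` off the compact set `K`
  set Y : Fin n → EuclideanSpace ℝ (Fin n) → ℝ := fun k => T.indicator (X w k) with hY
  have hY0 : ∀ k, ∀ y ∉ K, Y k y = 0 := by
    intro k y hy
    by_cases hyT : y ∈ T
    · rw [hY]
      simp only [Set.indicator_of_mem hyT]
      exact hX0 _ _ _ (hw0 y hyT hy)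
    · exact Set.indicator_of_notMem hyT _
  have hYX : ∀ k, ∀ y ∈ T, Y k =ᶠ[𝓝 y] X w k := by
    intro k y hy
    filter_upwards [hTo.mem_nhds hy] with z hz
    exact Set.indicator_of_mem hz _
  have hYsmooth : ∀ k, ContDiff ℝ ∞ (Y k) := by
    intro k
    rw [contDiff_iff_contDiffAt]
    intro y
    by_cases hy : y ∈ K
    · exact ((hX u hu y (hKT hy)).2 k).congr_of_eventuallyEq (hYX k y (hKT hy))
    · have : Y k =ᶠ[𝓝 y] fun _ => 0 := by
        filter_upwards [hKc.isClosed.isOpen_compl.mem_nhds hy] with z hz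
        exact hY0 k z hz
      exact contDiffAt_const.congr_of_eventuallyEq this
  have hYc : ∀ k, HasCompactSupport (Y k) := fun k => HasCompactSupport.intro hKc (hY0 k)
  have hYint := fun k => integral_partialDeriv_eq_zero (hYsmooth k) (hYc k) k
  set D : EuclideanSpace ℝ (Fin n) → ℝ := fun y => ∑ k, partialDeriv k (Y k) y with hD
  have hDint : Integrable D := integrable_finsetSum _ fun k _ => (hYint k).1
  have hDzero : ∫ y, D y = 0 := by
    rw [integral_finsetSum _ fun k _ => (hYint k).1]
    exact Finset.sum_eq_zero fun k _ => (hYint k).2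
  have hDcont : Continuous D := continuous_finsetSum _ fun k _ =>
    ((hYsmooth k).continuous_fderiv (by simp)).clm_apply continuous_const
  have hDK : ∀ y ∉ T, D y = 0 := by
    intro y hy
    refine Finset.sum_eq_zero fun k _ => ?_
    have : Y k =ᶠ[𝓝 y] fun _ => 0 := by
      filter_upwards [hKc.isClosed.isOpen_compl.mem_nhds fun h => hy (hKT h)] with z hz
      exact hY0 k z hz
    rw [partialDeriv, this.fderiv_eq]
    simp
  have hDeq : ∀ y ∈ T, √(coordMatrix g.inner x₀ y).det * P u ((extChartAt (𝓡 n) x₀).symm y)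
      = D y := by
    intro y hy
    rw [(hX u hu y hy).1]
    exact Finset.sum_congr rfl fun k _ => ((partialDeriv_congr (hYX k y hy) k).self_of_nhds).symm
  have hpos : ∀ y ∈ T, 0 < √(coordMatrix g.inner x₀ y).det := fun y hy =>
    Real.sqrt_pos.mpr (posDef_coordMatrix g hy).det_pos
  -- `P u` vanishes outside the chart, by its expression in the other charts
  have hPsupp : ∀ p ∉ S, P u p = 0 := by
    intro p hp
    obtain ⟨X', hX', hX0'⟩ := hP.exists_density p
    have h1 := (hX' u hu _ (mem_target_self p)).1
    rw [extChartAt_to_inv] at h1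
    have hup : u ∘ (extChartAt (𝓡 n) p).symm =ᶠ[𝓝 (extChartAt (𝓡 n) p p)] 0 := by
      have h2 : u =ᶠ[𝓝 p] 0 := notMem_tsupport_iff_eventuallyEq.mp fun h => hp (hsupp h)
      have h3 := (contMDiffAt_extChartAt_symm (mem_target_self (n := n) p)).continuousAt
      rw [ContinuousAt, extChartAt_to_inv] at h3
      exact h3.eventually h2
    have h4 : ∑ k, partialDeriv k (X' (u ∘ (extChartAt (𝓡 n) p).symm) k)
        (extChartAt (𝓡 n) p p) = 0 := by
      refine Finset.sum_eq_zero fun k _ => ?_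
      have : X' (u ∘ (extChartAt (𝓡 n) p).symm) k =ᶠ[𝓝 (extChartAt (𝓡 n) p p)] fun _ => 0 := by
        filter_upwards [eventually_eventually_nhds.mpr hup] with z hz
        exact hX0' _ _ _ hz
      rw [partialDeriv, this.fderiv_eq]
      simp
    rw [h4] at h1
    exact (mul_eq_zero.mp h1).resolve_left
      (Real.sqrt_pos.mpr (posDef_coordMatrix g (mem_target_self p)).det_pos).ne'
  have hPcont : ContinuousOn (P u) S := by
    have h1 : ContinuousOn (fun y => D y / √(coordMatrix g.inner x₀ y).det) T :=
      hDcont.continuousOn.div (continuousOn_density g x₀) fun y hy => (hpos y hy).ne'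
    refine (h1.comp (continuousOn_extChartAt x₀)
      fun p hp => (extChartAt (𝓡 n) x₀).map_source hp).congr fun p hp => ?_
    have h2 := hDeq _ ((extChartAt (𝓡 n) x₀).map_source hp)
    rw [(extChartAt (𝓡 n) x₀).left_inv hp] at h2
    simp only [Function.comp_apply]
    rw [← h2, mul_div_cancel_left₀ _ (hpos _ ((extChartAt (𝓡 n) x₀).map_source hp)).ne']
  have hmeas : AEStronglyMeasurable (P u) (chartVolume g.inner x₀) := by
    rw [← volumeMeasure_restrict_source]
    exact hPcont.aestronglyMeasurable hSo.measurableSet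
  have hdens : (fun y => (ENNReal.ofReal √(coordMatrix g.inner x₀ y).det).toReal •
      P u ((extChartAt (𝓡 n) x₀).symm y)) =ᵐ[volume.restrict T] D := by
    filter_upwards [ae_restrict_mem hTo.measurableSet] with y hy
    rw [ENNReal.toReal_ofReal (Real.sqrt_nonneg _), smul_eq_mul]
    exact hDeq y hy
  have hsubset : Function.support (P u) ⊆ S := fun p hp => by
    by_contra h
    exact hp (hPsupp p h)
  constructor
  · rw [← integrableOn_iff_integrable_of_support_subset hsubset, IntegrableOn,
      volumeMeasure_restrict_source, chartVolume,
      integrable_map_measure hmeas (aemeasurable_symm g x₀),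
      integrable_withDensity_iff_integrable_smul₀' (aemeasurable_density g x₀)
        (Eventually.of_forall fun _ => ENNReal.ofReal_lt_top)]
    exact (integrable_congr hdens).mpr hDint.integrableOn
  · rw [← setIntegral_eq_integral_of_forall_compl_eq_zero hPsupp,
      volumeMeasure_restrict_source, chartVolume, integral_map (aemeasurable_symm g x₀) hmeas,
      integral_withDensity_eq_integral_toReal_smul₀ (aemeasurable_density g x₀)
        (Eventually.of_forall fun _ => ENNReal.ofReal_lt_top), integral_congr_ae hdens,
      setIntegral_eq_integral_of_forall_compl_eq_zero hDK, hDzero]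

variable [T2Space M]

/-- The divergence theorem on a closed manifold, by a partition of unity. -/
theorem integral_eq_zero (hP : HasDivergenceForm g P) {u : M → ℝ}
    (hu : ContMDiff (𝓡 n) 𝓘(ℝ, ℝ) ∞ u) :
    Integrable (P u) (volumeMeasure g.inner) ∧ ∫ x, P u x ∂(volumeMeasure g.inner) = 0 := by
  obtain ⟨ρ, hρ⟩ := SmoothPartitionOfUnity.exists_isSubordinate_chartAt_source (𝓡 n) M
  have hfin : {i | (Function.support (ρ i)).Nonempty}.Finite :=
    ρ.locallyFinite.finite_nonempty_of_compact
  set s := hfin.toFinset with hs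
  set v : M → M → ℝ := fun i => ρ i * u with hv
  have hvs : ∀ i, ContMDiff (𝓡 n) 𝓘(ℝ, ℝ) ∞ (v i) := fun i => (ρ i).contMDiff.mul hu
  have hsum : u = ∑ i ∈ s, v i := by
    funext x
    have h1 : ∑ i ∈ s, ρ i x = 1 := by
      rw [← ρ.sum_eq_one (Set.mem_univ x)]
      refine (finsum_eq_sum_of_support_subset _ fun i hi => ?_).symm
      rw [hs, Set.Finite.coe_toFinset]
      exact ⟨x, hi⟩
    rw [Finset.sum_apply]
    simp only [hv, Pi.mul_apply]
    rw [← Finset.sum_mul, h1, one_mul]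
  have hi : ∀ i, Integrable (P (v i)) (volumeMeasure g.inner) ∧
      ∫ x, P (v i) x ∂(volumeMeasure g.inner) = 0 := fun i =>
    hP.integral_eq_zero_of_tsupport_subset (hvs i) (x₀ := i) (by
      rw [extChartAt_source]
      exact (tsupport_mul_subset_left).trans (hρ i))
  have hPu : P u = ∑ i ∈ s, P (v i) := by
    conv_lhs => rw [hsum]
    exact hP.map_sum s v hvs
  rw [hPu]
  refine ⟨integrable_finsetSum' _ fun i _ => (hi i).1, ?_⟩
  simp only [Finset.sum_apply]
  rw [integral_finsetSum _ fun i _ => (hi i).1]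
  exact Finset.sum_eq_zero fun i _ => (hi i).2

end HasDivergenceForm

end

section

open Filter Topology Matrix MeasureTheory

variable {n : ℕ}

/-! ### The equations of the theorem in coordinates -/

/-- The norm induced by `G` on symmetric forms is definite: for `G⁻¹ = Bᵀ B`, the squared norm of
`A` is the sum of the squares of the entries of `B A Bᵀ`. -/
lemma trace_inner_self {G A : Matrix (Fin n) (Fin n) ℝ} (hG : G.PosDef) (hA : Aᵀ = A) :
    0 ≤ trace (G⁻¹ * A * G⁻¹ * A) ∧ (trace (G⁻¹ * A * G⁻¹ * A) = 0 → A = 0) := by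
  obtain ⟨B, hd, hB⟩ := exists_inv_eq_transpose_mul_self hG
  have h1 : trace (G⁻¹ * A * G⁻¹ * A) = ∑ i, ∑ j, (B * A * Bᵀ) i j ^ 2 := by
    have hsym : (B * A * Bᵀ)ᵀ = B * A * Bᵀ := by
      simp [Matrix.transpose_mul, hA, mul_assoc]
    have h2 : trace (G⁻¹ * A * G⁻¹ * A) = trace ((B * A * Bᵀ)ᵀ * (B * A * Bᵀ)) := by
      rw [hsym, hB]
      simp only [mul_assoc]
      rw [Matrix.trace_mul_comm]
      simp only [mul_assoc]
    rw [h2, Finset.sum_comm]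
    simp only [Matrix.trace, Matrix.diag, Matrix.mul_apply, Matrix.transpose_apply, sq]
  rw [h1]
  refine ⟨Finset.sum_nonneg fun i _ => Finset.sum_nonneg fun j _ => sq_nonneg _, fun h0 => ?_⟩
  have hC : B * A * Bᵀ = 0 := by
    ext i j
    have h3 := (Finset.sum_eq_zero_iff_of_nonneg fun i _ =>
      Finset.sum_nonneg fun j _ => sq_nonneg _).mp h0 i (Finset.mem_univ i)
    have h4 := (Finset.sum_eq_zero_iff_of_nonneg fun j _ => sq_nonneg _).mp h3 j
      (Finset.mem_univ j)
    exact pow_eq_zero_iff (two_ne_zero) |>.mp h4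
  have hd' : IsUnit Bᵀ.det := by rwa [Matrix.det_transpose]
  calc A = B⁻¹ * (B * A * Bᵀ) * (Bᵀ)⁻¹ := by
        rw [mul_assoc B, Matrix.nonsing_inv_mul_cancel_left _ _ hd,
          Matrix.mul_nonsing_inv_cancel_right _ _ hd']
    _ = 0 := by rw [hC]; simp

variable {M : Type*} [TopologicalSpace M] [ChartedSpace (EuclideanSpace ℝ (Fin n)) M]

lemma formOfCoord_sub (x : M) (A B : Matrix (Fin n) (Fin n) ℝ) (v w : TangentSpace (𝓡 n) x) :
    formOfCoord x (A - B) v w = formOfCoord x A v w - formOfCoord x B v w := by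
  simp only [formOfCoord, Matrix.sub_apply, sub_mul, Finset.sum_sub_distrib]

lemma formOfCoord_smul (x : M) (c : ℝ) (A : Matrix (Fin n) (Fin n) ℝ)
    (v w : TangentSpace (𝓡 n) x) : formOfCoord x (c • A) v w = c * formOfCoord x A v w := by
  simp only [formOfCoord, Matrix.smul_apply, smul_eq_mul, Finset.mul_sum, mul_assoc]

variable [IsManifold (𝓡 n) ∞ M]

lemma chartFrame_tangentCoord (x : M) (v : EuclideanSpace ℝ (Fin n)) :
    chartFrame x (extChartAt (𝓡 n) x x) (tangentCoord x v) = v := by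
  have h := mfderivWithin_extChartAt_symm_comp_mfderiv_extChartAt' (I := 𝓡 n)
    (mem_extChartAt_source (I := 𝓡 n) x)
  rw [← mfderiv_extChartAt_symm_eq] at h
  exact DFunLike.congr_fun h v

lemma tangentCoord_chartFrame (x : M) (w : EuclideanSpace ℝ (Fin n)) :
    tangentCoord x (chartFrame x (extChartAt (𝓡 n) x x) w) = w := by
  have h := mfderiv_extChartAt_comp_mfderivWithin_extChartAt_symm' (I := 𝓡 n)
    (mem_extChartAt_source (I := 𝓡 n) x)
  rw [← mfderiv_extChartAt_symm_eq] at h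
  exact DFunLike.congr_fun h w

/-- A tensor field is recovered from its matrix in the chart at the point. -/
lemma formOfCoord_coordMatrix (h : TwoTensorField n M) (x : M) (v w : TangentSpace (𝓡 n) x) :
    h x v w = formOfCoord x (coordMatrix h x (extChartAt (𝓡 n) x x)) v w := by
  have h1 : toBilin h x v w = toBilin h x
      (chartFrame x (extChartAt (𝓡 n) x x) (tangentCoord x v))
      (chartFrame x (extChartAt (𝓡 n) x x) (tangentCoord x w)) :=
    (congrArg₂ (fun a b => toBilin h x a b) (chartFrame_tangentCoord x v)
      (chartFrame_tangentCoord x w)).symm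
  refine h1.trans ?_
  rw [map_sum_stdDir, map_sum_stdDir _ (tangentCoord x w), bilin_sum_sum]
  simp only [formOfCoord, coordMatrix_apply, extChartAt_to_inv]

lemma formOfCoord_injective (x : M) {A B : Matrix (Fin n) (Fin n) ℝ}
    (h : ∀ v w : TangentSpace (𝓡 n) x, formOfCoord x A v w = formOfCoord x B v w) : A = B := by
  ext i j
  have h1 : ∀ C : Matrix (Fin n) (Fin n) ℝ, formOfCoord x C
      (chartFrame x (extChartAt (𝓡 n) x x) (stdDir i))
      (chartFrame x (extChartAt (𝓡 n) x x) (stdDir j)) = C i j := by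
    intro C
    simp only [formOfCoord, tangentCoord_chartFrame, stdDir]
    simp
  rw [← h1 A, ← h1 B]
  exact h _ _

variable {g : Metric n M}

lemma isEinstein_iff : IsEinstein g ↔ ∃ c : ℝ, ∀ x : M,
    ricciCoord (coordMatrix g.inner x) (extChartAt (𝓡 n) x x)
      = c • coordMatrix g.inner x (extChartAt (𝓡 n) x x) := by
  refine exists_congr fun c => forall_congr' fun x => ⟨fun h => ?_, fun h v w => ?_⟩
  · refine formOfCoord_injective x fun v w => ?_
    rw [formOfCoord_smul, ← formOfCoord_coordMatrix]
    exact h v w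
  · rw [ricci, h, formOfCoord_smul, ← formOfCoord_coordMatrix]

/-- The CPE equation says that the formal adjoint of the linearized scalar curvature maps `f` to
the trace-free Ricci tensor. -/
lemma adjointScalarCoord_eq_of_equation {f : M → ℝ} {x : M}
    (h : ∀ v w : TangentSpace (𝓡 n) x, hessian g.inner f x v w
      - laplacian g.inner f x * g.inner x v w - f x * ricci g.inner x v w
        = traceFreeRicci g.inner x v w) :
    adjointScalarCoord (coordMatrix g.inner x) (f ∘ (extChartAt (𝓡 n) x).symm)
        (extChartAt (𝓡 n) x x)
      = ricciCoord (coordMatrix g.inner x) (extChartAt (𝓡 n) x x)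
        - (scalarCurvature g.inner x / n) • coordMatrix g.inner x (extChartAt (𝓡 n) x x) := by
  refine formOfCoord_injective x fun v w => ?_
  have h1 := h v w
  rw [traceFreeRicci, formOfCoord_coordMatrix g.inner x v w] at h1
  simp only [adjointScalarCoord, formOfCoord_sub, formOfCoord_smul, Function.comp_apply,
    extChartAt_to_inv]
  exact h1

section pointwise

variable (g) (x : M)

lemma inv_mul_coordMatrix : (coordMatrix g.inner x (extChartAt (𝓡 n) x x))⁻¹ *
    coordMatrix g.inner x (extChartAt (𝓡 n) x x) = 1 :=
  Matrix.nonsing_inv_mul _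
    (isUnit_iff_ne_zero.mpr (posDef_coordMatrix g (mem_target_self x)).det_pos.ne')

lemma ricciCoord_self_symm :
    (ricciCoord (coordMatrix g.inner x) (extChartAt (𝓡 n) x x))ᵀ
      = ricciCoord (coordMatrix g.inner x) (extChartAt (𝓡 n) x x) :=
  (isMetricAt_coordMatrix g (mem_target_self x)).ricciCoord_symm
    (posDef_coordMatrix g (mem_target_self x)).det_pos

lemma sigmaTwo_eq (hn : 3 ≤ n) : sigmaTwo g.inner x
    = n / (8 * ((n : ℝ) - 1)) * scalarCurvature g.inner x ^ 2 - normSqRicci g.inner x / 2 :=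
  sigmaTwoCoord_eq hn (posDef_coordMatrix g (mem_target_self x)) (ricciCoord_self_symm g x)

lemma linearizedSigmaTwo_self (hn : 3 ≤ n) :
    linearizedSigmaTwo g.inner g.inner x = -2 * sigmaTwo g.inner x := by
  have h := (hasDerivAt_sigmaTwoCoord_self hn (posDef_coordMatrix g (mem_target_self x))
    (ricciCoord_self_symm g x)).deriv
  simp only [linearizedSigmaTwo, sigmaTwo, coordMatrix_add_smul]
  exact h

lemma linearizedSigmaTwo_of_einstein (hn : 3 ≤ n) {h : TwoTensorField n M}
    (hh : IsSmoothSymmetric h) {c : ℝ}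
    (hc : ricciCoord (coordMatrix g.inner x) (extChartAt (𝓡 n) x x)
      = c • coordMatrix g.inner x (extChartAt (𝓡 n) x x)) :
    linearizedSigmaTwo g.inner h x
      = (n / (4 * ((n : ℝ) - 1)) * (n * c) - c) * linearizedScalar g.inner h x := by
  have hx := mem_target_self (n := n) x
  have h1 := deriv_sigmaTwoCoord_of_einstein hn (isMetricAt_coordMatrix g hx)
    (posDef_coordMatrix g hx) (fun i j => hh.contDiffAt_coordMatrix hx i j)
    (Eventually.of_forall fun z => hh.transpose_coordMatrix x z) hc
  simp only [linearizedSigmaTwo, linearizedScalar, sigmaTwo, scalarCurvature, coordMatrix_add_smul]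
  exact h1

/-- `|Ric|² - R² / n` is the squared norm of the trace-free Ricci tensor, so it is nonnegative and
vanishes only where `Ric = (R / n) g`. -/
lemma traceFree_normSq (hn : 3 ≤ n) :
    0 ≤ normSqRicci g.inner x - scalarCurvature g.inner x ^ 2 / n ∧
    (normSqRicci g.inner x - scalarCurvature g.inner x ^ 2 / n = 0 →
      ricciCoord (coordMatrix g.inner x) (extChartAt (𝓡 n) x x)
        = (scalarCurvature g.inner x / n) • coordMatrix g.inner x (extChartAt (𝓡 n) x x)) := by
  have hpos := posDef_coordMatrix g (mem_target_self x)
  have hinv := inv_mul_coordMatrix g x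
  have hn0 : (n : ℝ) ≠ 0 := by positivity
  have hs : (ricciCoord (coordMatrix g.inner x) (extChartAt (𝓡 n) x x)
      - (scalarCurvature g.inner x / n) • coordMatrix g.inner x (extChartAt (𝓡 n) x x))ᵀ
      = ricciCoord (coordMatrix g.inner x) (extChartAt (𝓡 n) x x)
      - (scalarCurvature g.inner x / n) • coordMatrix g.inner x (extChartAt (𝓡 n) x x) := by
    rw [Matrix.transpose_sub, Matrix.transpose_smul, ricciCoord_self_symm,
      (isSmoothSymmetric_inner g).transpose_coordMatrix]
  obtain ⟨h1, h2⟩ := trace_inner_self hpos hs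
  have hN : normSqRicci g.inner x - scalarCurvature g.inner x ^ 2 / n = trace
      ((coordMatrix g.inner x (extChartAt (𝓡 n) x x))⁻¹ *
        (ricciCoord (coordMatrix g.inner x) (extChartAt (𝓡 n) x x)
          - (scalarCurvature g.inner x / n) • coordMatrix g.inner x (extChartAt (𝓡 n) x x)) *
        (coordMatrix g.inner x (extChartAt (𝓡 n) x x))⁻¹ *
        (ricciCoord (coordMatrix g.inner x) (extChartAt (𝓡 n) x x)
          - (scalarCurvature g.inner x / n) •
            coordMatrix g.inner x (extChartAt (𝓡 n) x x))) := by
    have hR : trace ((coordMatrix g.inner x (extChartAt (𝓡 n) x x))⁻¹ *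
        ricciCoord (coordMatrix g.inner x) (extChartAt (𝓡 n) x x)) = scalarCurvature g.inner x :=
      rfl
    have hNs : trace ((coordMatrix g.inner x (extChartAt (𝓡 n) x x))⁻¹ *
        ricciCoord (coordMatrix g.inner x) (extChartAt (𝓡 n) x x) *
        (coordMatrix g.inner x (extChartAt (𝓡 n) x x))⁻¹ *
        ricciCoord (coordMatrix g.inner x) (extChartAt (𝓡 n) x x)) = normSqRicci g.inner x := rfl
    simp only [Matrix.mul_sub, Matrix.sub_mul, Matrix.mul_smul, Matrix.smul_mul, hinv, one_mul,
      Matrix.trace_sub, Matrix.trace_smul, smul_eq_mul, hNs]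
    rw [mul_assoc _ _ (coordMatrix g.inner x (extChartAt (𝓡 n) x x)), hinv, mul_one, hR,
      Matrix.trace_one, Fintype.card_fin]
    field_simp
    ring
  rw [hN]
  exact ⟨h1, fun h => sub_eq_zero.mp (h2 h)⟩

variable {f : M → ℝ} (h : adjointScalarCoord (coordMatrix g.inner x)
    (f ∘ (extChartAt (𝓡 n) x).symm) (extChartAt (𝓡 n) x x)
  = ricciCoord (coordMatrix g.inner x) (extChartAt (𝓡 n) x x)
    - (scalarCurvature g.inner x / n) • coordMatrix g.inner x (extChartAt (𝓡 n) x x))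
include h

/-- The trace of the CPE equation. -/
lemma laplacian_of_adjointScalarCoord (hn : 3 ≤ n) :
    ((n : ℝ) - 1) * laplacian g.inner f x = -(f x * scalarCurvature g.inner x) := by
  have hinv := inv_mul_coordMatrix g x
  have hn0 : (n : ℝ) ≠ 0 := by positivity
  have h1 := congrArg (fun A => trace ((coordMatrix g.inner x (extChartAt (𝓡 n) x x))⁻¹ * A)) h
  have hL : trace ((coordMatrix g.inner x (extChartAt (𝓡 n) x x))⁻¹ *
      hessianCoord (coordMatrix g.inner x) (f ∘ (extChartAt (𝓡 n) x).symm) (extChartAt (𝓡 n) x x))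
      = laplacian g.inner f x := rfl
  have hR : trace ((coordMatrix g.inner x (extChartAt (𝓡 n) x x))⁻¹ *
      ricciCoord (coordMatrix g.inner x) (extChartAt (𝓡 n) x x)) = scalarCurvature g.inner x := rfl
  simp only [adjointScalarCoord, Matrix.mul_sub, Matrix.mul_smul, hinv, Matrix.trace_sub,
    Matrix.trace_smul, smul_eq_mul, Matrix.trace_one, Fintype.card_fin, hL, hR,
    Function.comp_apply, extChartAt_to_inv, div_mul_cancel₀ _ hn0] at h1
  linarith

/-- The inner product of the CPE equation with the Ricci tensor. -/
lemma ricInnerHess_of_adjointScalarCoord (hn : 3 ≤ n) :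
    ricInnerHess g.inner f x
      = (1 + f x) * (normSqRicci g.inner x - scalarCurvature g.inner x ^ 2 / n)
        - f x * scalarCurvature g.inner x ^ 2 / (n * ((n : ℝ) - 1)) := by
  have hinv := inv_mul_coordMatrix g x
  have hn0 : (n : ℝ) ≠ 0 := by positivity
  have hn1 : (n : ℝ) - 1 ≠ 0 := by
    have : (3 : ℝ) ≤ n := by exact_mod_cast hn
    linarith
  have hlap := laplacian_of_adjointScalarCoord g x h hn
  have h1 := congrArg (fun A => trace ((coordMatrix g.inner x (extChartAt (𝓡 n) x x))⁻¹ *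
    ricciCoord (coordMatrix g.inner x) (extChartAt (𝓡 n) x x) *
    (coordMatrix g.inner x (extChartAt (𝓡 n) x x))⁻¹ * A)) h
  have hL : trace ((coordMatrix g.inner x (extChartAt (𝓡 n) x x))⁻¹ *
      hessianCoord (coordMatrix g.inner x) (f ∘ (extChartAt (𝓡 n) x).symm) (extChartAt (𝓡 n) x x))
      = laplacian g.inner f x := rfl
  have hR : trace ((coordMatrix g.inner x (extChartAt (𝓡 n) x x))⁻¹ *
      ricciCoord (coordMatrix g.inner x) (extChartAt (𝓡 n) x x)) = scalarCurvature g.inner x := rfl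
  have hN : trace ((coordMatrix g.inner x (extChartAt (𝓡 n) x x))⁻¹ *
      ricciCoord (coordMatrix g.inner x) (extChartAt (𝓡 n) x x) *
      (coordMatrix g.inner x (extChartAt (𝓡 n) x x))⁻¹ *
      ricciCoord (coordMatrix g.inner x) (extChartAt (𝓡 n) x x)) = normSqRicci g.inner x := rfl
  have hG : trace ((coordMatrix g.inner x (extChartAt (𝓡 n) x x))⁻¹ *
      ricciCoord (coordMatrix g.inner x) (extChartAt (𝓡 n) x x) *
      (coordMatrix g.inner x (extChartAt (𝓡 n) x x))⁻¹ *
      coordMatrix g.inner x (extChartAt (𝓡 n) x x)) = scalarCurvature g.inner x := by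
    rw [mul_assoc _ _ (coordMatrix g.inner x (extChartAt (𝓡 n) x x)), hinv, mul_one, hR]
  simp only [adjointScalarCoord, Matrix.mul_sub, Matrix.mul_smul, Matrix.trace_sub,
    Matrix.trace_smul, smul_eq_mul, hL, hN, hG, Function.comp_apply, extChartAt_to_inv] at h1
  change ricInnerHess g.inner f x - _ - _ = _ at h1
  have hl : laplacian g.inner f x = -(f x * scalarCurvature g.inner x) / ((n : ℝ) - 1) := by
    rw [← hlap, mul_div_cancel_left₀ _ hn1]
  rw [hl] at h1
  have h2 : ricInnerHess g.inner f x = -(f x * scalarCurvature g.inner x) / ((n : ℝ) - 1)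
      * scalarCurvature g.inner x + f x * normSqRicci g.inner x + (normSqRicci g.inner x
        - scalarCurvature g.inner x / n * scalarCurvature g.inner x) := by linarith
  rw [h2]
  field_simp
  ring

end pointwise

/-- Near `x₀` the function is read in the fixed chart at `x₀`, whereas its definition uses the chart
at each point. -/
lemma continuous_normSqRicci (g : Metric n M) : Continuous (normSqRicci g.inner) := by
  rw [continuous_iff_continuousAt]
  intro x₀
  have hx := mem_target_self (n := n) x₀
  have hm := isMetricAt_coordMatrix g hx
  have h1 : ContinuousAt (fun z => (coordMatrix g.inner x₀ z)⁻¹) (extChartAt (𝓡 n) x₀ x₀) :=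
    continuousAt_pi.mpr fun i => continuousAt_pi.mpr fun j =>
      (hm.contDiffAt_inv i j).continuousAt
  have h2 : ContinuousAt (ricciCoord (coordMatrix g.inner x₀)) (extChartAt (𝓡 n) x₀ x₀) :=
    continuousAt_pi.mpr fun i => continuousAt_pi.mpr fun j =>
      (hm.contDiffAt_ricciCoord i j).continuousAt
  have h3 : ContinuousAt (normSqRicciCoord (coordMatrix g.inner x₀)) (extChartAt (𝓡 n) x₀ x₀) :=
    ((continuous_id.matrix_trace).continuousAt).comp (((h1.mul h2).mul h1).mul h2)
  refine (ContinuousAt.comp (f := extChartAt (𝓡 n) x₀) h3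
    (continuousAt_extChartAt x₀)).congr ?_
  filter_upwards [extChartAt_source_mem_nhds (I := 𝓡 n) x₀] with p hp
  exact (normSqRicci_eq hp g).symm

end

section

open Filter Topology Matrix MeasureTheory

variable {n : ℕ} {M : Type*} [TopologicalSpace M] [ChartedSpace (EuclideanSpace ℝ (Fin n)) M]

/-! ### Einstein metrics and the kernel of the adjoint -/

lemma tensorInner_zero (g h : TwoTensorField n M) (x : M) : tensorInner g 0 h x = 0 := by
  simp [tensorInner, coordMatrix_zero]

variable [IsManifold (𝓡 n) ∞ M] [T2Space M] [CompactSpace M] [MeasurableSpace M] [BorelSpace M]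
  {g : Metric n M} {f : M → ℝ}

/-- If `g` is Einstein, `Λ_g` is a constant multiple of the linearized scalar curvature, whose
formal adjoint maps `f` to the trace-free Ricci tensor, that is, to zero. -/
theorem IsCPE.memKerAdjoint_of_isEinstein (hn : 3 ≤ n) (hcpe : IsCPE g f) (hE : IsEinstein g) :
    MemKerAdjoint g f := by
  obtain ⟨c, hc⟩ := isEinstein_iff.mp hE
  have hn0 : (n : ℝ) ≠ 0 := by positivity
  refine ⟨hcpe.smooth, isSmoothSymmetric_zero, fun h hh => ?_⟩
  have hR : ∀ x, scalarCurvature g.inner x = c * n := fun x => by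
    rw [scalarCurvature, scalarCoord, hc, Matrix.mul_smul, inv_mul_coordMatrix, Matrix.trace_smul,
      Matrix.trace_one, Fintype.card_fin, smul_eq_mul]
  have hL : ∀ x, f x * linearizedSigmaTwo g.inner h x
      = (n / (4 * ((n : ℝ) - 1)) * (n * c) - c) * adjointDefect g.inner h f x := by
    intro x
    have h1 := adjointScalarCoord_eq_of_equation (hcpe.equation x)
    rw [hc, hR, mul_div_cancel_right₀ _ hn0, sub_self] at h1
    rw [linearizedSigmaTwo_of_einstein g x hn hh (hc x), adjointDefect, h1]
    simp only [Matrix.mul_zero, Matrix.zero_mul, Matrix.trace_zero]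
    ring
  simp only [tensorInner_zero, hL, integral_zero]
  rw [integral_const_mul, ((hasDivergenceForm_adjointDefect g hh).integral_eq_zero hcpe.smooth).2,
    mul_zero]

/-- Testing `Λ_g^*(f) = 0` against `g` itself gives `∫ f σ₂ = 0`; together with the integrals of
`Δf` and `⟨Ric, ∇²f⟩`, which vanish, this forces the trace-free Ricci tensor to vanish. -/
theorem IsCPE.isEinstein_of_memKerAdjoint (hn : 3 ≤ n) (hcpe : IsCPE g f)
    (hker : MemKerAdjoint g f) : IsEinstein g := by
  obtain ⟨R, hR⟩ := hcpe.scalar_const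
  have hn1 : (n : ℝ) - 1 ≠ 0 := by
    have : (3 : ℝ) ≤ n := by exact_mod_cast hn
    linarith
  set μ := volumeMeasure g.inner with hμ
  have : IsFiniteMeasure μ := ⟨by rw [hcpe.volume_eq_one]; exact ENNReal.one_lt_top⟩
  have hopen : μ.IsOpenPosMeasure := isOpenPosMeasure_volumeMeasure g
  have hint : ∀ {u : M → ℝ}, Continuous u → Integrable u μ := fun hu =>
    hu.integrable_of_hasCompactSupport (HasCompactSupport.of_compactSpace _)
  have hfc : Continuous f := hcpe.smooth.continuous
  set N : M → ℝ := fun x => normSqRicci g.inner x - R ^ 2 / n with hN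
  have hNc : Continuous N := (continuous_normSqRicci g).sub continuous_const
  have hfN : Integrable (fun x => f x * N x) μ := hint (hfc.mul hNc)
  have hRf : ∀ a : ℝ, Integrable (fun x => a * (R * f x)) μ := fun a =>
    hint (continuous_const.mul (continuous_const.mul hfc))
  have hadj := fun x => adjointScalarCoord_eq_of_equation (hcpe.equation x)
  have hNx := fun x => traceFree_normSq g x hn
  simp only [hR] at hNx
  -- `∫ Δf = 0`
  have hA : R * ∫ x, f x ∂μ = 0 := by
    have h1 := ((hasDivergenceForm_laplacian g).integral_eq_zero hcpe.smooth).2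
    have h2 : ∀ x, laplacian g.inner f x = -(R / ((n : ℝ) - 1)) * f x := fun x => by
      have h3 := laplacian_of_adjointScalarCoord g x (hadj x) hn
      rw [hR] at h3
      field_simp
      linarith
    simp only [h2] at h1
    rw [integral_const_mul] at h1
    field_simp at h1
    linarith
  -- `∫ ⟨Ric, ∇²f⟩ = 0`
  have hB : ∫ x, N x ∂μ + ∫ x, f x * N x ∂μ = 0 := by
    have h1 := ((hasDivergenceForm_ricInnerHess g hR).integral_eq_zero hcpe.smooth).2
    have h2 : ∀ x, ricInnerHess g.inner f x
        = N x + f x * N x - R / (n * ((n : ℝ) - 1)) * (R * f x) := fun x => by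
      rw [ricInnerHess_of_adjointScalarCoord g x (hadj x) hn, hR]
      simp only [hN]
      ring
    simp only [h2] at h1
    rw [integral_sub (f := fun x => N x + f x * N x) ((hint hNc).add hfN) (hRf _),
      integral_add (hint hNc) hfN, integral_const_mul, integral_const_mul, hA,
      mul_zero, sub_zero] at h1
    exact h1
  -- `∫ f σ₂ = 0`
  have hC : ∫ x, f x * N x ∂μ = 0 := by
    have h1 := hker.2.2 g.inner (isSmoothSymmetric_inner g)
    have h2 : ∀ x, f x * linearizedSigmaTwo g.inner g.inner x
        = f x * N x - (n / (4 * ((n : ℝ) - 1)) - 1 / n) * R * (R * f x) := fun x => by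
      rw [linearizedSigmaTwo_self g x hn, sigmaTwo_eq g x hn, hR]
      simp only [hN]
      field_simp
      ring
    simp only [tensorInner_zero, integral_zero, h2] at h1
    rw [integral_sub hfN (hRf _), integral_const_mul,
      integral_const_mul, hA, mul_zero, sub_zero] at h1
    exact h1.symm
  rw [hC, add_zero, integral_eq_zero_iff_of_nonneg (fun x => (hNx x).1) (hint hNc),
    hNc.ae_eq_iff_eq μ continuous_zero] at hB
  refine isEinstein_iff.mpr ⟨R / n, fun x => ?_⟩
  exact (hNx x).2 (congrFun hB x)

end

end CPESigma2

end

theorem mainTheorem1 {n : ℕ} (hn : 3 ≤ n) {M : Type*} [TopologicalSpace M] [T2Space M]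
    [CompactSpace M] [ChartedSpace (EuclideanSpace ℝ (Fin n)) M] [IsManifold (𝓡 n) ∞ M]
    [MeasurableSpace M] [BorelSpace M]
    (g : CPESigma2.Metric n M) (f : M → ℝ) (hcpe : CPESigma2.IsCPE g f)
    (hf : ¬ ∃ c : ℝ, ∀ x : M, f x = c) :
    (CPESigma2.IsEinstein g ↔ CPESigma2.MemKerAdjoint g f) ∧
    (CPESigma2.IsEinstein g ↔ CPESigma2.IsSigmaTwoSingular g f) := by
  have h : CPESigma2.IsEinstein g ↔ CPESigma2.MemKerAdjoint g f :=
    ⟨hcpe.memKerAdjoint_of_isEinstein hn, hcpe.isEinstein_of_memKerAdjoint hn⟩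
  have hf0 : f ≠ 0 := fun h0 => hf ⟨0, congrFun h0⟩
  exact ⟨h, h.trans ⟨fun hk => ⟨hk, hf0⟩, fun hs => hs.1⟩⟩
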